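/- Let $g\ge 1$ and let $\mathbb H_g$ be the Siegel upper half-space of symmetric complex $g\times g$ matrices $\tau$ with positive definite imaginary part. Let $\mathcal A_g=\mathbb H_g/\operatorname{Sp}(g,\mathbb Z)$ be the moduli space of principally polarized abelian varieties, where $\sigma=\begin{pmatrix}a&b\\c&d\end{pmatrix}$ acts by $\sigma\cdot\tau=(a\tau+b)(c\tau+d)^{-1}$. For $\varepsilon,\delta\in(\mathbb Z/2\mathbb Z)^g$, regarded as vectors of zeros and ones, put $$\theta[\varepsilon,\delta](\tau,z)=\sum_{m\in\mathbb Z^g}\exp \pi i\Big[{}^t\big(m+\tfrac{\varepsilon}{2}\big)\tau\big(m+\tfrac{\varepsilon}{2}\big)+2\,{}^t\big(m+\tfrac{\varepsilon}{2}\big)\big(z+\tfrac{\delta}{2}\big)\Big],\qquad \theta=\theta[0,0],$$ and call $[\varepsilon,\delta]$ even if $\varepsilon\cdot\delta=0$ in $\mathbb Z/2\mathbb Z$. Let $$\theta_{\rm null}^{g-1}=\Big\{\tau\in\mathbb H_g:\ \exists\,[\varepsilon,\delta]\text{ even},\ \theta[\varepsilon,\delta](\tau,0)=0,\ \operatorname{rk}\Big(\frac{\partial^2\theta[\varepsilon,\delta]}{\partial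 z_j\partial z_k}(\tau,0)\Big)_{j,k}\le g-1\Big\},$$ and denote its image in $\mathcal A_g$ in the same way. Let $\mathcal X$ be the universal family of the abelian varieties $A_\tau=\mathbb C^g/(\tau\mathbb Z^g+\mathbb Z^g)$ over $\mathbb H_g$, with local coordinates $\tau_{ij}$ ($i\le j$) and $z_1,\dots,z_g$, and let $p:\mathcal X\to\mathbb H_g$ and $\pi:\mathcal X\to\mathbb H_g\to\mathcal A_g$ be the projections. Let $\mathcal S\subset\mathcal X$ be the locus of singular points of the theta divisors, that is, the complex analytic subspace defined locally by the $g+1$ equations $$\theta(\tau,z)=0,\qquad \frac{\partial\theta}{\partial z_i}(\tau,z)=0\quad(i=1,\dots,g).$$ Let $\mathcal S_{\rm null}\subset\mathcal S$ be the set of the points $\big(\tau,\tfrac{\tau\varepsilon+\delta}{2}\big)$, with $[\varepsilon,\delta]$ even, that lie on the theta divisor. Let $\operatorname{Sing}\mathcal S$ be the set of singular points of $\mathcal S$, that is, of the points of $\mathcal S$ near which the $g+1$ equations do not generate the ideal of a complex submanifold (of any codimension). Then, as sets, $$\theta_{\rm null}^{g-1}=p(\mathcal S_{\rm null}\cap\operatorname{Sing}\mathcal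 S)\ \text{ in } \mathbb H_g,\qquad\text{and hence}\qquad \theta_{\rm null}^{g-1}=\pi(\mathcal S_{\rm null}\cap\operatorname{Sing}\mathcal S)\ \text{ in }\mathcal A_g .$$ -/

import Mathlib

open scoped Topology

noncomputable section

namespace ThetaNull

/-- Coordinates `τ_{ij} = τ_{ji}` on the space of complex symmetric `g × g` matrices: one
complex number for each unordered pair `{i, j}`. -/
abbrev SymCoord (g : ℕ) : Type := Sym2 (Fin g) → ℂ

/-- The symmetric matrix with the given coordinates. -/
def symMatrix {g : ℕ} (t : SymCoord g) : Matrix (Fin g) (Fin g) ℂ :=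
  Matrix.of fun i j => t s(i, j)

/-- The Siegel upper half-space `ℍ_g`: complex symmetric `g × g` matrices with positive definite
imaginary part. -/
def Siegel (g : ℕ) : Type :=
  {t : SymCoord g // ((symMatrix t).map Complex.im).PosDef}

/-- The period matrix `τ` of a point of the Siegel upper half-space. -/
def Siegel.mat {g : ℕ} (τ : Siegel g) : Matrix (Fin g) (Fin g) ℂ := symMatrix τ.1

/-- `τ'` is in the relation to `τ` if `τ' = σ · τ = (aτ + b)(cτ + d)⁻¹` for some
`σ = (a b; c d)` in `Sp(g, ℤ)`; the matrix `cτ + d` is invertible for every `τ` in `ℍ_g`. -/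
def SympRel (g : ℕ) (τ τ' : Siegel g) : Prop :=
  ∃ σ : Matrix (Fin g ⊕ Fin g) (Fin g ⊕ Fin g) ℤ, σ ∈ Matrix.symplecticGroup (Fin g) ℤ ∧
    τ'.mat =
      (σ.toBlocks₁₁.map (Int.cast : ℤ → ℂ) * τ.mat + σ.toBlocks₁₂.map (Int.cast : ℤ → ℂ)) *
      (σ.toBlocks₂₁.map (Int.cast : ℤ → ℂ) * τ.mat + σ.toBlocks₂₂.map (Int.cast : ℤ → ℂ))⁻¹

/-- The moduli space `𝒜_g = ℍ_g / Sp(g, ℤ)` of ppavs. -/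
def Moduli (g : ℕ) : Type := Quot (SympRel g)

/-- The quotient map `ℍ_g → 𝒜_g`. -/
def toModuli {g : ℕ} (τ : Siegel g) : Moduli g := Quot.mk _ τ

/-- A characteristic in `(ℤ/2ℤ)^g`, thought of as a complex vector of zeros and ones. -/
def charVec {g : ℕ} (ε : Fin g → ZMod 2) : Fin g → ℂ := fun i => ((ε i).val : ℂ)

/-- The theta function with characteristic `[ε, δ]`,
`∑_{m ∈ ℤ^g} exp πi [ᵗ(m + ε/2) τ (m + ε/2) + 2 ᵗ(m + ε/2) (z + δ/2)]`.
It is used only for `τ` in `ℍ_g`, where the series converges absolutely. -/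
def thetaChar {g : ℕ} (ε δ : Fin g → ZMod 2) (t : SymCoord g) (z : Fin g → ℂ) : ℂ :=
  ∑' m : Fin g → ℤ,
    let n : Fin g → ℂ := fun i => (m i : ℂ) + charVec ε i / 2
    let w : Fin g → ℂ := fun i => z i + charVec δ i / 2
    Complex.exp (Real.pi * Complex.I * (n ⬝ᵥ (symMatrix t).mulVec n + 2 * (n ⬝ᵥ w)))

/-- The Riemann theta function: the theta function with characteristic `[0, 0]`. -/
def theta {g : ℕ} (t : SymCoord g) (z : Fin g → ℂ) : ℂ := thetaChar 0 0 t z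

/-- A characteristic `[ε, δ]` is even if `ε · δ = 0` in `ℤ/2ℤ`. -/
def IsEvenChar {g : ℕ} (ε δ : Fin g → ZMod 2) : Prop := ε ⬝ᵥ δ = 0

/-- The partial derivative `∂F/∂z_i` of a function on `ℂ^g`. -/
def partialZ {g : ℕ} (i : Fin g) (F : (Fin g → ℂ) → ℂ) (z : Fin g → ℂ) : ℂ :=
  fderiv ℂ F z (Pi.single i 1)

/-- The matrix of second partial derivatives `∂²F/∂z_j∂z_k`. -/
def hessian {g : ℕ} (F : (Fin g → ℂ) → ℂ) (z : Fin g → ℂ) : Matrix (Fin g) (Fin g) ℂ :=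
  Matrix.of fun j k => partialZ j (partialZ k F) z

/-- The locus `θ_null^h` in `ℍ_g`. -/
def thetaNull (g h : ℕ) : Set (Siegel g) :=
  {τ | ∃ ε δ : Fin g → ZMod 2, IsEvenChar ε δ ∧ thetaChar ε δ τ.1 0 = 0 ∧
    (hessian (thetaChar ε δ τ.1) 0).rank ≤ h}

/-- The locus `θ_null^h` in the moduli space `𝒜_g`. -/
def thetaNullModuli (g h : ℕ) : Set (Moduli g) := toModuli '' thetaNull g h

/-- The homomorphism `(m, n) ↦ τ m + n` from `ℤ^g × ℤ^g` to `ℂ^g`. -/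
def periodHom {g : ℕ} (τ : Siegel g) : (Fin g → ℤ) × (Fin g → ℤ) →+ (Fin g → ℂ) where
  toFun mn := τ.mat.mulVec (fun i => (mn.1 i : ℂ)) + fun i => (mn.2 i : ℂ)
  map_zero' := by
    ext i
    simp [Matrix.mulVec, dotProduct]
  map_add' p q := by
    ext i
    simp [Matrix.mulVec, dotProduct, mul_add, Finset.sum_add_distrib]
    ring

/-- The abelian variety `A_τ = ℂ^g / (τ ℤ^g + ℤ^g)`. -/
abbrev AbVar {g : ℕ} (τ : Siegel g) : Type := (Fin g → ℂ) ⧸ (periodHom τ).range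

/-- The universal family over `ℍ_g`: pairs of a `τ` and a point of `A_τ`. It is the quotient of
`ℍ_g × ℂ^g` by a free and properly discontinuous action of `ℤ^g × ℤ^g`, and so has the `τ_{ij}`
and the `z_i` as local coordinates. -/
def UnivFamily (g : ℕ) : Type := Σ τ : Siegel g, AbVar τ

/-- The point `(τ, z)` of the universal family. -/
def UnivFamily.point {g : ℕ} (τ : Siegel g) (z : Fin g → ℂ) : UnivFamily g :=
  ⟨τ, (QuotientAddGroup.mk z : AbVar τ)⟩

/-- The projection of the universal family to `ℍ_g`. -/
def UnivFamily.toSiegel {g : ℕ} (x : UnivFamily g) : Siegel g := x.1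

/-- The projection `π` of the universal family to `𝒜_g`. -/
def UnivFamily.proj {g : ℕ} (x : UnivFamily g) : Moduli g := toModuli x.toSiegel

/-- The `g + 1` functions `θ, ∂θ/∂z_1, …, ∂θ/∂z_g` of `(τ, z)`. -/
def singEq (g : ℕ) : Option (Fin g) → SymCoord g × (Fin g → ℂ) → ℂ
  | none => fun p => theta p.1 p.2
  | some i => fun p => partialZ i (theta p.1) p.2

/-- The locus `𝒮` of the singular points of theta divisors. -/
def singLocus (g : ℕ) : Set (UnivFamily g) :=
  {x | ∃ (τ : Siegel g) (z : Fin g → ℂ), x = UnivFamily.point τ z ∧ ∀ i, singEq g i (τ.1, z) = 0}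

/-- The locus `𝒮_null` of the even points of order two `(τ ε + δ)/2` that lie on the theta
divisor. -/
def singNull (g : ℕ) : Set (UnivFamily g) :=
  {x | ∃ (τ : Siegel g) (ε δ : Fin g → ZMod 2), IsEvenChar ε δ ∧
    x = UnivFamily.point τ ((1 / 2 : ℂ) • (τ.mat.mulVec (charVec ε) + charVec δ)) ∧
    theta τ.1 ((1 / 2 : ℂ) • (τ.mat.mulVec (charVec ε) + charVec δ)) = 0}

/-- In the ring of germs at `p` of holomorphic functions, every `f i` lies in the ideal generated
by the `u j`. -/
def GermsInIdeal {E : Type*} [NormedAddCommGroup E] [NormedSpace ℂ E] {ι κ : Type*} [Fintype κ]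
    (f : ι → E → ℂ) (u : κ → E → ℂ) (p : E) : Prop :=
  ∀ i, ∃ a : κ → E → ℂ, (∀ j, AnalyticAt ℂ (a j) p) ∧ ∀ᶠ x in 𝓝 p, f i x = ∑ j, a j x * u j x

/-- The analytic space `{f = 0}` cut out by holomorphic functions `f i` is nonsingular at its point
`p`: the `f i` generate, in the ring of germs at `p`, the ideal of a complex submanifold through `p`
of some codimension `k`, i.e. the same ideal as `k` holomorphic functions that vanish at `p` and
have linearly independent differentials at `p` (part of a system of local coordinates). -/
def IsNonsingularAt {E : Type*} [NormedAddCommGroup E] [NormedSpace ℂ E] {ι : Type*} [Fintype ι]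
    (f : ι → E → ℂ) (p : E) : Prop :=
  ∃ (k : ℕ) (u : Fin k → E → ℂ), (∀ j, AnalyticAt ℂ (u j) p) ∧ (∀ j, u j p = 0) ∧
    LinearIndependent ℂ (fun j => fderiv ℂ (u j) p) ∧
    GermsInIdeal f u p ∧ GermsInIdeal u f p

/-- `Sing 𝒮`: the points of `𝒮` at which the analytic space defined by the `g + 1` equations
`θ = ∂θ/∂z_1 = ⋯ = ∂θ/∂z_g = 0` in the local coordinates `(τ, z)` is singular. -/
def singOfSingLocus (g : ℕ) : Set (UnivFamily g) :=
  {x | ∃ (τ : Siegel g) (z : Fin g → ℂ), x = UnivFamily.point τ z ∧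
    (∀ i, singEq g i (τ.1, z) = 0) ∧ ¬ IsNonsingularAt (singEq g) (τ.1, z)}

end ThetaNull

end

/-! Translation by the half-period `(τε + δ)/2` turns `θ` into a unit times `F = θ[ε, δ]`, so the
question concerns the ideal `I = (F, ∂₁F, …, ∂_gF)` at `(τ, 0)`. There `F` is even in `z`, so all
its odd `z`-derivatives vanish, and the heat equation turns `τ`-derivatives into second
`z`-derivatives. Write `A` for the Hessian of `F` at `(τ, 0)`.

If `A` is nondegenerate, `dF` involves only the `dτ` and the `d(∂ᵢF)` only the `dz`, both with
coefficients taken from `A`. The `g + 1` differentials are independent and `𝒮` is smooth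
(`isNonsingularAt_of_nondegenerate`).

Conversely, let `Aκ = 0` with `κ ≠ 0` and suppose that `𝒮` is smooth at `(τ, 0)`. The differential
of `∂_κF` vanishes there: its `z`-part is `Aκ`, and its `τ`-part consists of third derivatives. By
smoothness `∂_κF` lies in `𝔪I`, that is `∂_κF = b₀F + Σ bᵢ∂ᵢF` with all `b` zero at the point
(`exists_kernel_identity`). Differentiating in `z` and in `τ` gives a linear differential inequality
for `(F, dF, D²F·κ)` along `ℝκ`. Gronwall's inequality and analytic continuation show that `F` and
`dF` vanish on all of `ℂκ` and that `D²F` stays proportional to `A` there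
(`thetaSum_vanish_on_kernel_line`).

Smoothness is an open condition, so the same holds for nearby `τ` in the divisor `F(τ, 0) = 0`, with
a kernel vector that varies with `τ`. Differentiating along a curve in this divisor with tangent `κ
ᵗe + e ᵗκ`, where `e` is a basis vector, gives `ψ' = 2βzψ` for a nonzero Hessian entry `ψ(z)` on
`ℂκ`. So `ψ` is a constant times `exp(βz²)` (`exists_gaussian_hessian`).

This contradicts quasi-periodicity. Multiples `nζκ` return arbitrarily close to periods `τa + m`,
where the factor of automorphy has size about `exp(π ᵗa Im(τ) a)`. Hence `Re(βζ²) ≥ 0`, and equality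
forces `ζκ` to be a real vector (`gaussian_growth`). Taking `ζ = 1` and `ζ = i` gives `Re β = 0`, so
`κ` and `iκ` are both real and `κ = 0`. -/

noncomputable section

namespace ThetaNull

set_option maxSynthPendingDepth 3

/-! ### Exponential series with linear exponents: analyticity and termwise differentiation -/

section ExpSum

variable {ι E : Type*} [NormedAddCommGroup E] [NormedSpace ℂ E]

/-- The sum of the exponential series `∑ c_m exp(ℓ_m x)` with linear exponents. -/
def expSum (c : ι → ℂ) (l : ι → E →L[ℂ] ℂ) (x : E) : ℂ := ∑' m, c m * Complex.exp (l m x)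

/-- Absolute convergence of an exponential series on a ball around `x`. -/
def ExpSummableAt (c : ι → ℂ) (l : ι → E →L[ℂ] ℂ) (x : E) : Prop :=
  ∃ r : ℝ, 0 < r ∧ Summable fun m => ‖c m‖ * Real.exp ((l m x).re + r * ‖l m‖)

/-- The `n`-th power of a linear form, as a multilinear map. -/
def powForm (n : ℕ) (f : E →L[ℂ] ℂ) : ContinuousMultilinearMap ℂ (fun _ : Fin n => E) ℂ :=
  (ContinuousMultilinearMap.mkPiAlgebraFin ℂ n ℂ).compContinuousLinearMap fun _ => f

lemma powForm_apply (n : ℕ) (f : E →L[ℂ] ℂ) (v : Fin n → E) :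
    powForm n f v = ∏ i, f (v i) := by
  simp [powForm, List.prod_ofFn]

lemma norm_powForm_le (n : ℕ) (f : E →L[ℂ] ℂ) : ‖powForm n f‖ ≤ ‖f‖ ^ n := by
  refine ContinuousMultilinearMap.opNorm_le_bound (by positivity) fun v => ?_
  rw [powForm_apply, norm_prod, ← Fin.prod_const, ← Finset.prod_mul_distrib]
  exact Finset.prod_le_prod (fun _ _ => norm_nonneg _) fun i _ => f.le_opNorm _

/-- The Taylor series of an exponential series. -/
def expSeries (c : ι → ℂ) (l : ι → E →L[ℂ] ℂ) (x : E) : FormalMultilinearSeries ℂ E ℂ :=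
  fun n => ∑' m, (c m * Complex.exp (l m x) * (n.factorial : ℂ)⁻¹) • powForm n (l m)

/-- Summing over the degree first reassembles `exp (r‖l m‖)`, so the hypothesis is exactly absolute
summability of the double series. This licenses every later interchange of the sum over `m` with the
Taylor expansion. -/
lemma ExpSummableAt.summable_prod {c : ι → ℂ} {l : ι → E →L[ℂ] ℂ} {x : E} {r : ℝ} (hr : 0 < r)
    (h : Summable fun m => ‖c m‖ * Real.exp ((l m x).re + r * ‖l m‖)) :
    Summable fun q : ι × ℕ =>
      ‖c q.1 * Complex.exp (l q.1 x) * (q.2.factorial : ℂ)⁻¹‖ * (r * ‖l q.1‖) ^ q.2 := by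
  have key : ∀ m, HasSum (fun n : ℕ => ‖c m * Complex.exp (l m x) * (n.factorial : ℂ)⁻¹‖ *
      (r * ‖l m‖) ^ n) (‖c m‖ * Real.exp ((l m x).re + r * ‖l m‖)) := by
    intro m
    have := (NormedSpace.expSeries_div_hasSum_exp (r * ‖l m‖)).mul_left
      (‖c m‖ * Real.exp ((l m x).re))
    rw [← Real.exp_eq_exp_ℝ] at this
    rw [Real.exp_add, ← mul_assoc]
    refine this.congr_fun fun n => ?_
    simp [Complex.norm_exp]
    ring
  refine (summable_prod_of_nonneg fun q => by positivity).2 ⟨fun m => (key m).summable, ?_⟩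
  simpa only [(key _).tsum_eq] using h

/-- Each factor `exp (l m y)` is expanded in powers of `l m y`, and the double sum is regrouped by
degree. -/
lemma expSum_hasFPowerSeriesAt {c : ι → ℂ} {l : ι → E →L[ℂ] ℂ} {x : E}
    (h : ExpSummableAt c l x) : HasFPowerSeriesAt (expSum c l) (expSeries c l x) x := by
  obtain ⟨r, hr, h⟩ := h
  have hs := ExpSummableAt.summable_prod hr h
  have hs' := hs.prod_symm
  have hterm : ∀ (n : ℕ) m, ‖(c m * Complex.exp (l m x) * (n.factorial : ℂ)⁻¹) •
      powForm n (l m)‖ * r ^ n ≤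
      ‖c m * Complex.exp (l m x) * (n.factorial : ℂ)⁻¹‖ * (r * ‖l m‖) ^ n := by
    intro n m
    rw [norm_smul, mul_pow, mul_assoc, mul_comm (r ^ n)]
    gcongr
    exact norm_powForm_le _ _
  have hsum : ∀ n : ℕ, Summable fun m =>
      ‖(c m * Complex.exp (l m x) * (n.factorial : ℂ)⁻¹) • powForm n (l m)‖ := by
    intro n
    have h1 : Summable fun m => ‖(c m * Complex.exp (l m x) * (n.factorial : ℂ)⁻¹) •
      powForm n (l m)‖ * r ^ n :=
      Summable.of_nonneg_of_le (fun m => by positivity) (hterm n) (hs'.prod_factor n)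
    exact (summable_mul_right_iff (by positivity)).1 h1
  lift r to NNReal using hr.le
  refine ⟨(r : ENNReal), ?_, by simpa using hr, ?_⟩
  · refine FormalMultilinearSeries.le_radius_of_bound _
      (∑' q : ℕ × ι, ‖c q.2 * Complex.exp (l q.2 x) * (q.1.factorial : ℂ)⁻¹‖ *
        (r * ‖l q.2‖) ^ q.1) fun n => ?_
    have h2 : ‖expSeries c l x n‖ * (r : ℝ) ^ n ≤ ∑' m,
        ‖c m * Complex.exp (l m x) * (n.factorial : ℂ)⁻¹‖ * (r * ‖l m‖) ^ n := by
      refine (mul_le_mul_of_nonneg_right (norm_tsum_le_tsum_norm (hsum n)) (by positivity)).trans ?_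
      rw [← tsum_mul_right]
      exact ((hsum n).mul_right _).tsum_le_tsum (hterm n) (hs'.prod_factor n)
    refine h2.trans ?_
    have := hs'.prod.le_tsum n (fun j _ => tsum_nonneg fun m => by positivity)
    rwa [← hs'.tsum_prod] at this
  · intro y hy
    have hy' : ‖y‖ ≤ r := by
      have := Metric.mem_eball.1 hy
      rw [edist_zero_right] at this
      have := this.le
      rw [← ofReal_norm, ENNReal.ofReal_le_coe] at this
      exact_mod_cast this
    have hb : Summable fun q : ι × ℕ =>
        (c q.1 * Complex.exp (l q.1 x) * (q.2.factorial : ℂ)⁻¹) * (l q.1 y) ^ q.2 := by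
      refine Summable.of_norm_bounded hs fun q => ?_
      rw [norm_mul, norm_pow]
      gcongr
      refine ((l q.1).le_opNorm y).trans ?_
      rw [mul_comm]; gcongr
    have hrow : ∀ m, HasSum (fun n : ℕ => (c m * Complex.exp (l m x) * (n.factorial : ℂ)⁻¹) *
        (l m y) ^ n) (c m * Complex.exp (l m (x + y))) := by
      intro m
      have := (NormedSpace.expSeries_div_hasSum_exp (l m y)).mul_left (c m * Complex.exp (l m x))
      rw [← Complex.exp_eq_exp_ℂ] at this
      rw [map_add, Complex.exp_add, ← mul_assoc]
      refine this.congr_fun fun n => ?_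
      ring
    have htot : HasSum (fun q : ι × ℕ => (c q.1 * Complex.exp (l q.1 x) *
        (q.2.factorial : ℂ)⁻¹) * (l q.1 y) ^ q.2) (expSum c l (x + y)) := by
      have := hb.hasSum
      rwa [hb.tsum_prod, tsum_congr fun m => (hrow m).tsum_eq] at this
    have hcol : ∀ n : ℕ, HasSum (fun m => (c m * Complex.exp (l m x) * (n.factorial : ℂ)⁻¹) *
        (l m y) ^ n) (expSeries c l x n fun _ => y) := by
      intro n
      have h1 := (hsum n).of_norm.hasSum
      have h2 := h1.mapL (ContinuousMultilinearMap.apply ℂ (fun _ : Fin n => E) ℂ fun _ => y)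
      simpa [powForm_apply, expSeries] using h2
    exact ((Equiv.prodComm ℕ ι).hasSum_iff.2 htot).prod_fiberwise hcol

lemma expSum_analyticAt {c : ι → ℂ} {l : ι → E →L[ℂ] ℂ} {x : E}
    (h : ExpSummableAt c l x) : AnalyticAt ℂ (expSum c l) x :=
  ⟨_, expSum_hasFPowerSeriesAt h⟩

lemma expSum_fderiv_apply {c : ι → ℂ} {l : ι → E →L[ℂ] ℂ} {x : E}
    (h : ExpSummableAt c l x) (v : E) :
    fderiv ℂ (expSum c l) x v = expSum (fun m => c m * l m v) l x := by
  have h0 := expSum_hasFPowerSeriesAt h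
  obtain ⟨r, hr, h⟩ := h
  rw [h0.fderiv_eq]
  have hs := (ExpSummableAt.summable_prod hr h).prod_symm.prod_factor 1
  have hsum : Summable fun m =>
      ‖(c m * Complex.exp (l m x) * ((1 : ℕ).factorial : ℂ)⁻¹) • powForm 1 (l m)‖ := by
    refine (summable_mul_right_iff hr.ne').1
      (Summable.of_nonneg_of_le (fun m => by positivity) (fun m => ?_) hs)
    rw [norm_smul]
    have := norm_powForm_le 1 (l m)
    simp only [pow_one] at this ⊢
    rw [mul_assoc, mul_comm r]
    dsimp
    rw [pow_one]
    gcongr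
  have h2 := hsum.of_norm.hasSum.mapL
    (ContinuousMultilinearMap.apply ℂ (fun _ : Fin 1 => E) ℂ fun _ => v)
  have h3 := h2.tsum_eq
  simp only [ContinuousMultilinearMap.apply_apply, smul_apply,
    powForm_apply] at h3
  have h4 : (continuousMultilinearCurryFin1 ℂ E ℂ) (expSeries c l x 1) v =
      expSeries c l x 1 (fun _ => v) := by
    simp only [continuousMultilinearCurryFin1_apply]
    congr 1
  rw [h4]
  refine h3.symm.trans (tsum_congr fun m => ?_)
  simp
  ring

/-- Half of the radius `r` pays for a factor linear in `‖l m‖`, because `u ≤ exp u`. The condition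
is therefore stable under differentiation, with a smaller radius each time. -/
lemma ExpSummableAt.mul_bound {c c' : ι → ℂ} {l : ι → E →L[ℂ] ℂ} {x : E}
    (h : ExpSummableAt c l x) (K : ℝ) (hc : ∀ m, ‖c' m‖ ≤ ‖c m‖ * (K * ‖l m‖)) :
    ExpSummableAt c' l x := by
  obtain ⟨r, hr, h⟩ := h
  refine ⟨r / 2, by positivity, Summable.of_nonneg_of_le (fun m => by positivity) (fun m => ?_)
    (h.mul_left (|K| * (2 / r)))⟩
  have h1 : r / 2 * ‖l m‖ ≤ Real.exp (r / 2 * ‖l m‖) :=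
    (by linarith : _ ≤ r / 2 * ‖l m‖ + 1).trans (Real.add_one_le_exp _)
  have h2 : Real.exp ((l m x).re + r * ‖l m‖) =
      Real.exp ((l m x).re + r / 2 * ‖l m‖) * Real.exp (r / 2 * ‖l m‖) := by
    rw [← Real.exp_add]; ring_nf
  have h3 : K * ‖l m‖ ≤ |K| * (2 / r) * Real.exp (r / 2 * ‖l m‖) := by
    calc K * ‖l m‖ ≤ |K| * ‖l m‖ := by gcongr; exact le_abs_self K
      _ = |K| * (2 / r) * (r / 2 * ‖l m‖) := by field_simp
      _ ≤ _ := by gcongr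
  calc ‖c' m‖ * Real.exp ((l m x).re + r / 2 * ‖l m‖)
      ≤ (‖c m‖ * (K * ‖l m‖)) * Real.exp ((l m x).re + r / 2 * ‖l m‖) := by
        gcongr; exact hc m
    _ ≤ (‖c m‖ * (|K| * (2 / r) * Real.exp (r / 2 * ‖l m‖))) *
        Real.exp ((l m x).re + r / 2 * ‖l m‖) := by gcongr
    _ = _ := by rw [h2]; ring

lemma ExpSummableAt.mul_apply {c : ι → ℂ} {l : ι → E →L[ℂ] ℂ} {x : E}
    (h : ExpSummableAt c l x) (v : E) : ExpSummableAt (fun m => c m * l m v) l x :=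
  h.mul_bound ‖v‖ fun m => by
    rw [norm_mul, mul_comm ‖v‖]
    gcongr
    exact (l m).le_opNorm v

lemma ExpSummableAt.summable {c : ι → ℂ} {l : ι → E →L[ℂ] ℂ} {x : E}
    (h : ExpSummableAt c l x) : Summable fun m => c m * Complex.exp (l m x) := by
  obtain ⟨r, hr, h⟩ := h
  refine Summable.of_norm_bounded h fun m => ?_
  rw [norm_mul, Complex.norm_exp]
  gcongr
  have := norm_nonneg (l m)
  nlinarith

end ExpSum

/-! ### Convergence of the theta series on the Siegel upper half-space -/

lemma summable_pi_prod {g : ℕ} {f : ℤ → ℝ} (h0 : ∀ n, 0 ≤ f n) (h : Summable f) :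
    Summable fun m : Fin g → ℤ => ∏ i, f (m i) := by
  induction g with
  | zero => exact Summable.of_finite
  | succ g ih =>
    rw [← (Fin.consEquiv fun _ : Fin (g + 1) => ℤ).summable_iff]
    have := h.mul_of_nonneg ih h0 fun m => Finset.prod_nonneg fun i _ => h0 _
    refine this.congr fun q => ?_
    simp [Fin.prod_univ_succ, Fin.consEquiv]

lemma summable_exp_neg_abs {c : ℝ} (hc : 0 < c) : Summable fun n : ℤ => Real.exp (-c * |(n : ℝ)|) := by
  have h : Summable fun n : ℕ => Real.exp (-c) ^ n :=
    summable_geometric_of_lt_one (Real.exp_pos _).le (by simpa using hc)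
  have h' : ∀ n : ℕ, Real.exp (-c) ^ n = Real.exp (-c * n) := fun n => by
    rw [← Real.exp_nat_mul]; ring_nf
  refine Summable.of_nat_of_neg (h.congr fun n => ?_) (h.congr fun n => ?_) <;> simp [h']

/-- By homogeneity the constant is the minimum of the quadratic form on the compact unit sphere. An
empty sphere means that there are no nonzero vectors, and then any constant serves. -/
lemma posDef_lower_bound {g : ℕ} {Y : Matrix (Fin g) (Fin g) ℝ} (hY : Y.PosDef) :
    ∃ c : ℝ, 0 < c ∧ ∀ n : Fin g → ℝ, c * ∑ i, n i ^ 2 ≤ n ⬝ᵥ Y.mulVec n := by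
  have hcont : Continuous fun n : EuclideanSpace ℝ (Fin g) => n.ofLp ⬝ᵥ Y.mulVec n.ofLp := by
    fun_prop
  have hpos : ∀ n : Fin g → ℝ, n ≠ 0 → 0 < n ⬝ᵥ Y.mulVec n := fun n hn => by
    simpa using hY.dotProduct_mulVec_pos hn
  rcases (Metric.sphere (0 : EuclideanSpace ℝ (Fin g)) 1).eq_empty_or_nonempty with he | hne
  · refine ⟨1, one_pos, fun n => ?_⟩
    by_cases hn : n = 0
    · simp [hn]
    · exfalso
      have hn' : (WithLp.toLp 2 n : EuclideanSpace ℝ (Fin g)) ≠ 0 := by simpa using hn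
      have : (‖(WithLp.toLp 2 n : EuclideanSpace ℝ (Fin g))‖⁻¹ • WithLp.toLp 2 n) ∈
          Metric.sphere (0 : EuclideanSpace ℝ (Fin g)) 1 := by
        simp [norm_smul, hn']
      rw [he] at this
      exact this
  · obtain ⟨x, hx, hmin⟩ := (isCompact_sphere _ _).exists_isMinOn hne hcont.continuousOn
    refine ⟨x.ofLp ⬝ᵥ Y.mulVec x.ofLp, hpos _ ?_, fun n => ?_⟩
    · rintro h
      have : x = 0 := by ext i; simpa using congrFun h i
      simp [this] at hx
    · by_cases hn : n = 0
      · simp [hn]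
      set N : EuclideanSpace ℝ (Fin g) := WithLp.toLp 2 n with hN
      have hn' : N ≠ 0 := by simpa [hN] using hn
      have hm : (‖N‖⁻¹ • N) ∈ Metric.sphere (0 : EuclideanSpace ℝ (Fin g)) 1 := by
        simp [norm_smul, hn']
      have h := hmin hm
      simp only [Set.mem_ofPred_eq, WithLp.ofLp_smul, Matrix.mulVec_smul, dotProduct_smul,
        smul_dotProduct, smul_eq_mul] at h
      have h2 : ∑ i, n i ^ 2 = ‖N‖ ^ 2 := by
        rw [EuclideanSpace.norm_sq_eq]; simp [hN]
      have h3 : 0 < ‖N‖ := norm_pos_iff.2 hn'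
      rw [h2]
      calc _ ≤ ‖N‖⁻¹ * (‖N‖⁻¹ * (n ⬝ᵥ Y.mulVec n)) * ‖N‖ ^ 2 := by gcongr
        _ = _ := by field_simp

section Series

variable {g : ℕ}

/-- The real vector `m + ε / 2`. -/
def thetaIdx (ε : Fin g → ZMod 2) (m : Fin g → ℤ) : Fin g → ℝ := fun i => m i + ((ε i).val : ℝ) / 2

/-- The complex vector `m + ε / 2`. -/
def thetaIdxC (ε : Fin g → ZMod 2) (m : Fin g → ℤ) : Fin g → ℂ := fun i => m i + charVec ε i / 2

lemma thetaIdxC_eq (ε : Fin g → ZMod 2) (m : Fin g → ℤ) (i : Fin g) :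
    thetaIdxC ε m i = (thetaIdx ε m i : ℂ) := by
  simp only [thetaIdx, thetaIdxC, charVec]
  push_cast
  rfl

/-- The exponent `πi [ᵗn τ n + 2 ᵗn z]`, `n = m + ε / 2`, as a linear form in `(τ, z)`. -/
def thetaForm (ε : Fin g → ZMod 2) (m : Fin g → ℤ) : SymCoord g × (Fin g → ℂ) →L[ℂ] ℂ :=
  LinearMap.toContinuousLinearMap
    { toFun := fun x => Real.pi * Complex.I *
        (thetaIdxC ε m ⬝ᵥ (symMatrix x.1).mulVec (thetaIdxC ε m) + 2 * (thetaIdxC ε m ⬝ᵥ x.2))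
      map_add' := fun x y => by
        have : symMatrix (x + y).1 = symMatrix x.1 + symMatrix y.1 := rfl
        rw [this, Matrix.add_mulVec, dotProduct_add, Prod.snd_add, dotProduct_add]
        ring
      map_smul' := fun a x => by
        have : symMatrix (a • x).1 = a • symMatrix x.1 := rfl
        rw [this, Matrix.smul_mulVec, dotProduct_smul, Prod.smul_snd, dotProduct_smul]
        simp only [smul_eq_mul, RingHom.id_apply]
        ring }

lemma thetaForm_apply (ε : Fin g → ZMod 2) (m : Fin g → ℤ) (x : SymCoord g × (Fin g → ℂ)) :
    thetaForm ε m x = Real.pi * Complex.I *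
      (thetaIdxC ε m ⬝ᵥ (symMatrix x.1).mulVec (thetaIdxC ε m) + 2 * (thetaIdxC ε m ⬝ᵥ x.2)) := rfl

lemma thetaForm_re (ε : Fin g → ZMod 2) (m : Fin g → ℤ) (x : SymCoord g × (Fin g → ℂ)) :
    (thetaForm ε m x).re = - Real.pi * (thetaIdx ε m ⬝ᵥ
      ((symMatrix x.1).map Complex.im).mulVec (thetaIdx ε m) +
      2 * ∑ i, thetaIdx ε m i * (x.2 i).im) := by
  have h1 : (thetaIdxC ε m ⬝ᵥ (symMatrix x.1).mulVec (thetaIdxC ε m)).im =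
      thetaIdx ε m ⬝ᵥ ((symMatrix x.1).map Complex.im).mulVec (thetaIdx ε m) := by
    simp [dotProduct, Matrix.mulVec, thetaIdxC_eq, Complex.im_sum]
  have h2 : (thetaIdxC ε m ⬝ᵥ x.2).im = ∑ i, thetaIdx ε m i * (x.2 i).im := by
    simp [dotProduct, thetaIdxC_eq, Complex.im_sum]
  rw [thetaForm_apply, ← h1, ← h2]
  simp [Complex.mul_re, Complex.mul_im]

lemma norm_thetaForm_le (ε : Fin g → ZMod 2) (m : Fin g → ℤ) :
    ‖thetaForm ε m‖ ≤ Real.pi * (3 * g + 1) * (∑ i, thetaIdx ε m i ^ 2 + 1) * (g + 1) := by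
  set N := ∑ i, thetaIdx ε m i ^ 2 with hN
  have hN0 : 0 ≤ N := Finset.sum_nonneg fun i _ => sq_nonneg _
  have hi : ∀ i, thetaIdx ε m i ^ 2 ≤ N := fun i =>
    Finset.single_le_sum (f := fun i => thetaIdx ε m i ^ 2) (fun i _ => sq_nonneg _)
      (Finset.mem_univ i)
  have hi2 : ∀ i, |thetaIdx ε m i| ≤ N + 1 := fun i => by
    have := hi i
    rw [← sq_abs] at this
    nlinarith [sq_nonneg (|thetaIdx ε m i| - 1)]
  have hij : ∀ i j, |thetaIdx ε m i| * |thetaIdx ε m j| ≤ N := fun i j => by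
    have h1 := hi i
    have h2 := hi j
    rw [← sq_abs] at h1 h2
    nlinarith [sq_nonneg (|thetaIdx ε m i| - |thetaIdx ε m j|)]
  refine ContinuousLinearMap.opNorm_le_bound _ (by positivity) fun x => ?_
  have h1 : ‖thetaIdxC ε m ⬝ᵥ (symMatrix x.1).mulVec (thetaIdxC ε m)‖ ≤ g * (g * (N * ‖x‖)) := by
    simp only [dotProduct, Matrix.mulVec, Finset.mul_sum]
    have : ∀ i ∈ Finset.univ, ‖∑ j, thetaIdxC ε m i * (symMatrix x.1 i j * thetaIdxC ε m j)‖ ≤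
        g * (N * ‖x‖) := fun i _ => by
      have : ∀ j ∈ Finset.univ, ‖thetaIdxC ε m i * (symMatrix x.1 i j * thetaIdxC ε m j)‖ ≤
          N * ‖x‖ := fun j _ => by
        have hx : ‖symMatrix x.1 i j‖ ≤ ‖x‖ := (norm_le_pi_norm x.1 s(i, j)).trans (norm_fst_le x)
        rw [norm_mul, norm_mul, thetaIdxC_eq, thetaIdxC_eq, Complex.norm_real, Complex.norm_real,
          Real.norm_eq_abs, Real.norm_eq_abs]
        calc _ = (|thetaIdx ε m i| * |thetaIdx ε m j|) * ‖symMatrix x.1 i j‖ := by ring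
          _ ≤ _ := by gcongr; exact hij i j
      simpa using (norm_sum_le_of_le _ this)
    simpa using (norm_sum_le_of_le _ this)
  have h2 : ‖thetaIdxC ε m ⬝ᵥ x.2‖ ≤ g * ((N + 1) * ‖x‖) := by
    simp only [dotProduct]
    have : ∀ i ∈ Finset.univ, ‖thetaIdxC ε m i * x.2 i‖ ≤ (N + 1) * ‖x‖ := fun i _ => by
      rw [norm_mul, thetaIdxC_eq, Complex.norm_real, Real.norm_eq_abs]
      gcongr
      · exact hi2 i
      · exact (norm_le_pi_norm x.2 i).trans (norm_snd_le x)
    simpa using (norm_sum_le_of_le _ this)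
  rw [thetaForm_apply, norm_mul, norm_mul, Complex.norm_I, Complex.norm_real, mul_one,
    Real.norm_of_nonneg Real.pi_pos.le]
  have h3 : ‖thetaIdxC ε m ⬝ᵥ (symMatrix x.1).mulVec (thetaIdxC ε m) +
      2 * (thetaIdxC ε m ⬝ᵥ x.2)‖ ≤ g * (g * (N * ‖x‖)) + 2 * (g * ((N + 1) * ‖x‖)) := by
    refine (norm_add_le _ _).trans (add_le_add h1 ?_)
    rw [norm_mul, Complex.norm_two]
    gcongr
  calc _ ≤ Real.pi * (g * (g * (N * ‖x‖)) + 2 * (g * ((N + 1) * ‖x‖))) := by gcongr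
    _ ≤ Real.pi * ((3 * g + 1) * (N + 1) * (g + 1) * ‖x‖) := by
      gcongr
      have := norm_nonneg x
      have hg : (0 : ℝ) ≤ g := Nat.cast_nonneg g
      have e : (3 * g + 1) * (N + 1) * (g + 1) * ‖x‖ -
        (g * (g * (N * ‖x‖)) + 2 * (g * ((N + 1) * ‖x‖))) =
        ‖x‖ * (2 * (g * g * N) + 3 * (g * g) + 2 * (g * N) + 2 * g + N + 1) := by ring
      have : 0 ≤ ‖x‖ * (2 * (g * g * N) + 3 * (g * g) + 2 * (g * N) + 2 * g + N + 1) := by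
        positivity
      linarith
    _ = _ := by ring

/-- Comparing the quadratic exponent with a linear one reduces convergence to a product of geometric
series. It follows from `(x ∓ 1)² ≥ 0`. -/
lemma abs_le_thetaIdx_sq (ε : Fin g → ZMod 2) (m : Fin g → ℤ) (i : Fin g) :
    |(m i : ℝ)| - 2 ≤ thetaIdx ε m i ^ 2 := by
  have h0 : (0 : ℝ) ≤ ((ε i).val : ℝ) := Nat.cast_nonneg _
  have h1 : ((ε i).val : ℝ) ≤ 1 := by
    have := ZMod.val_lt (ε i)
    exact_mod_cast Nat.lt_succ_iff.1 this
  unfold thetaIdx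
  set e := ((ε i).val : ℝ)
  rcases abs_cases (m i : ℝ) with ⟨h, _⟩ | ⟨h, _⟩ <;> rw [h]
  · nlinarith [sq_nonneg ((m i : ℝ) + e / 2 - 1)]
  · nlinarith [sq_nonneg ((m i : ℝ) + e / 2 + 1)]

/-- The Siegel upper half-space as an open subset of the space of symmetric matrices. -/
def siegelSet (g : ℕ) : Set (SymCoord g) := {t | ((symMatrix t).map Complex.im).PosDef}

lemma thetaForm_exp_summable (ε : Fin g → ZMod 2) {x : SymCoord g × (Fin g → ℂ)}
    (hx : x.1 ∈ siegelSet g) :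
    ∃ r : ℝ, 0 < r ∧ Summable fun m => Real.exp ((thetaForm ε m x).re + r * ‖thetaForm ε m‖) := by
  obtain ⟨c, hc, hq⟩ := posDef_lower_bound hx
  set A : ℝ := Real.pi * (3 * g + 1) * (g + 1) with hA
  have hA0 : 0 < A := by positivity
  set D : ℝ := Real.pi * ∑ i, (2 / c * (x.2 i).im ^ 2) with hD
  -- The available decay is `πcN = 4bN`. Completing the square for the term linear in `z` uses
  -- `2bN`, the term `r‖thetaForm ε m‖` uses `bN`, and the remaining `bN` gives summability.
  set b : ℝ := Real.pi * c / 4 with hb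
  have hb0 : 0 < b := by positivity
  refine ⟨b / A, by positivity, ?_⟩
  have hs := (summable_pi_prod (g := g) (fun n => (Real.exp_pos _).le)
    (summable_exp_neg_abs hb0)).mul_left (Real.exp (D + b + 2 * g * b))
  refine Summable.of_nonneg_of_le (fun m => (Real.exp_pos _).le) (fun m => ?_) hs
  rw [← Real.exp_sum, ← Real.exp_add]
  refine Real.exp_le_exp.2 ?_
  set N := ∑ i, thetaIdx ε m i ^ 2 with hN
  have h1 := norm_thetaForm_le ε m
  have h2 : b / A * ‖thetaForm ε m‖ ≤ b * (N + 1) := by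
    calc _ ≤ b / A * (A * (N + 1)) := by
          gcongr; refine h1.trans (le_of_eq ?_); rw [hA]; ring
      _ = _ := by field_simp
  have h3 : (thetaForm ε m x).re ≤ - Real.pi * (c * N) + (Real.pi * c / 2 * N + D) := by
    rw [thetaForm_re]
    have e1 := hq (thetaIdx ε m)
    have e2 : -(2 * ∑ i, thetaIdx ε m i * (x.2 i).im) ≤
        c / 2 * N + ∑ i, (2 / c * (x.2 i).im ^ 2) := by
      rw [hN, Finset.mul_sum, Finset.mul_sum, ← Finset.sum_neg_distrib, ← Finset.sum_add_distrib]
      refine Finset.sum_le_sum fun i _ => ?_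
      have : c / 2 * thetaIdx ε m i ^ 2 + 2 / c * (x.2 i).im ^ 2 +
          2 * (thetaIdx ε m i * (x.2 i).im) =
          c / 2 * (thetaIdx ε m i + 2 / c * (x.2 i).im) ^ 2 := by
        field_simp; ring
      have : 0 ≤ c / 2 * (thetaIdx ε m i + 2 / c * (x.2 i).im) ^ 2 := by positivity
      linarith
    rw [hD]
    nlinarith [Real.pi_pos]
  have h4 : ∑ i, (|(m i : ℝ)| - 2) ≤ N := Finset.sum_le_sum fun i _ => abs_le_thetaIdx_sq ε m i
  have h5 : ∑ i, (-b * |(m i : ℝ)|) = -b * (∑ i, (|(m i : ℝ)| - 2)) - 2 * g * b := by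
    simp [Finset.sum_sub_distrib]; ring_nf; simp [Finset.mul_sum]
  have h6 := mul_le_mul_of_nonneg_left h4 hb0.le
  have h7 : Real.pi * (c * N) = 4 * (b * N) := by rw [hb]; ring
  have h8 : Real.pi * c / 2 * N = 2 * (b * N) := by rw [hb]; ring
  rw [h5]
  linarith

end Series

/-! ### Derivatives of theta functions, heat equation, quasi-periodicity and parity -/

section ThetaSeries

variable {g : ℕ}

/-- The coefficient `exp πi ᵗn δ`, `n = m + ε / 2`. -/
def thetaCoef (ε δ : Fin g → ZMod 2) (m : Fin g → ℤ) : ℂ :=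
  Complex.exp (Real.pi * Complex.I * (thetaIdxC ε m ⬝ᵥ charVec δ))

/-- The factor `∏ 2πi ᵗn v` by which differentiation along the vectors `v` multiplies a term. -/
def thetaSymbol (ε : Fin g → ZMod 2) (s : List (Fin g → ℂ)) (m : Fin g → ℤ) : ℂ :=
  (s.map fun v => 2 * Real.pi * Complex.I * (thetaIdxC ε m ⬝ᵥ v)).prod

/-- The iterated derivative of the theta function with characteristic along the vectors `s`. -/
def thetaSum (ε δ : Fin g → ZMod 2) (s : List (Fin g → ℂ)) : SymCoord g × (Fin g → ℂ) → ℂ :=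
  expSum (fun m => thetaCoef ε δ m * thetaSymbol ε s m) (thetaForm ε)

variable {ε δ : Fin g → ZMod 2} {s : List (Fin g → ℂ)} {x : SymCoord g × (Fin g → ℂ)}

lemma thetaForm_zero_left (m : Fin g → ℤ) (v : Fin g → ℂ) :
    thetaForm ε m (0, v) = 2 * Real.pi * Complex.I * (thetaIdxC ε m ⬝ᵥ v) := by
  have : symMatrix (0 : SymCoord g) = 0 := rfl
  rw [thetaForm_apply, this]
  simp
  ring

lemma thetaSymbol_cons (v : Fin g → ℂ) (m : Fin g → ℤ) :
    thetaSymbol ε (v :: s) m = thetaForm ε m (0, v) * thetaSymbol ε s m := by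
  rw [thetaForm_zero_left]; simp [thetaSymbol]

lemma norm_thetaCoef (m : Fin g → ℤ) : ‖thetaCoef ε δ m‖ = 1 := by
  have : thetaIdxC ε m ⬝ᵥ charVec δ =
      ((∑ i, thetaIdx ε m i * ((δ i).val : ℝ) : ℝ) : ℂ) := by
    simp only [dotProduct, thetaIdxC_eq, charVec]
    push_cast
    rfl
  rw [thetaCoef, Complex.norm_exp, this]
  simp

lemma thetaSum_summable (ε δ : Fin g → ZMod 2) (s : List (Fin g → ℂ)) (hx : x.1 ∈ siegelSet g) :
    ExpSummableAt (fun m => thetaCoef ε δ m * thetaSymbol ε s m) (thetaForm ε) x := by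
  induction s with
  | nil =>
    obtain ⟨r, hr, h⟩ := thetaForm_exp_summable ε hx
    exact ⟨r, hr, by simpa [thetaSymbol, norm_thetaCoef] using h⟩
  | cons v s ih =>
    have := ih.mul_apply (0, v)
    convert this using 2 with m
    rw [thetaSymbol_cons]; ring

lemma thetaSum_analyticAt (ε δ : Fin g → ZMod 2) (s : List (Fin g → ℂ)) (hx : x.1 ∈ siegelSet g) :
    AnalyticAt ℂ (thetaSum ε δ s) x :=
  expSum_analyticAt (thetaSum_summable ε δ s hx)

lemma thetaSum_fderiv_snd (hx : x.1 ∈ siegelSet g) (v : Fin g → ℂ) :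
    fderiv ℂ (thetaSum ε δ s) x (0, v) = thetaSum ε δ (v :: s) x := by
  rw [thetaSum, expSum_fderiv_apply (thetaSum_summable ε δ s hx), thetaSum]
  congr 1
  ext m
  rw [thetaSymbol_cons]; ring

lemma thetaSum_perm {s' : List (Fin g → ℂ)} (h : s.Perm s') :
    thetaSum ε δ s = thetaSum ε δ s' := by
  have : thetaSymbol ε s = thetaSymbol ε s' := by
    ext m
    exact (h.map _).prod_eq
  rw [thetaSum, thetaSum, this]

lemma thetaSum_swap (v w : Fin g → ℂ) :
    thetaSum ε δ (v :: w :: s) = thetaSum ε δ (w :: v :: s) :=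
  thetaSum_perm (List.Perm.swap w v s)

lemma thetaSum_cons_add (hx : x.1 ∈ siegelSet g) (v w : Fin g → ℂ) :
    thetaSum ε δ ((v + w) :: s) x = thetaSum ε δ (v :: s) x + thetaSum ε δ (w :: s) x := by
  simp only [← thetaSum_fderiv_snd hx]
  rw [← map_add]; simp

lemma thetaSum_cons_smul (hx : x.1 ∈ siegelSet g) (a : ℂ) (v : Fin g → ℂ) :
    thetaSum ε δ ((a • v) :: s) x = a * thetaSum ε δ (v :: s) x := by
  simp only [← thetaSum_fderiv_snd hx]
  rw [← smul_eq_mul, ← map_smul]; simp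

lemma thetaSum_cons_eq_sum (hx : x.1 ∈ siegelSet g) (v : Fin g → ℂ) :
    thetaSum ε δ (v :: s) x = ∑ i, v i * thetaSum ε δ (Pi.single i 1 :: s) x := by
  simp only [← thetaSum_fderiv_snd hx]
  have : ((0 : SymCoord g), v) = ∑ i, v i • ((0 : SymCoord g), (Pi.single i 1 : Fin g → ℂ)) := by
    ext j
    · simp [Prod.fst_sum]
    · simp [Prod.snd_sum, Finset.sum_apply, Pi.single_apply]
  conv_lhs => rw [this, map_sum]
  simp only [map_smul, smul_eq_mul]

/-- The symmetric matrix `v ᵗw + w ᵗv`. -/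
def symDir (v w : Fin g → ℂ) : SymCoord g :=
  Sym2.lift ⟨fun i j => v i * w j + w i * v j, fun i j => by ring⟩

/-- This is the heat equation on a single term: `ᵗn(v ᵗw + w ᵗv)n = 2(ᵗn v)(ᵗn w)`, so one
`τ`-derivative equals two `z`-derivatives up to `2πi`. -/
lemma thetaForm_symDir (m : Fin g → ℤ) (v w : Fin g → ℂ) :
    thetaForm ε m (symDir v w, 0) =
      (2 * Real.pi * Complex.I)⁻¹ * (thetaForm ε m (0, v) * thetaForm ε m (0, w)) := by
  have h : thetaIdxC ε m ⬝ᵥ (symMatrix (symDir v w)).mulVec (thetaIdxC ε m) =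
      2 * ((thetaIdxC ε m ⬝ᵥ v) * (thetaIdxC ε m ⬝ᵥ w)) := by
    simp only [dotProduct, Matrix.mulVec, symMatrix, symDir, Matrix.of_apply, Sym2.lift_mk]
    rw [two_mul, Finset.sum_mul_sum]
    simp only [add_mul, mul_add, Finset.sum_add_distrib, Finset.mul_sum]
    congr 1
    · refine Finset.sum_congr rfl fun i _ => Finset.sum_congr rfl fun j _ => by ring
    · rw [Finset.sum_comm]
      refine Finset.sum_congr rfl fun i _ => Finset.sum_congr rfl fun j _ => by ring
  rw [thetaForm_zero_left, thetaForm_zero_left, thetaForm_apply, h]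
  have := Complex.two_pi_I_ne_zero
  field_simp
  simp

/-- The heat equation, along the direction `v ᵗw + w ᵗv`. -/
lemma thetaSum_fderiv_symDir (hx : x.1 ∈ siegelSet g) (v w : Fin g → ℂ) :
    fderiv ℂ (thetaSum ε δ s) x (symDir v w, 0) =
      (2 * Real.pi * Complex.I)⁻¹ * thetaSum ε δ (v :: w :: s) x := by
  rw [thetaSum, expSum_fderiv_apply (thetaSum_summable ε δ s hx), thetaSum, expSum, expSum,
    ← tsum_mul_left]
  refine tsum_congr fun m => ?_
  rw [thetaSymbol_cons, thetaSymbol_cons, thetaForm_symDir]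
  ring

lemma symCoord_eq_sum (t : SymCoord g) :
    t = ∑ i, ∑ j, (t s(i, j) / 2) • symDir (Pi.single i 1) (Pi.single j 1) := by
  ext q
  induction q using Sym2.ind with
  | _ a b =>
    simp only [Finset.sum_apply, Pi.smul_apply, symDir, Sym2.lift_mk, smul_eq_mul, mul_add,
      Finset.sum_add_distrib, Pi.single_apply]
    simp [Sym2.eq_swap (a := b) (b := a)]

lemma thetaSum_fderiv_fst_eq_zero (hx : x.1 ∈ siegelSet g)
    (h : ∀ i j, thetaSum ε δ (Pi.single i 1 :: Pi.single j 1 :: s) x = 0) (t : SymCoord g) :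
    fderiv ℂ (thetaSum ε δ s) x (t, 0) = 0 := by
  have : (t, (0 : Fin g → ℂ)) =
      ∑ i, ∑ j, (t s(i, j) / 2) • (symDir (Pi.single i 1) (Pi.single j 1), (0 : Fin g → ℂ)) := by
    refine Prod.ext ?_ ?_
    · simp only [Prod.fst_sum, Prod.smul_fst]
      exact symCoord_eq_sum t
    · simp [Prod.snd_sum]
  rw [this]
  simp only [map_sum, map_smul, thetaSum_fderiv_symDir hx, h]
  simp

lemma thetaChar_eq (t : SymCoord g) (z : Fin g → ℂ) :
    thetaChar ε δ t z = thetaSum ε δ [] (t, z) := by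
  refine tsum_congr fun m => ?_
  simp only [thetaSymbol, thetaCoef, List.map_nil, List.prod_nil, mul_one]
  rw [← Complex.exp_add, thetaForm_apply]
  congr 1
  have e1 : (fun i => (m i : ℂ) + charVec ε i / 2) = thetaIdxC ε m := rfl
  have e2 : (fun i => z i + charVec δ i / 2) = z + (1 / 2 : ℂ) • charVec δ := by
    ext i; simp; ring
  rw [e1, e2, dotProduct_add, dotProduct_smul, smul_eq_mul]
  ring

lemma theta_eq (t : SymCoord g) (z : Fin g → ℂ) : theta t z = thetaSum 0 0 [] (t, z) :=
  thetaChar_eq t z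

lemma charVec_zero : charVec (0 : Fin g → ZMod 2) = 0 := by
  ext i; simp [charVec]

lemma symMatrix_dot_comm (t : SymCoord g) (v w : Fin g → ℂ) :
    v ⬝ᵥ (symMatrix t).mulVec w = w ⬝ᵥ (symMatrix t).mulVec v := by
  simp only [dotProduct, Matrix.mulVec, Finset.mul_sum]
  rw [Finset.sum_comm]
  refine Finset.sum_congr rfl fun i _ => Finset.sum_congr rfl fun j _ => ?_
  have : symMatrix t i j = symMatrix t j i := by simp [symMatrix, Sym2.eq_swap]
  rw [this]; ring

/-- An integral vector as a complex vector. -/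
def intVec (m : Fin g → ℤ) : Fin g → ℂ := fun i => (m i : ℂ)

lemma thetaIdxC_def (m : Fin g → ℤ) : thetaIdxC ε m = intVec m + (1 / 2 : ℂ) • charVec ε := by
  ext i; simp [thetaIdxC, intVec]; ring

lemma intVec_add (m n : Fin g → ℤ) : intVec (m + n) = intVec m + intVec n := by
  ext i; simp [intVec]

lemma intVec_dot (m n : Fin g → ℤ) : intVec m ⬝ᵥ intVec n = ((m ⬝ᵥ n : ℤ) : ℂ) := by
  simp [intVec, dotProduct]

/-- The characteristic as an integral vector. -/
def charInt (ε : Fin g → ZMod 2) : Fin g → ℤ := fun i => ((ε i).val : ℤ)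

lemma charVec_eq (ε : Fin g → ZMod 2) : charVec ε = intVec (charInt ε) := by
  ext i
  simp only [charVec, intVec, charInt]
  push_cast
  rfl

lemma exp_two_pi_int (k : ℤ) : Complex.exp (Real.pi * Complex.I * (2 * k)) = 1 := by
  rw [← Complex.exp_int_mul_two_pi_mul_I k]; congr 1; ring

/-- Quasi-periodicity of the theta function with characteristic. -/
lemma thetaSum_add_period (t : SymCoord g) (w : Fin g → ℂ) (a b : Fin g → ℤ) :
    thetaSum ε δ [] (t, w + ((symMatrix t).mulVec (intVec a) + intVec b)) =
      Complex.exp (Real.pi * Complex.I * (-(intVec a ⬝ᵥ (symMatrix t).mulVec (intVec a))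
        - 2 * (intVec a ⬝ᵥ w) - intVec a ⬝ᵥ charVec δ + charVec ε ⬝ᵥ intVec b)) *
      thetaSum ε δ [] (t, w) := by
  rw [thetaSum, expSum, expSum, ← tsum_mul_left]
  conv_rhs => rw [← (Equiv.addRight a).tsum_eq]
  refine tsum_congr fun m => ?_
  simp only [thetaSymbol, thetaCoef, List.map_nil, List.prod_nil, mul_one, Equiv.coe_addRight,
    thetaForm_apply]
  have e : thetaIdxC ε (m + a) = thetaIdxC ε m + intVec a := by
    rw [thetaIdxC_def, thetaIdxC_def, intVec_add]; abel
  rw [e, ← Complex.exp_add, ← Complex.exp_add, ← Complex.exp_add]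
  -- After the shift of the summation index by `a`, the two exponents differ by `2πi ᵗm b`.
  refine Complex.exp_eq_exp_iff_exists_int.2 ⟨m ⬝ᵥ b, ?_⟩
  rw [← intVec_dot]
  have h1 := symMatrix_dot_comm t (intVec a) (thetaIdxC ε m)
  have h2 : thetaIdxC ε m ⬝ᵥ intVec b = intVec m ⬝ᵥ intVec b + 1 / 2 * charVec ε ⬝ᵥ intVec b := by
    rw [thetaIdxC_def, add_dotProduct, smul_dotProduct, smul_eq_mul]
  have h3 : intVec m ⬝ᵥ intVec b = thetaIdxC ε m ⬝ᵥ intVec b - 1 / 2 * charVec ε ⬝ᵥ intVec b := by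
    rw [h2]; ring
  simp only [dotProduct_add, add_dotProduct, Matrix.mulVec_add, h1, h3]
  ring

/-- The identity holds term by term with the same index `m`, by completing the square with `m +
ε/2`. -/
lemma theta_half_period (t : SymCoord g) (w : Fin g → ℂ) (ε δ : Fin g → ZMod 2) :
    thetaSum 0 0 [] (t, w + (1 / 2 : ℂ) • ((symMatrix t).mulVec (charVec ε) + charVec δ)) =
      Complex.exp (Real.pi * Complex.I * (-(1 / 4 * (charVec ε ⬝ᵥ (symMatrix t).mulVec (charVec ε)))
        - charVec ε ⬝ᵥ w - 1 / 2 * (charVec ε ⬝ᵥ charVec δ))) *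
      thetaSum ε δ [] (t, w) := by
  rw [thetaSum, thetaSum, expSum, expSum, ← tsum_mul_left]
  refine tsum_congr fun m => ?_
  simp only [thetaSymbol, thetaCoef, List.map_nil, List.prod_nil, mul_one,
    thetaForm_apply]
  rw [thetaIdxC_def, thetaIdxC_def, charVec_zero, ← Complex.exp_add, ← Complex.exp_add,
    ← Complex.exp_add]
  have h1 := symMatrix_dot_comm t (charVec ε) (intVec m)
  simp only [dotProduct_add, add_dotProduct, Matrix.mulVec_add, Matrix.mulVec_smul,
    dotProduct_smul, smul_dotProduct, smul_eq_mul, h1, dotProduct_zero,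
    smul_zero, smul_add, add_zero, mul_zero, zero_add]
  congr 1
  ring

/-- The substitution `m ↦ -m - ε` sends `n = m + ε/2` to `-n`, so each differentiation contributes a
sign. The coefficient changes by `exp(2πi ᵗn δ)`, which is `1` because `ᵗn δ = ᵗm δ + ᵗε δ/2` is an
integer for an even characteristic. -/
lemma thetaSum_neg (he : IsEvenChar ε δ) (t : SymCoord g) (w : Fin g → ℂ) :
    thetaSum ε δ s (t, -w) = (-1) ^ s.length * thetaSum ε δ s (t, w) := by
  have hev : ∃ k : ℤ, charInt ε ⬝ᵥ charInt δ = 2 * k := by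
    have : ((charInt ε ⬝ᵥ charInt δ : ℤ) : ZMod 2) = 0 := by
      rw [← he]; simp [dotProduct, charInt]
    obtain ⟨k, hk⟩ := (ZMod.intCast_zmod_eq_zero_iff_dvd _ 2).1 this
    exact ⟨k, by simpa using hk⟩
  obtain ⟨k, hk⟩ := hev
  have hk' : charVec ε ⬝ᵥ charVec δ = 2 * (k : ℂ) := by
    rw [charVec_eq, charVec_eq, intVec_dot, hk]; push_cast; rfl
  rw [thetaSum, expSum, expSum, ← tsum_mul_left,
    ← ((Equiv.neg (Fin g → ℤ)).trans (Equiv.subRight (charInt ε))).tsum_eq]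
  refine tsum_congr fun m => ?_
  have e : thetaIdxC ε (-m - charInt ε) = - thetaIdxC ε m := by
    ext i
    simp only [thetaIdxC, charVec_eq, intVec, Pi.neg_apply, Pi.sub_apply]
    push_cast
    ring
  have e1 : thetaSymbol ε s (-m - charInt ε) = (-1) ^ s.length * thetaSymbol ε s m := by
    induction s with
    | nil => simp [thetaSymbol]
    | cons v s ih =>
      rw [thetaSymbol_cons, thetaSymbol_cons, ih, thetaForm_zero_left, thetaForm_zero_left, e,
        neg_dotProduct, List.length_cons, pow_succ]
      ring
  have e2 : thetaForm ε (-m - charInt ε) (t, -w) = thetaForm ε m (t, w) := by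
    simp only [thetaForm_apply, e, Matrix.mulVec_neg, dotProduct_neg, neg_dotProduct, neg_neg]
  have e3 : thetaCoef ε δ (-m - charInt ε) = thetaCoef ε δ m := by
    rw [thetaCoef, thetaCoef, e, ← mul_one (Complex.exp (_ * - _ ⬝ᵥ _)),
      ← exp_two_pi_int (m ⬝ᵥ charInt δ + k), ← Complex.exp_add]
    congr 1
    push_cast
    rw [← intVec_dot, ← charVec_eq, thetaIdxC_def, neg_dotProduct, add_dotProduct,
      smul_dotProduct, hk', smul_eq_mul]
    ring
  simp only [Equiv.trans_apply, Equiv.neg_apply, Equiv.subRight_apply, e1, e2, e3]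
  ring

lemma thetaSum_odd_zero (he : IsEvenChar ε δ) (t : SymCoord g) (hs : Odd s.length) :
    thetaSum ε δ s (t, 0) = 0 := by
  have := thetaSum_neg (s := s) he t 0
  rw [hs.neg_one_pow, neg_zero] at this
  linear_combination this / 2

end ThetaSeries

/-! ### Ideals of germs and nonsingular points -/

section Ideals

variable {E : Type*} [NormedAddCommGroup E] [NormedSpace ℂ E] {ι κ μ : Type*} [Fintype κ] [Fintype μ]

lemma GermsInIdeal.trans {f : ι → E → ℂ} {u : κ → E → ℂ} {v : μ → E → ℂ} {p : E}
    (h1 : GermsInIdeal f u p) (h2 : GermsInIdeal u v p) : GermsInIdeal f v p := by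
  intro i
  obtain ⟨a, ha, hf⟩ := h1 i
  choose b hb hu using h2
  refine ⟨fun k x => ∑ j, a j x * b j k x, fun k => ?_, ?_⟩
  · exact Finset.analyticAt_fun_sum _ fun j _ => (ha j).mul (hb j k)
  · filter_upwards [hf, Filter.eventually_all.2 hu] with x hx hux
    rw [hx]
    simp only [hux, Finset.mul_sum, Finset.sum_mul]
    rw [Finset.sum_comm]
    exact Finset.sum_congr rfl fun k _ => Finset.sum_congr rfl fun j _ => by ring

lemma GermsInIdeal.eventually [Fintype ι] {f : ι → E → ℂ} {u : κ → E → ℂ} {p : E}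
    (h : GermsInIdeal f u p) : ∀ᶠ q in 𝓝 p, GermsInIdeal f u q := by
  choose a ha hf using h
  have h1 : ∀ᶠ q in 𝓝 p, ∀ i j, AnalyticAt ℂ (a i j) q :=
    Filter.eventually_all.2 fun i => Filter.eventually_all.2 fun j => (ha i j).eventually_analyticAt
  filter_upwards [h1, Filter.eventually_all.2 fun i => (hf i).eventually_nhds] with q hq hfq
  exact fun i => ⟨a i, hq i, hfq i⟩

lemma GermsInIdeal.comp {f : ι → E → ℂ} {u : κ → E → ℂ} {p : E} {ψ : E → E}
    (hψ : AnalyticAt ℂ ψ p) (h : GermsInIdeal f u (ψ p)) :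
    GermsInIdeal (fun i => f i ∘ ψ) (fun j => u j ∘ ψ) p := by
  intro i
  obtain ⟨a, ha, hf⟩ := h i
  exact ⟨fun j => a j ∘ ψ, fun j => (ha j).comp hψ, hψ.continuousAt.eventually hf⟩

variable [Fintype ι]

lemma IsNonsingularAt.of_ideal_eq {f : ι → E → ℂ} {h : κ → E → ℂ} {p : E}
    (h1 : GermsInIdeal f h p) (h2 : GermsInIdeal h f p) (hn : IsNonsingularAt h p) :
    IsNonsingularAt f p := by
  obtain ⟨k, u, hu, hu0, hl, ha, hb⟩ := hn
  exact ⟨k, u, hu, hu0, hl, h1.trans ha, hb.trans h2⟩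

lemma IsNonsingularAt.comp {f : ι → E → ℂ} {p : E} {ψ : E → E} (hψ : AnalyticAt ℂ ψ p)
    (hs : Function.Surjective (fderiv ℂ ψ p)) (h : IsNonsingularAt f (ψ p)) :
    IsNonsingularAt (fun i => f i ∘ ψ) p := by
  obtain ⟨k, u, hu, hu0, hl, ha, hb⟩ := h
  refine ⟨k, fun j => u j ∘ ψ, fun j => (hu j).comp hψ, hu0, ?_, ha.comp hψ, hb.comp hψ⟩
  have e : ∀ j, fderiv ℂ (u j ∘ ψ) p = (fderiv ℂ (u j) (ψ p)).comp (fderiv ℂ ψ p) := fun j =>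
    fderiv_comp p (hu j).differentiableAt hψ.differentiableAt
  simp only [e]
  refine Fintype.linearIndependent_iff.2 fun c hc => Fintype.linearIndependent_iff.1 hl c ?_
  ext y
  obtain ⟨x, rfl⟩ := hs y
  simpa using DFunLike.congr_fun hc x

/-- The same `u j` serve at nearby points: independence of the differentials is open, and the `u j`
vanish at `q` because they lie in the ideal of the `f i` there. -/
lemma IsNonsingularAt.eventually {f : ι → E → ℂ} {p : E} (h : IsNonsingularAt f p) :
    ∀ᶠ q in 𝓝 p, (∀ i, f i q = 0) → IsNonsingularAt f q := by
  obtain ⟨k, u, hu, -, hl, ha, hb⟩ := h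
  have h1 : ∀ᶠ q in 𝓝 p, ∀ j, AnalyticAt ℂ (u j) q :=
    Filter.eventually_all.2 fun j => (hu j).eventually_analyticAt
  have h2 : ∀ᶠ q in 𝓝 p, LinearIndependent ℂ fun j => fderiv ℂ (u j) q := by
    have hc : ContinuousAt (fun q => fun j => fderiv ℂ (u j) q) p :=
      continuousAt_pi.2 fun j => (hu j).fderiv.continuousAt
    exact hc.eventually (isOpen_setOfPred_linearIndependent.mem_nhds hl)
  filter_upwards [h1, h2, ha.eventually, hb.eventually] with q q1 q2 q3 q4 hq
  refine ⟨k, u, q1, fun j => ?_, q2, q3, q4⟩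
  obtain ⟨b, -, hb⟩ := q4 j
  simpa [hq] using hb.self_of_nhds

lemma fderiv_sum_mul {a u : κ → E → ℂ} {p : E} (ha : ∀ j, DifferentiableAt ℂ (a j) p)
    (hu : ∀ j, DifferentiableAt ℂ (u j) p) (h0 : ∀ j, u j p = 0) :
    fderiv ℂ (fun x => ∑ j, a j x * u j x) p = ∑ j, a j p • fderiv ℂ (u j) p := by
  have h : HasFDerivAt (fun x => ∑ j, a j x * u j x)
      (∑ j, (a j p • fderiv ℂ (u j) p + u j p • fderiv ℂ (a j) p)) p :=
    HasFDerivAt.fun_sum fun j _ => (ha j).hasFDerivAt.mul (hu j).hasFDerivAt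
  rw [h.fderiv]
  ext v
  simp [h0]

/-- A combination of generators whose differential vanishes lies in the product of the ideal with
the maximal ideal. -/
lemma IsNonsingularAt.exists_of_fderiv_eq_zero {f : ι → E → ℂ} {p : E} (h : IsNonsingularAt f p)
    (c : ι → ℂ) (hc : fderiv ℂ (fun x => ∑ i, c i * f i x) p = 0) :
    ∃ b : ι → E → ℂ, (∀ i, AnalyticAt ℂ (b i) p) ∧ (∀ i, b i p = 0) ∧
      ∀ᶠ x in 𝓝 p, ∑ i, c i * f i x = ∑ i, b i x * f i x := by
  obtain ⟨k, u, hu, hu0, hl, ha, hb⟩ := h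
  choose a ha hf using ha
  choose b hb hu' using hb
  have hA : ∀ j, AnalyticAt ℂ (fun x => ∑ i, c i * a i j x) p := fun j =>
    Finset.analyticAt_fun_sum _ fun i _ => analyticAt_const.mul (ha i j)
  have heq : (fun x => ∑ i, c i * f i x) =ᶠ[𝓝 p] fun x => ∑ j, (∑ i, c i * a i j x) * u j x := by
    filter_upwards [Filter.eventually_all.2 hf] with x hx
    simp only [hx, Finset.mul_sum, Finset.sum_mul]
    rw [Finset.sum_comm]
    exact Finset.sum_congr rfl fun k _ => Finset.sum_congr rfl fun j _ => by ring
  rw [heq.fderiv_eq, fderiv_sum_mul (fun j => (hA j).differentiableAt)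
    (fun j => (hu j).differentiableAt) hu0] at hc
  -- Since the `u j` vanish at `p`, only the values of the coefficients at `p` enter the
  -- differential of the combination; independence of the `du j` makes them zero. Rewriting the `u
  -- j` through the `f i` keeps this vanishing.
  have hA0 := Fintype.linearIndependent_iff.1 hl _ hc
  refine ⟨fun i x => ∑ j, (∑ i, c i * a i j x) * b j i x, fun i => ?_, fun i => ?_, ?_⟩
  · exact Finset.analyticAt_fun_sum _ fun j _ => (hA j).mul (hb j i)
  · simp [hA0]
  · filter_upwards [heq, Filter.eventually_all.2 hu'] with x hx hux
    rw [hx]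
    simp only [hux, Finset.sum_mul (s := Finset.univ (α := Fin k))]
    rw [Finset.sum_comm]
    refine Finset.sum_congr rfl fun k _ => ?_
    rw [Finset.mul_sum]
    exact Finset.sum_congr rfl fun j _ => by ring

/-- The `u j` are combinations of functions that vanish at `p` together with their differentials, so
`du j = 0`. Independence then forces `k = 0`, and the ideal is zero. -/
lemma IsNonsingularAt.eventually_eq_zero {f : ι → E → ℂ} {p : E} (h : IsNonsingularAt f p)
    (hd : ∀ i, fderiv ℂ (f i) p = 0) : ∀ᶠ x in 𝓝 p, ∀ i, f i x = 0 := by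
  obtain ⟨k, u, hu, hu0, hl, ha, hb⟩ := h
  have hfd : ∀ i, DifferentiableAt ℂ (f i) p ∧ f i p = 0 := fun i => by
    obtain ⟨a, ha, hf⟩ := ha i
    refine ⟨DifferentiableAt.congr_of_eventuallyEq ?_ hf, by simpa [hu0] using hf.self_of_nhds⟩
    exact (Finset.analyticAt_fun_sum _ fun j _ => (ha j).mul (hu j)).differentiableAt
  have hz : ∀ j, fderiv ℂ (u j) p = 0 := fun j => by
    obtain ⟨b, hb, hu⟩ := hb j
    rw [Filter.EventuallyEq.fderiv_eq hu, fderiv_sum_mul (fun i => (hb i).differentiableAt)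
      (fun i => (hfd i).1) fun i => (hfd i).2]
    ext v
    simp [hd]
  have : IsEmpty (Fin k) := ⟨fun j => hl.ne_zero j (hz j)⟩
  refine Filter.eventually_all.2 fun i => ?_
  obtain ⟨a, -, hf⟩ := ha i
  filter_upwards [hf] with x hx
  simpa using hx

lemma isNonsingularAt_of_linearIndependent {f : ι → E → ℂ} {p : E} (hf : ∀ i, AnalyticAt ℂ (f i) p)
    (h0 : ∀ i, f i p = 0) (hl : LinearIndependent ℂ fun i => fderiv ℂ (f i) p) :
    IsNonsingularAt f p := by
  classical
  let e := Fintype.equivFin ι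
  refine ⟨Fintype.card ι, fun j => f (e.symm j), fun j => hf _, fun j => h0 _,
    hl.comp _ e.symm.injective, fun i => ⟨fun j _ => if j = e i then 1 else 0,
      fun j => analyticAt_const, .of_forall fun x => by simp⟩,
    fun j => ⟨fun i _ => if i = e.symm j then 1 else 0,
      fun j => analyticAt_const, .of_forall fun x => by simp⟩⟩

end Ideals

/-! ### A differential inequality along a line in the kernel of the Hessian -/

section Line

variable {V : Type*} [NormedAddCommGroup V] [NormedSpace ℂ V]

lemma hasDerivAt_line {W : Type*} [NormedAddCommGroup W] [NormedSpace ℂ W] {h : V → W} {κ : V}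
    {t : ℝ} (hd : DifferentiableAt ℂ h ((t : ℂ) • κ)) :
    HasDerivAt (fun t : ℝ => h ((t : ℂ) • κ)) (fderiv ℂ h ((t : ℂ) • κ) κ) t := by
  have h1 : HasDerivAt (fun z : ℂ => z • κ) κ (t : ℂ) := by
    simpa using (hasDerivAt_id (t : ℂ)).smul_const κ
  have h2 : HasDerivAt (fun z : ℂ => h (z • κ)) (fderiv ℂ h ((t : ℂ) • κ) κ) (t : ℂ) :=
    hd.hasFDerivAt.comp_hasDerivAt (t : ℂ) h1
  simpa [Function.comp_def] using h2.scomp t (Complex.ofRealCLM.hasDerivAt (x := t))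

variable [CompleteSpace V]

lemma exists_sub_eq_of_norm_le_half {B : V →L[ℂ] V} (hB : ‖B‖ ≤ 1 / 2) (κ : V) :
    ∃ v, v - B v = κ ∧ ‖v‖ ≤ 2 * ‖κ‖ := by
  have hB1 : ‖B‖ < 1 := by linarith
  let U := Units.oneSub B hB1
  have h : U.1 * U⁻¹.1 = 1 := U.mul_inv
  have h' : (1 - B) (U⁻¹.1 κ) = κ := DFunLike.congr_fun h κ
  refine ⟨U⁻¹.1 κ, by simpa using h', ?_⟩
  set v := U⁻¹.1 κ
  have h2 : v = κ + B v := by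
    have : v - B v = κ := by simpa using h'
    rw [← this]; abel
  have h3 : ‖v‖ ≤ ‖κ‖ + 1 / 2 * ‖v‖ := by
    conv_lhs => rw [h2]
    exact (norm_add_le _ _).trans (add_le_add le_rfl ((B.le_opNorm v).trans (by gcongr)))
  linarith

/-- The vectors `v - G (A v) - B w v` are perturbed kernel vectors of `A`. For small `w` the
equation `v - B w v = κ` is solvable, which makes such a vector equal to `κ - β` with `β = G (A v)`.
The correction `β` is itself controlled by `D²f·κ`, `f` and `df`, so the hypotheses on `κ - β`
become statements about `κ`. -/
lemma third_deriv_bounds {f : V → ℂ} (hf : AnalyticAt ℂ f 0)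
    {A : V →L[ℂ] V →L[ℂ] ℂ} (hA : fderiv ℂ (fderiv ℂ f) 0 = A)
    (G : (V →L[ℂ] ℂ) →L[ℂ] V) (hG : ∀ v, A (G (A v)) = A v)
    {B : V → V →L[ℂ] V} (hB : Filter.Tendsto B (𝓝 0) (𝓝 0)) {a : V → V →L[ℂ] ℂ} {C : ℝ}
    (hC : 0 ≤ C) (ha : ∀ᶠ w in 𝓝 0, ‖a w‖ ≤ C)
    (hi : ∀ᶠ w in 𝓝 0, ∀ v, ‖fderiv ℂ (fderiv ℂ f) w (v - G (A v) - B w v)‖ ≤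
      C * (‖f w‖ + ‖fderiv ℂ f w‖) * ‖v‖)
    (hii : ∀ᶠ w in 𝓝 0, ∀ v, ‖fderiv ℂ (fderiv ℂ (fderiv ℂ f)) w (v - G (A v) - B w v) -
      a w v • fderiv ℂ (fderiv ℂ f) w‖ ≤ C * (‖f w‖ + ‖fderiv ℂ f w‖) * ‖v‖)
    (κ : V) :
    ∃ K L : ℝ, 0 ≤ K ∧ ∀ᶠ w in 𝓝 0, ‖fderiv ℂ (fderiv ℂ (fderiv ℂ f)) w κ κ‖ ≤
        K * (‖fderiv ℂ (fderiv ℂ f) w κ‖ + (‖f w‖ + ‖fderiv ℂ f w‖)) ∧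
      (f w = 0 → fderiv ℂ f w = 0 → fderiv ℂ (fderiv ℂ f) w κ = 0 → ∃ α : ℂ, ‖α‖ ≤ L ∧
        fderiv ℂ (fderiv ℂ (fderiv ℂ f)) w κ = α • fderiv ℂ (fderiv ℂ f) w) := by
  set D1 := fderiv ℂ f with hD1
  set D2 := fderiv ℂ D1 with hD2
  set D3 := fderiv ℂ D2 with hD3
  have a1 : AnalyticAt ℂ D1 0 := hf.fderiv
  have a2 : AnalyticAt ℂ D2 0 := a1.fderiv
  have a3 : AnalyticAt ℂ D3 0 := a2.fderiv
  have e1 : ∀ᶠ w in 𝓝 (0 : V), ‖B w‖ ≤ 1 / 2 := by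
    filter_upwards [hB.norm.eventually_le_const (u := 1 / 2) (by simp)] with w hw using hw
  have e2 : ∀ᶠ w in 𝓝 (0 : V), ‖G‖ * ‖A - D2 w‖ ≤ 1 / 2 := by
    have : ContinuousAt (fun w => ‖G‖ * ‖A - D2 w‖) 0 :=
      continuousAt_const.mul (continuousAt_const.sub a2.continuousAt).norm
    exact this.tendsto.eventually_le_const (by rw [hA]; simp)
  have e3 : ∀ᶠ w in 𝓝 (0 : V), ‖D3 w‖ ≤ ‖D3 0‖ + 1 :=
    a3.continuousAt.norm.tendsto.eventually_le_const (by simp)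
  set M := ‖D3 0‖ + 1 with hM
  have hM0 : 0 ≤ M := by positivity
  have key : ∀ᶠ w in 𝓝 (0 : V), ∃ (α : ℂ) (β : V), ‖α‖ ≤ 2 * C * ‖κ‖ ∧
      ‖β‖ ≤ 2 * ‖G‖ * (‖D2 w κ‖ + 2 * C * ‖κ‖ * (‖f w‖ + ‖D1 w‖)) ∧
      ‖D3 w (κ - β) - α • D2 w‖ ≤ 2 * C * ‖κ‖ * (‖f w‖ + ‖D1 w‖) := by
    filter_upwards [e1, e2, ha, hi, hii] with w w1 w2 wa wi wii
    obtain ⟨v, hv, hvn⟩ := exists_sub_eq_of_norm_le_half w1 κ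
    set β := G (A v) with hβ
    have hsub : v - G (A v) - B w v = κ - β := by rw [← hv]; abel
    have hEn : 0 ≤ ‖f w‖ + ‖D1 w‖ := by positivity
    have hbd : C * (‖f w‖ + ‖D1 w‖) * ‖v‖ ≤ 2 * C * ‖κ‖ * (‖f w‖ + ‖D1 w‖) := by
      calc _ ≤ C * (‖f w‖ + ‖D1 w‖) * (2 * ‖κ‖) := by gcongr
        _ = _ := by ring
    refine ⟨a w v, β, ?_, ?_, ?_⟩
    · calc ‖a w v‖ ≤ ‖a w‖ * ‖v‖ := (a w).le_opNorm v
        _ ≤ C * (2 * ‖κ‖) := by gcongr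
        _ = _ := by ring
    · have hGA : β = G (D2 w β) + G ((A - D2 w) β) := by
        rw [← map_add, ← add_apply]
        simp [hβ, hG]
      have hD2β : ‖D2 w β‖ ≤ ‖D2 w κ‖ + 2 * C * ‖κ‖ * (‖f w‖ + ‖D1 w‖) := by
        have : D2 w β = D2 w κ - D2 w (κ - β) := by rw [map_sub]; abel
        rw [this]
        refine (norm_sub_le _ _).trans (add_le_add le_rfl ?_)
        rw [← hsub]
        exact (wi v).trans hbd
      have h3 : ‖β‖ ≤ ‖G‖ * (‖D2 w κ‖ + 2 * C * ‖κ‖ * (‖f w‖ + ‖D1 w‖)) + 1 / 2 * ‖β‖ := by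
        conv_lhs => rw [hGA]
        refine (norm_add_le _ _).trans (add_le_add ?_ ?_)
        · exact (G.le_opNorm _).trans (by gcongr)
        · refine (G.le_opNorm _).trans ?_
          calc ‖G‖ * ‖(A - D2 w) β‖ ≤ ‖G‖ * (‖A - D2 w‖ * ‖β‖) := by
                gcongr; exact (A - D2 w).le_opNorm β
            _ = ‖G‖ * ‖A - D2 w‖ * ‖β‖ := by ring
            _ ≤ _ := by gcongr
      linarith
    · rw [← hsub]
      exact (wii v).trans hbd
  set K : ℝ := M * (2 * ‖G‖ * (1 + 2 * C * ‖κ‖)) * ‖κ‖ + 2 * C * ‖κ‖ + 2 * C * ‖κ‖ * ‖κ‖ with hK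
  have hK0 : 0 ≤ K := by positivity
  have P1 : ∀ᶠ w in 𝓝 (0 : V), ‖D3 w κ κ‖ ≤ K * (‖D2 w κ‖ + (‖f w‖ + ‖D1 w‖)) := by
    filter_upwards [key, e3] with w ⟨α, β, hα, hβ, h⟩ w3
    set y := ‖D2 w κ‖
    set e := ‖f w‖ + ‖D1 w‖
    have he : 0 ≤ e := by positivity
    have hy : 0 ≤ y := norm_nonneg _
    have hβ' : ‖β‖ ≤ 2 * ‖G‖ * (1 + 2 * C * ‖κ‖) * (y + e) := by
      refine hβ.trans ?_
      have : y + 2 * C * ‖κ‖ * e ≤ (1 + 2 * C * ‖κ‖) * (y + e) := by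
        have : 0 ≤ 2 * C * ‖κ‖ * y := by positivity
        nlinarith
      calc _ ≤ 2 * ‖G‖ * ((1 + 2 * C * ‖κ‖) * (y + e)) := by gcongr
        _ = _ := by ring
    have hdec : D3 w κ κ = D3 w β κ + α • D2 w κ + (D3 w (κ - β) - α • D2 w) κ := by
      simp only [map_sub, sub_apply, smul_apply]
      abel
    rw [hdec]
    have t1 : ‖D3 w β κ‖ ≤ M * (2 * ‖G‖ * (1 + 2 * C * ‖κ‖)) * ‖κ‖ * (y + e) := by
      calc ‖D3 w β κ‖ ≤ ‖D3 w β‖ * ‖κ‖ := (D3 w β).le_opNorm κ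
        _ ≤ (‖D3 w‖ * ‖β‖) * ‖κ‖ := by gcongr; exact (D3 w).le_opNorm β
        _ ≤ (M * (2 * ‖G‖ * (1 + 2 * C * ‖κ‖) * (y + e))) * ‖κ‖ := by gcongr
        _ = _ := by ring
    have t2 : ‖α • D2 w κ‖ ≤ 2 * C * ‖κ‖ * (y + e) := by
      rw [norm_smul]
      calc _ ≤ 2 * C * ‖κ‖ * y := by gcongr
        _ ≤ _ := by gcongr; linarith
    have t3 : ‖(D3 w (κ - β) - α • D2 w) κ‖ ≤ 2 * C * ‖κ‖ * ‖κ‖ * (y + e) := by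
      calc _ ≤ ‖D3 w (κ - β) - α • D2 w‖ * ‖κ‖ := ContinuousLinearMap.le_opNorm _ _
        _ ≤ (2 * C * ‖κ‖ * e) * ‖κ‖ := by gcongr
        _ ≤ (2 * C * ‖κ‖ * (y + e)) * ‖κ‖ := by gcongr; linarith
        _ = _ := by ring
    calc _ ≤ ‖D3 w β κ‖ + ‖α • D2 w κ‖ + ‖(D3 w (κ - β) - α • D2 w) κ‖ := norm_add₃_le
      _ ≤ _ := by rw [hK]; linarith
  have P2 : ∀ᶠ w in 𝓝 (0 : V), f w = 0 → D1 w = 0 → D2 w κ = 0 →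
      ∃ α : ℂ, ‖α‖ ≤ 2 * C * ‖κ‖ ∧ D3 w κ = α • D2 w := by
    filter_upwards [key] with w ⟨α, β, hα, hβ, h⟩ q1 q2 q3
    simp only [q1, q2, q3, norm_zero, add_zero, mul_zero, norm_le_zero_iff] at hβ h
    rw [hβ, sub_zero] at h
    exact ⟨α, hα, sub_eq_zero.1 h⟩
  exact ⟨K, 2 * C * ‖κ‖, hK0, P1.and P2⟩

/-- If the ideal generated by `f` and its first derivatives contains, up to terms of higher order,
the derivatives along the kernel of the Hessian `A` of `f` at `0`, then `f` and its first
derivatives vanish on that kernel near `0`, and the Hessian of `f` is there a multiple of `A`. -/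
theorem vanish_on_kernel_line {f : V → ℂ} (hf : AnalyticAt ℂ f 0) (h0 : f 0 = 0)
    (h1 : fderiv ℂ f 0 = 0) {A : V →L[ℂ] V →L[ℂ] ℂ} (hA : fderiv ℂ (fderiv ℂ f) 0 = A)
    (G : (V →L[ℂ] ℂ) →L[ℂ] V) (hG : ∀ v, A (G (A v)) = A v)
    {B : V → V →L[ℂ] V} (hB : Filter.Tendsto B (𝓝 0) (𝓝 0)) {a : V → V →L[ℂ] ℂ} {C : ℝ}
    (hC : 0 ≤ C) (ha : ∀ᶠ w in 𝓝 0, ‖a w‖ ≤ C)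
    (hi : ∀ᶠ w in 𝓝 0, ∀ v, ‖fderiv ℂ (fderiv ℂ f) w (v - G (A v) - B w v)‖ ≤
      C * (‖f w‖ + ‖fderiv ℂ f w‖) * ‖v‖)
    (hii : ∀ᶠ w in 𝓝 0, ∀ v, ‖fderiv ℂ (fderiv ℂ (fderiv ℂ f)) w (v - G (A v) - B w v) -
      a w v • fderiv ℂ (fderiv ℂ f) w‖ ≤ C * (‖f w‖ + ‖fderiv ℂ f w‖) * ‖v‖)
    {κ : V} (hκ : A κ = 0) :
    ∃ d : ℝ, 0 < d ∧ ∀ t ∈ Set.Icc (0 : ℝ) d, f ((t : ℂ) • κ) = 0 ∧ fderiv ℂ f ((t : ℂ) • κ) = 0 ∧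
      ∀ l : (V →L[ℂ] V →L[ℂ] ℂ) →L[ℂ] ℂ, l A = 0 →
        l (fderiv ℂ (fderiv ℂ f) ((t : ℂ) • κ)) = 0 := by
  obtain ⟨K, L, hK0, hP⟩ := third_deriv_bounds hf hA G hG hB hC ha hi hii κ
  set D1 := fderiv ℂ f with hD1
  set D2 := fderiv ℂ D1 with hD2
  set D3 := fderiv ℂ D2 with hD3
  have a1 : AnalyticAt ℂ D1 0 := hf.fderiv
  have a2 : AnalyticAt ℂ D2 0 := a1.fderiv
  have hline : Filter.Tendsto (fun t : ℝ => (t : ℂ) • κ) (𝓝 0) (𝓝 0) := by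
    have : Continuous fun t : ℝ => (t : ℂ) • κ := by fun_prop
    simpa using this.tendsto 0
  have hev := hline.eventually (hP.and (hf.eventually_analyticAt.and
    (a1.eventually_analyticAt.and a2.eventually_analyticAt)))
  obtain ⟨d, hd, hball⟩ := Metric.eventually_nhds_iff.1 hev
  have hgood : ∀ t ∈ Set.Icc (0 : ℝ) (d / 2), _ := fun t ht => @hball t (by
    rw [Real.dist_0_eq_abs, abs_of_nonneg ht.1]; linarith [ht.2])
  have c1 : ∀ t ∈ Set.Icc (0 : ℝ) (d / 2),
      HasDerivAt (fun t : ℝ => f ((t : ℂ) • κ)) (D1 ((t : ℂ) • κ) κ) t := fun t ht =>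
    hasDerivAt_line (hgood t ht).2.1.differentiableAt
  have c2 : ∀ t ∈ Set.Icc (0 : ℝ) (d / 2),
      HasDerivAt (fun t : ℝ => D1 ((t : ℂ) • κ)) (D2 ((t : ℂ) • κ) κ) t := fun t ht =>
    hasDerivAt_line (hgood t ht).2.2.1.differentiableAt
  have c3 : ∀ t ∈ Set.Icc (0 : ℝ) (d / 2),
      HasDerivAt (fun t : ℝ => D2 ((t : ℂ) • κ)) (D3 ((t : ℂ) • κ) κ) t := fun t ht =>
    hasDerivAt_line (hgood t ht).2.2.2.differentiableAt
  have c4 : ∀ t ∈ Set.Icc (0 : ℝ) (d / 2),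
      HasDerivAt (fun t : ℝ => D2 ((t : ℂ) • κ) κ) (D3 ((t : ℂ) • κ) κ κ) t := fun t ht =>
    ((ContinuousLinearMap.apply ℂ (V →L[ℂ] ℂ) κ).restrictScalars ℝ).hasFDerivAt.comp_hasDerivAt t
      (c3 t ht)
  -- The triple satisfies `‖Z'‖ ≤ const · ‖Z‖` and `Z 0 = 0`, so it vanishes identically.
  let Z : ℝ → ℂ × (V →L[ℂ] ℂ) × (V →L[ℂ] ℂ) := fun t =>
    (f ((t : ℂ) • κ), D1 ((t : ℂ) • κ), D2 ((t : ℂ) • κ) κ)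
  have hZd : ∀ t ∈ Set.Icc (0 : ℝ) (d / 2), HasDerivAt Z
      (D1 ((t : ℂ) • κ) κ, D2 ((t : ℂ) • κ) κ, D3 ((t : ℂ) • κ) κ κ) t := fun t ht =>
    (c1 t ht).prodMk ((c2 t ht).prodMk (c4 t ht))
  have hZ : ∀ t ∈ Set.Icc (0 : ℝ) (d / 2), Z t = 0 := by
    refine eq_zero_of_abs_deriv_le_mul_abs_self_of_eq_zero_right (K := ‖κ‖ + 1 + K * 3)
      (fun t ht => (hZd t ht).continuousAt.continuousWithinAt)
      (fun t ht => (hZd t (Set.Ico_subset_Icc_self ht)).hasDerivWithinAt) ?_ ?_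
    · simp [Z, h0, h1, hA, hκ]
    · intro t ht
      have hp := (hgood t (Set.Ico_subset_Icc_self ht)).1.1
      have n1 : ‖f ((t : ℂ) • κ)‖ ≤ ‖Z t‖ := norm_fst_le (Z t)
      have n2 : ‖D1 ((t : ℂ) • κ)‖ ≤ ‖Z t‖ := (norm_fst_le (Z t).2).trans (norm_snd_le (Z t))
      have n3 : ‖D2 ((t : ℂ) • κ) κ‖ ≤ ‖Z t‖ := (norm_snd_le (Z t).2).trans (norm_snd_le (Z t))
      have hκ0 := norm_nonneg κ
      have hZ0 := norm_nonneg (Z t)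
      have hKZ : 0 ≤ K * ‖Z t‖ := by positivity
      have hκZ : 0 ≤ ‖κ‖ * ‖Z t‖ := by positivity
      refine norm_prod_le_iff.2 ⟨?_, norm_prod_le_iff.2 ⟨?_, ?_⟩⟩
      · calc ‖D1 ((t : ℂ) • κ) κ‖ ≤ ‖D1 ((t : ℂ) • κ)‖ * ‖κ‖ := ContinuousLinearMap.le_opNorm _ _
          _ ≤ ‖Z t‖ * ‖κ‖ := by gcongr
          _ ≤ _ := by nlinarith
      · calc ‖D2 ((t : ℂ) • κ) κ‖ ≤ ‖Z t‖ := n3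
          _ ≤ _ := by nlinarith
      · calc ‖D3 ((t : ℂ) • κ) κ κ‖ ≤ K * (‖Z t‖ + (‖Z t‖ + ‖Z t‖)) := hp.trans (by gcongr)
          _ ≤ _ := by nlinarith
  refine ⟨d / 2, by positivity, fun t ht => ?_⟩
  have hz : ∀ t ∈ Set.Icc (0 : ℝ) (d / 2), f ((t : ℂ) • κ) = 0 ∧ D1 ((t : ℂ) • κ) = 0 ∧
      D2 ((t : ℂ) • κ) κ = 0 := fun t ht => by
    have := hZ t ht
    simp only [Z, Prod.mk_eq_zero] at this
    exact this
  refine ⟨(hz t ht).1, (hz t ht).2.1, fun l hl => ?_⟩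
  -- On the segment `D³f·κ = α D²f` with `α` bounded, so a linear functional that kills `A` kills
  -- `D²f` by a second application of Gronwall's inequality.
  have c5 : ∀ t ∈ Set.Icc (0 : ℝ) (d / 2),
      HasDerivAt (fun t : ℝ => l (D2 ((t : ℂ) • κ))) (l (D3 ((t : ℂ) • κ) κ)) t := fun t ht =>
    ((l.restrictScalars ℝ).hasFDerivAt).comp_hasDerivAt t (c3 t ht)
  refine eq_zero_of_abs_deriv_le_mul_abs_self_of_eq_zero_right (K := L)
    (fun t ht => (c5 t ht).continuousAt.continuousWithinAt)
    (fun t ht => (c5 t (Set.Ico_subset_Icc_self ht)).hasDerivWithinAt) ?_ ?_ t ht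
  · simp [hA, hl]
  · intro t ht
    have ht' := Set.Ico_subset_Icc_self ht
    obtain ⟨α, hα, h⟩ := (hgood t ht').1.2 (hz t ht').1 (hz t ht').2.1 (hz t ht').2.2
    rw [h, map_smul, norm_smul]
    gcongr

end Line

/-! ### The Siegel upper half-space is open and convex -/

section SiegelSet

variable {g : ℕ}

lemma symMatrix_im_isHermitian (t : SymCoord g) : ((symMatrix t).map Complex.im).IsHermitian := by
  ext i j
  simp [symMatrix, Sym2.eq_swap]

lemma isOpen_siegelSet (g : ℕ) : IsOpen (siegelSet g) := by
  refine Metric.isOpen_iff.2 fun t ht => ?_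
  obtain ⟨c, hc, hq⟩ := posDef_lower_bound ht
  refine ⟨c / (g + 1), by positivity, fun u hu => ?_⟩
  rw [Metric.mem_ball, dist_eq_norm] at hu
  refine Matrix.PosDef.of_dotProduct_mulVec_pos (symMatrix_im_isHermitian u) fun n hn => ?_
  rw [star_trivial]
  have hN : 0 < ∑ i, n i ^ 2 := by
    obtain ⟨i, hi⟩ := Function.ne_iff.1 hn
    exact Finset.sum_pos' (fun i _ => sq_nonneg _) ⟨i, Finset.mem_univ i, by
      have : n i ≠ 0 := hi
      positivity⟩
  have hdiff : n ⬝ᵥ ((symMatrix t).map Complex.im).mulVec n -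
      n ⬝ᵥ ((symMatrix u).map Complex.im).mulVec n ≤ ‖u - t‖ * (g * ∑ i, n i ^ 2) := by
    have e1 : n ⬝ᵥ ((symMatrix t).map Complex.im).mulVec n -
        n ⬝ᵥ ((symMatrix u).map Complex.im).mulVec n =
        ∑ i, ∑ j, n i * (((t - u) s(i, j)).im * n j) := by
      simp [dotProduct, Matrix.mulVec, symMatrix, Finset.mul_sum, sub_mul, mul_sub]
    have e2 : (∑ i, |n i|) ^ 2 ≤ g * ∑ i, n i ^ 2 := by
      simpa using sq_sum_le_card_mul_sum_sq (s := Finset.univ) (f := fun i => |n i|)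
    rw [e1]
    calc _ ≤ ∑ i, ∑ j, |n i| * (‖u - t‖ * |n j|) := by
          refine Finset.sum_le_sum fun i _ => Finset.sum_le_sum fun j _ => ?_
          refine (le_abs_self _).trans ?_
          rw [abs_mul, abs_mul]
          gcongr
          refine (Complex.abs_im_le_norm _).trans ?_
          rw [norm_sub_rev]
          exact norm_le_pi_norm (t - u) s(i, j)
      _ = ‖u - t‖ * (∑ i, |n i|) ^ 2 := by
          rw [sq, Finset.sum_mul_sum, Finset.mul_sum]
          refine Finset.sum_congr rfl fun i _ => ?_
          rw [Finset.mul_sum]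
          exact Finset.sum_congr rfl fun j _ => by ring
      _ ≤ _ := by gcongr
  have h2 : ‖u - t‖ * (g + 1) < c := (lt_div_iff₀ (by positivity)).1 hu
  have h3 := hq n
  have h4 := norm_nonneg (u - t)
  nlinarith [mul_lt_mul_of_pos_right h2 hN, mul_nonneg h4 hN.le]

lemma convex_siegelSet (g : ℕ) : Convex ℝ (siegelSet g) := by
  intro t ht u hu a b ha hb hab
  have e : (symMatrix (a • t + b • u)).map Complex.im =
      a • (symMatrix t).map Complex.im + b • (symMatrix u).map Complex.im := by
    ext i j
    simp [symMatrix]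
  change ((symMatrix (a • t + b • u)).map Complex.im).PosDef
  rw [e]
  rcases ha.eq_or_lt with rfl | ha
  · have : b = 1 := by linarith
    rw [this, zero_smul, zero_add, one_smul]
    exact hu
  · exact (Matrix.PosDef.smul ht ha).add_posSemidef (hu.posSemidef.smul hb)

lemma eventually_fst_mem_siegelSet {x : SymCoord g × (Fin g → ℂ)} (hx : x.1 ∈ siegelSet g) :
    ∀ᶠ y in 𝓝 x, y.1 ∈ siegelSet g :=
  continuous_fst.continuousAt.eventually ((isOpen_siegelSet g).mem_nhds hx)

end SiegelSet

/-! ### The equations of the singular locus at a nonsingular point `(τ, 0)` -/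

section System

variable {g : ℕ} {ε δ : Fin g → ZMod 2}

/-- The functions `F = θ[ε, δ], ∂F/∂z_1, …, ∂F/∂z_g` of `(τ, z)`. -/
def thetaSys (ε δ : Fin g → ZMod 2) : Option (Fin g) → SymCoord g × (Fin g → ℂ) → ℂ
  | none => thetaSum ε δ []
  | some i => thetaSum ε δ [Pi.single i 1]

lemma thetaSys_none : thetaSys ε δ none = thetaSum ε δ [] := rfl

lemma thetaSys_some (i : Fin g) : thetaSys ε δ (some i) = thetaSum ε δ [Pi.single i 1] := rfl

lemma thetaSum_differentiableAt (s : List (Fin g → ℂ)) {x : SymCoord g × (Fin g → ℂ)}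
    (hx : x.1 ∈ siegelSet g) : DifferentiableAt ℂ (thetaSum ε δ s) x :=
  (thetaSum_analyticAt ε δ s hx).differentiableAt

lemma thetaSum_eq_zero_of_basis {s : List (Fin g → ℂ)} {x : SymCoord g × (Fin g → ℂ)}
    (hx : x.1 ∈ siegelSet g) (h : ∀ i, thetaSum ε δ (Pi.single i 1 :: s) x = 0) (v : Fin g → ℂ) :
    thetaSum ε δ (v :: s) x = 0 := by
  rw [thetaSum_cons_eq_sum hx]
  simp [h]

lemma fderiv_thetaSum_eq_zero {s : List (Fin g → ℂ)} {x : SymCoord g × (Fin g → ℂ)}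
    (hx : x.1 ∈ siegelSet g) (h1 : ∀ i, thetaSum ε δ (Pi.single i 1 :: s) x = 0)
    (h2 : ∀ i j, thetaSum ε δ (Pi.single i 1 :: Pi.single j 1 :: s) x = 0) :
    fderiv ℂ (thetaSum ε δ s) x = 0 := by
  refine ContinuousLinearMap.ext fun d => ?_
  have hd : d = (d.1, 0) + (0, d.2) := by simp
  rw [hd, map_add, thetaSum_fderiv_fst_eq_zero hx h2, thetaSum_fderiv_snd hx,
    thetaSum_eq_zero_of_basis hx h1]
  simp

/-- For `κ` in the kernel of the Hessian at a smooth point, `∂F/∂κ` lies in the product of the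
maximal ideal with the ideal of the singular locus. -/
lemma exists_kernel_identity (he : IsEvenChar ε δ) {t : SymCoord g} (ht : t ∈ siegelSet g)
    (hn : IsNonsingularAt (thetaSys ε δ) (t, 0)) {κ : Fin g → ℂ}
    (hκ : ∀ i, thetaSum ε δ [Pi.single i 1, κ] (t, 0) = 0) :
    ∃ b : Option (Fin g) → SymCoord g × (Fin g → ℂ) → ℂ, (∀ i, AnalyticAt ℂ (b i) (t, 0)) ∧
      (∀ i, b i (t, 0) = 0) ∧
      ∀ᶠ x in 𝓝 (t, 0), thetaSum ε δ [κ] x = ∑ i, b i x * thetaSys ε δ i x := by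
  let c : Option (Fin g) → ℂ := fun o => o.elim 0 κ
  have heq : (fun x => ∑ i, c i * thetaSys ε δ i x) =ᶠ[𝓝 (t, 0)] thetaSum ε δ [κ] := by
    filter_upwards [eventually_fst_mem_siegelSet (x := (t, (0 : Fin g → ℂ))) ht] with x hx
    rw [thetaSum_cons_eq_sum hx, Fintype.sum_option]
    simp [c, thetaSys_some]
  -- The `z`-part of the differential of `∂F/∂κ` is the Hessian applied to `κ`; by the heat equation
  -- the `τ`-part consists of third derivatives, which vanish by parity.
  obtain ⟨b, hb, hb0, h⟩ := hn.exists_of_fderiv_eq_zero c (by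
    rw [heq.fderiv_eq]
    refine fderiv_thetaSum_eq_zero ht hκ fun i j => thetaSum_odd_zero he t ?_
    exact ⟨1, rfl⟩)
  refine ⟨b, hb, hb0, ?_⟩
  filter_upwards [h, heq] with x hx hx'
  rw [← hx', hx]

/-- By the product rule the difference is `Σ u i · db i`, and the `db i` are bounded near `p`. -/
lemma fderiv_sub_sum_le {E ι : Type*} [NormedAddCommGroup E] [NormedSpace ℂ E] [Fintype ι]
    {G : E → ℂ} {b u : ι → E → ℂ} {p : E} (hb : ∀ i, AnalyticAt ℂ (b i) p)
    (hu : ∀ i, AnalyticAt ℂ (u i) p) (h : ∀ᶠ x in 𝓝 p, G x = ∑ i, b i x * u i x) :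
    ∃ M : ℝ, 0 ≤ M ∧ ∀ᶠ x in 𝓝 p, ∀ d, ‖fderiv ℂ G x d - ∑ i, b i x * fderiv ℂ (u i) x d‖ ≤
      M * ‖d‖ * ∑ i, ‖u i x‖ := by
  refine ⟨∑ i, (‖fderiv ℂ (b i) p‖ + 1), by positivity, ?_⟩
  have h1 : ∀ᶠ x in 𝓝 p, ∀ i, ‖fderiv ℂ (b i) x‖ ≤ ‖fderiv ℂ (b i) p‖ + 1 :=
    Filter.eventually_all.2 fun i =>
      (hb i).fderiv.continuousAt.norm.tendsto.eventually_le_const (by simp)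
  filter_upwards [h1, h.eventually_nhds,
    Filter.eventually_all.2 fun i => (hb i).eventually_analyticAt,
    Filter.eventually_all.2 fun i => (hu i).eventually_analyticAt] with x x1 x2 x3 x4 d
  have hd : HasFDerivAt (fun x => ∑ i, b i x * u i x)
      (∑ i, (b i x • fderiv ℂ (u i) x + u i x • fderiv ℂ (b i) x)) x :=
    HasFDerivAt.fun_sum fun i _ =>
      (x3 i).differentiableAt.hasFDerivAt.mul (x4 i).differentiableAt.hasFDerivAt
  rw [Filter.EventuallyEq.fderiv_eq x2, hd.fderiv]
  have e : (∑ i, (b i x • fderiv ℂ (u i) x + u i x • fderiv ℂ (b i) x)) d -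
      ∑ i, b i x * fderiv ℂ (u i) x d = ∑ i, u i x * fderiv ℂ (b i) x d := by
    simp [Finset.sum_add_distrib]
  rw [e, Finset.mul_sum]
  refine norm_sum_le_of_le _ fun i _ => ?_
  rw [norm_mul, mul_comm]
  gcongr
  refine (ContinuousLinearMap.le_opNorm _ _).trans ?_
  gcongr
  exact (x1 i).trans (Finset.single_le_sum (f := fun i => ‖fderiv ℂ (b i) p‖ + 1)
    (fun i _ => by positivity) (Finset.mem_univ i))

lemma thetaSum_slice_hasFDerivAt {t : SymCoord g} (ht : t ∈ siegelSet g) (s : List (Fin g → ℂ))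
    (w : Fin g → ℂ) : HasFDerivAt (fun w => thetaSum ε δ s (t, w))
      ((fderiv ℂ (thetaSum ε δ s) (t, w)).comp (ContinuousLinearMap.inr ℂ _ _)) w := by
  have h1 : HasFDerivAt (thetaSum ε δ s) (fderiv ℂ (thetaSum ε δ s) (t, w)) (t, w) :=
    (thetaSum_differentiableAt s ht).hasFDerivAt
  exact h1.comp w (hasFDerivAt_prodMk_right t w)

lemma fderiv_thetaSum_slice {t : SymCoord g} (ht : t ∈ siegelSet g) (s : List (Fin g → ℂ))
    (w v : Fin g → ℂ) :
    fderiv ℂ (fun w => thetaSum ε δ s (t, w)) w v = thetaSum ε δ (v :: s) (t, w) := by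
  rw [(thetaSum_slice_hasFDerivAt ht s w).fderiv]
  exact thetaSum_fderiv_snd (x := (t, w)) ht v

lemma analyticAt_thetaSum_slice {t : SymCoord g} (ht : t ∈ siegelSet g) (s : List (Fin g → ℂ))
    (w : Fin g → ℂ) : AnalyticAt ℂ (fun w => thetaSum ε δ s (t, w)) w :=
  AnalyticAt.comp (f := fun w => (t, w)) (thetaSum_analyticAt ε δ s (x := (t, w)) ht)
    (analyticAt_const.prod analyticAt_id)

lemma fderiv_apply_eq {V W : Type*} [NormedAddCommGroup V] [NormedSpace ℂ V]
    [NormedAddCommGroup W] [NormedSpace ℂ W] {h : V → V →L[ℂ] W} {w : V}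
    (hd : DifferentiableAt ℂ h w) (v v' : V) :
    fderiv ℂ h w v v' = fderiv ℂ (fun w => h w v') w v := by
  rw [fderiv_clm_apply hd (differentiableAt_const _)]
  simp

lemma fderiv2_thetaSum_slice {t : SymCoord g} (ht : t ∈ siegelSet g) (s : List (Fin g → ℂ))
    (w v v' : Fin g → ℂ) :
    fderiv ℂ (fderiv ℂ fun w => thetaSum ε δ s (t, w)) w v v' =
      thetaSum ε δ (v :: v' :: s) (t, w) := by
  rw [fderiv_apply_eq (analyticAt_thetaSum_slice ht s w).fderiv.differentiableAt]
  simp only [fderiv_thetaSum_slice ht]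

lemma fderiv3_thetaSum_slice {t : SymCoord g} (ht : t ∈ siegelSet g) (s : List (Fin g → ℂ))
    (w v v' v'' : Fin g → ℂ) :
    fderiv ℂ (fderiv ℂ (fderiv ℂ fun w => thetaSum ε δ s (t, w))) w v v' v'' =
      thetaSum ε δ (v :: v' :: v'' :: s) (t, w) := by
  have h := (analyticAt_thetaSum_slice (ε := ε) (δ := δ) ht s w).fderiv.fderiv.differentiableAt
  rw [fderiv_apply_eq h, fderiv_apply_eq (h.clm_apply (differentiableAt_const _))]
  simp only [fderiv2_thetaSum_slice ht, fderiv_thetaSum_slice ht]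

end System

/-! ### Bounds obtained by differentiating the kernel identity -/

section KernelLine

variable {g : ℕ} {ε δ : Fin g → ZMod 2}

lemma clm_apply_eq_sum {W : Type*} [NormedAddCommGroup W] [NormedSpace ℂ W]
    (L : (Fin g → ℂ) →L[ℂ] W) (v : Fin g → ℂ) : L v = ∑ i, v i • L (Pi.single i 1) := by
  conv_lhs => rw [pi_eq_sum_univ' v]
  simp only [map_sum, map_smul]

lemma norm_clm_le_sum {W : Type*} [NormedAddCommGroup W] [NormedSpace ℂ W]
    (L : (Fin g → ℂ) →L[ℂ] W) : ‖L‖ ≤ ∑ i, ‖L (Pi.single i 1)‖ := by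
  refine L.opNorm_le_bound (by positivity) fun v => ?_
  rw [clm_apply_eq_sum, Finset.sum_mul]
  refine norm_sum_le_of_le _ fun i _ => ?_
  rw [norm_smul, mul_comm]
  gcongr
  exact norm_le_pi_norm v i

lemma norm_single_one_le (i : Fin g) : ‖(Pi.single i 1 : Fin g → ℂ)‖ ≤ 1 := by
  refine (pi_norm_le_iff_of_nonneg zero_le_one).2 fun j => ?_
  by_cases h : j = i <;> simp [h]

lemma norm_symDir_single_le (i j : Fin g) :
    ‖(symDir (Pi.single i 1) (Pi.single j 1) : SymCoord g)‖ ≤ 2 := by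
  have h : ∀ i a : Fin g, ‖(Pi.single i 1 : Fin g → ℂ) a‖ ≤ 1 := fun i a =>
    (norm_le_pi_norm _ a).trans (norm_single_one_le i)
  refine (pi_norm_le_iff_of_nonneg zero_le_two).2 fun q => ?_
  induction q using Sym2.ind with
  | _ a b =>
    simp only [symDir, Sym2.lift_mk]
    have h2 : ∀ i j a b : Fin g,
        ‖(Pi.single i 1 : Fin g → ℂ) a * (Pi.single j 1 : Fin g → ℂ) b‖ ≤ 1 := fun i j a b => by
      rw [norm_mul]
      exact mul_le_one₀ (h i a) (norm_nonneg _) (h j b)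
    exact (norm_add_le _ _).trans ((add_le_add (h2 i j a b) (h2 j i a b)).trans (by norm_num))

/-- Both bounds come from `∂_κF = b₀F + Σ bᵢ∂ᵢF`, with `α = b₀` and `β = (bᵢ)`. The first is its
`z`-derivative, where the term `b₀∂ⱼF` is absorbed into the right-hand side. The second is its
`τ`-derivative, which the heat equation turns into a relation between third and second
`z`-derivatives. -/
lemma exists_kernel_bounds (he : IsEvenChar ε δ) {t : SymCoord g} (ht : t ∈ siegelSet g)
    (hn : IsNonsingularAt (thetaSys ε δ) (t, 0)) {κ : Fin g → ℂ}
    (hκ : ∀ i, thetaSum ε δ [Pi.single i 1, κ] (t, 0) = 0) :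
    ∃ (α : (Fin g → ℂ) → ℂ) (β : (Fin g → ℂ) → Fin g → ℂ) (C : ℝ), 0 ≤ C ∧
      Filter.Tendsto α (𝓝 0) (𝓝 0) ∧ Filter.Tendsto β (𝓝 0) (𝓝 0) ∧
      ∀ᶠ w in 𝓝 0,
        ‖fderiv ℂ (fderiv ℂ fun w => thetaSum ε δ [] (t, w)) w (κ - β w)‖ ≤
          C * (‖thetaSum ε δ [] (t, w)‖ + ‖fderiv ℂ (fun w => thetaSum ε δ [] (t, w)) w‖) ∧
        ‖fderiv ℂ (fderiv ℂ (fderiv ℂ fun w => thetaSum ε δ [] (t, w))) w (κ - β w) -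
            α w • fderiv ℂ (fderiv ℂ fun w => thetaSum ε δ [] (t, w)) w‖ ≤
          C * (‖thetaSum ε δ [] (t, w)‖ + ‖fderiv ℂ (fun w => thetaSum ε δ [] (t, w)) w‖) := by
  obtain ⟨b, hb, hb0, hid⟩ := exists_kernel_identity he ht hn hκ
  have hu : ∀ o, AnalyticAt ℂ (thetaSys ε δ o) (t, (0 : Fin g → ℂ)) := fun o => by
    cases o <;> exact thetaSum_analyticAt ε δ _ ht
  obtain ⟨M, hM, hbd⟩ := fderiv_sub_sum_le hb hu hid
  have hincl : Filter.Tendsto (fun w : Fin g → ℂ => (t, w)) (𝓝 0) (𝓝 (t, 0)) :=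
    (by fun_prop : Continuous fun w : Fin g → ℂ => (t, w)).tendsto 0
  have hb' : ∀ o, Filter.Tendsto (fun w : Fin g → ℂ => b o (t, w)) (𝓝 0) (𝓝 0) := fun o => by
    have := (hb o).continuousAt.tendsto.comp hincl
    rwa [hb0 o] at this
  have hα1 : ∀ᶠ w in 𝓝 (0 : Fin g → ℂ), ‖b none (t, w)‖ ≤ 1 :=
    (hb' none).norm.eventually_le_const (by simp)
  have hC1 : 0 ≤ g * (M * (g + 1) + 1) := by positivity
  have hC2 : 0 ≤ g * (g * (2 * Real.pi * (M * 2 * (g + 1)))) := by positivity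
  refine ⟨fun w => b none (t, w), fun w i => b (some i) (t, w),
    g * (M * (g + 1) + 1) + g * (g * (2 * Real.pi * (M * 2 * (g + 1)))), by positivity, hb' none,
    tendsto_pi_nhds.2 fun i => hb' (some i), ?_⟩
  filter_upwards [hincl.eventually hbd, hα1] with w hw hw1
  set D1 := fderiv ℂ fun w => thetaSum ε δ [] (t, w) with hD1
  set e := ‖thetaSum ε δ [] (t, w)‖ + ‖D1 w‖ with hE
  have he0 : 0 ≤ e := by positivity
  have hFi : ∀ i, ‖thetaSum ε δ [Pi.single i 1] (t, w)‖ ≤ ‖D1 w‖ := fun i => by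
    rw [← fderiv_thetaSum_slice ht]
    refine ((D1 w).le_opNorm _).trans ?_
    have := norm_single_one_le i
    have := norm_nonneg (D1 w)
    nlinarith
  have hsys : ∑ o, ‖thetaSys ε δ o (t, w)‖ ≤ (g + 1) * e := by
    rw [Fintype.sum_option]
    have : ∑ i, ‖thetaSys ε δ (some i) (t, w)‖ ≤ g * ‖D1 w‖ := by
      simpa [thetaSys_some] using Finset.sum_le_sum fun i (_ : i ∈ Finset.univ) => hFi i
    rw [thetaSys_none]
    have h1 := norm_nonneg (D1 w)
    have h2 := norm_nonneg (thetaSum ε δ [] (t, w))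
    have hg : (0 : ℝ) ≤ g := Nat.cast_nonneg g
    nlinarith [mul_nonneg hg h2]
  have hcoord : ∀ s : List (Fin g → ℂ), ∀ β : Fin g → ℂ,
      thetaSum ε δ ((κ - β) :: s) (t, w) = thetaSum ε δ (κ :: s) (t, w) -
        ∑ i, β i * thetaSum ε δ (Pi.single i 1 :: s) (t, w) := fun s β => by
    rw [← thetaSum_cons_eq_sum (x := (t, w)) ht, eq_sub_iff_add_eq,
      ← thetaSum_cons_add (x := (t, w)) ht, sub_add_cancel]
  constructor
  · refine (norm_clm_le_sum _).trans ?_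
    have : ∀ j ∈ Finset.univ, ‖fderiv ℂ D1 w (κ - fun i => b (some i) (t, w)) (Pi.single j 1)‖ ≤
        (M * (g + 1) + 1) * e := fun j _ => by
      have h1 := hw (0, Pi.single j 1)
      rw [Fintype.sum_option] at h1
      simp only [thetaSys_none, thetaSys_some,
        thetaSum_fderiv_snd (x := (t, w)) ht] at h1
      have h2 : fderiv ℂ D1 w (κ - fun i => b (some i) (t, w)) (Pi.single j 1) =
          (thetaSum ε δ [Pi.single j 1, κ] (t, w) -
            (b none (t, w) * thetaSum ε δ [Pi.single j 1] (t, w) +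
              ∑ i, b (some i) (t, w) * thetaSum ε δ [Pi.single j 1, Pi.single i 1] (t, w))) +
            b none (t, w) * thetaSum ε δ [Pi.single j 1] (t, w) := by
        rw [hD1, fderiv2_thetaSum_slice ht, hcoord, thetaSum_swap]
        simp only [thetaSum_swap (ε := ε) (δ := δ) (s := []) (Pi.single _ 1) (Pi.single j 1)]
        ring
      rw [h2]
      refine (norm_add_le _ _).trans ?_
      have h3 : ‖((0 : SymCoord g), (Pi.single j 1 : Fin g → ℂ))‖ ≤ 1 := by
        rw [norm_prod_le_iff]
        exact ⟨by simp, norm_single_one_le j⟩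
      have h4 : ‖b none (t, w) * thetaSum ε δ [Pi.single j 1] (t, w)‖ ≤ 1 * e := by
        rw [norm_mul]
        gcongr
        exact (hFi j).trans (by rw [hE]; linarith [norm_nonneg (thetaSum ε δ [] (t, w))])
      have h5 : M * ‖((0 : SymCoord g), (Pi.single j 1 : Fin g → ℂ))‖ *
          ∑ o, ‖thetaSys ε δ o (t, w)‖ ≤ M * 1 * ((g + 1) * e) := by gcongr
      linarith [h1.trans h5]
    refine (Finset.sum_le_sum this).trans ?_
    simp only [Finset.sum_const, Finset.card_univ, Fintype.card_fin, nsmul_eq_mul]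
    rw [← mul_assoc]
    gcongr
    linarith
  · refine (norm_clm_le_sum _).trans ?_
    have : ∀ j ∈ Finset.univ, ‖(fderiv ℂ (fderiv ℂ D1) w (κ - fun i => b (some i) (t, w)) -
        b none (t, w) • fderiv ℂ D1 w) (Pi.single j 1)‖ ≤
        g * (2 * Real.pi * (M * 2 * (g + 1))) * e := fun j _ => by
      refine (norm_clm_le_sum _).trans ?_
      have : ∀ l ∈ Finset.univ, ‖(fderiv ℂ (fderiv ℂ D1) w (κ - fun i => b (some i) (t, w)) -
          b none (t, w) • fderiv ℂ D1 w) (Pi.single j 1) (Pi.single l 1)‖ ≤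
          2 * Real.pi * (M * 2 * (g + 1)) * e := fun l _ => by
        have h1 := hw (symDir (Pi.single j 1) (Pi.single l 1), 0)
        rw [Fintype.sum_option] at h1
        simp only [thetaSys_none, thetaSys_some,
          thetaSum_fderiv_symDir (x := (t, w)) ht] at h1
        have hpi := Complex.two_pi_I_ne_zero
        have h2 : (fderiv ℂ (fderiv ℂ D1) w (κ - fun i => b (some i) (t, w)) -
            b none (t, w) • fderiv ℂ D1 w) (Pi.single j 1) (Pi.single l 1) =
            (2 * Real.pi * Complex.I) * ((2 * Real.pi * Complex.I)⁻¹ *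
                thetaSum ε δ [Pi.single j 1, Pi.single l 1, κ] (t, w) -
              (b none (t, w) * ((2 * Real.pi * Complex.I)⁻¹ *
                  thetaSum ε δ [Pi.single j 1, Pi.single l 1] (t, w)) +
                ∑ i, b (some i) (t, w) * ((2 * Real.pi * Complex.I)⁻¹ *
                  thetaSum ε δ [Pi.single j 1, Pi.single l 1, Pi.single i 1] (t, w)))) := by
          have hp : ∀ v : Fin g → ℂ, thetaSum ε δ [Pi.single j 1, Pi.single l 1, v] =
              thetaSum ε δ [v, Pi.single j 1, Pi.single l 1] := fun v =>
            thetaSum_perm (List.perm_append_comm (l₁ := [Pi.single j 1, Pi.single l 1]) (l₂ := [v]))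
          simp only [sub_apply, smul_apply, smul_eq_mul]
          rw [hD1, fderiv3_thetaSum_slice ht, fderiv2_thetaSum_slice ht, hcoord, hp]
          simp only [hp, mul_left_comm _ (2 * Real.pi * Complex.I)⁻¹, ← Finset.mul_sum]
          field_simp
          ring
        rw [h2, norm_mul]
        have h3 : ‖(symDir (Pi.single j 1) (Pi.single l 1), (0 : Fin g → ℂ))‖ ≤ 2 := by
          rw [norm_prod_le_iff]
          exact ⟨norm_symDir_single_le j l, by simp⟩
        have h5 : M * ‖(symDir (Pi.single j 1) (Pi.single l 1), (0 : Fin g → ℂ))‖ *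
          ∑ o, ‖thetaSys ε δ o (t, w)‖ ≤ M * 2 * ((g + 1) * e) := by gcongr
        have h6 : ‖(2 * Real.pi * Complex.I : ℂ)‖ = 2 * Real.pi := by
          simp [Real.pi_pos.le]
        rw [h6]
        calc _ ≤ 2 * Real.pi * (M * 2 * ((g + 1) * e)) := by
              gcongr
              exact h1.trans h5
          _ = _ := by ring
      refine (Finset.sum_le_sum this).trans (le_of_eq ?_)
      simp only [Finset.sum_const, Finset.card_univ, Fintype.card_fin, nsmul_eq_mul]
      ring
    refine (Finset.sum_le_sum this).trans ?_
    simp only [Finset.sum_const, Finset.card_univ, Fintype.card_fin, nsmul_eq_mul]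
    rw [← mul_assoc]
    gcongr
    linarith

end KernelLine

/-! ### From a real segment to the whole complex kernel line -/

section KernelLineGlobal

lemma exists_generalized_inverse {V W : Type*} [AddCommGroup V] [Module ℂ V] [AddCommGroup W]
    [Module ℂ W] (A : V →ₗ[ℂ] W) : ∃ G : W →ₗ[ℂ] V, ∀ v, A (G (A v)) = A v := by
  obtain ⟨s, hs⟩ := A.rangeRestrict.exists_rightInverse_of_surjective A.range_rangeRestrict
  obtain ⟨G, hG⟩ := LinearMap.exists_extend s
  refine ⟨G, fun v => ?_⟩
  have h1 : G (A v) = s (A.rangeRestrict v) := DFunLike.congr_fun hG (A.rangeRestrict v)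
  have h2 := congrArg Subtype.val (DFunLike.congr_fun hs (A.rangeRestrict v))
  rw [h1]
  exact h2

lemma eq_zero_of_eq_zero_on_segment {h : ℂ → ℂ} (hh : ∀ z, AnalyticAt ℂ h z) {d : ℝ} (hd : 0 < d)
    (h0 : ∀ t ∈ Set.Icc (0 : ℝ) d, h t = 0) (z : ℂ) : h z = 0 := by
  have hf : ∃ᶠ z in 𝓝[≠] (0 : ℂ), h z = 0 := by
    rw [Filter.frequently_iff]
    intro U hU
    have ht : Filter.Tendsto (fun t : ℝ => (t : ℂ)) (𝓝[>] 0) (𝓝[≠] 0) := by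
      refine tendsto_nhdsWithin_iff.2 ⟨?_, ?_⟩
      · exact (Complex.continuous_ofReal.tendsto' 0 0 (by simp)).mono_left nhdsWithin_le_nhds
      · filter_upwards [self_mem_nhdsWithin] with t ht
        simpa using (ne_of_gt ht)
    have hU' := Filter.mem_map.1 (ht hU)
    obtain ⟨t, h1, h2⟩ := Filter.nonempty_of_mem (Filter.inter_mem hU' (Ioc_mem_nhdsGT hd))
    exact ⟨t, h1, h0 t ⟨h2.1.le, h2.2⟩⟩
  exact AnalyticOnNhd.eqOn_zero_of_preconnected_of_frequently_eq_zero (U := Set.univ)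
    (fun z _ => hh z) isPreconnected_univ (Set.mem_univ 0) hf (Set.mem_univ z)

variable {g : ℕ} {ε δ : Fin g → ZMod 2}

lemma analyticAt_thetaSum_line {t : SymCoord g} (ht : t ∈ siegelSet g) (s : List (Fin g → ℂ))
    (κ : Fin g → ℂ) (z : ℂ) : AnalyticAt ℂ (fun z : ℂ => thetaSum ε δ s (t, z • κ)) z :=
  AnalyticAt.comp (f := fun z : ℂ => z • κ) (analyticAt_thetaSum_slice ht s _)
    (analyticAt_id.smul analyticAt_const)

/-- At a smooth point `(τ, 0)` of the singular locus, the theta divisor is singular along the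
kernel of the Hessian, and the Hessian stays in the same line there. -/
theorem thetaSum_vanish_on_kernel_line (he : IsEvenChar ε δ) {t : SymCoord g} (ht : t ∈ siegelSet g)
    (h0 : thetaSum ε δ [] (t, 0) = 0) (hn : IsNonsingularAt (thetaSys ε δ) (t, 0)) {κ : Fin g → ℂ}
    (hκ : ∀ i, thetaSum ε δ [Pi.single i 1, κ] (t, 0) = 0) (z : ℂ) :
    thetaSum ε δ [] (t, z • κ) = 0 ∧ (∀ i, thetaSum ε δ [Pi.single i 1] (t, z • κ) = 0) ∧
      ∀ i j k l, thetaSum ε δ [Pi.single i 1, Pi.single j 1] (t, z • κ) *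
          thetaSum ε δ [Pi.single k 1, Pi.single l 1] (t, 0) =
        thetaSum ε δ [Pi.single k 1, Pi.single l 1] (t, z • κ) *
          thetaSum ε δ [Pi.single i 1, Pi.single j 1] (t, 0) := by
  set f : (Fin g → ℂ) → ℂ := fun w => thetaSum ε δ [] (t, w) with hf
  have hfa : AnalyticAt ℂ f 0 := analyticAt_thetaSum_slice ht [] 0
  set A := fderiv ℂ (fderiv ℂ f) 0 with hA
  have hAv : ∀ v v', A v v' = thetaSum ε δ [v, v'] (t, 0) := fun v v' =>
    fderiv2_thetaSum_slice ht [] 0 v v'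
  have hker : ∀ v, A v = 0 → ∀ i, thetaSum ε δ [Pi.single i 1, v] (t, 0) = 0 := fun v hv i => by
    rw [thetaSum_swap, ← hAv, hv]; rfl
  have hAκ : A κ = 0 := by
    ext v
    rw [hAv, thetaSum_swap, thetaSum_cons_eq_sum (x := (t, 0)) ht]
    simp [hκ]
  obtain ⟨G₀, hG₀⟩ := exists_generalized_inverse A.toLinearMap
  let G : ((Fin g → ℂ) →L[ℂ] ℂ) →L[ℂ] (Fin g → ℂ) := LinearMap.toContinuousLinearMap G₀
  have hG : ∀ v, A (G (A v)) = A v := hG₀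
  -- The vectors `k l` are the images of the basis under the projection `1 - G A` onto the kernel of
  -- `A`. The bounds for each of them are assembled linearly into `B` and `a`.
  let k : Fin g → Fin g → ℂ := fun l => Pi.single l 1 - G (A (Pi.single l 1))
  have hk : ∀ l, A (k l) = 0 := fun l => by simp [k, hG]
  choose α β C hC hα hβ hbd using fun l => exists_kernel_bounds he ht hn (hker _ (hk l))
  let B : (Fin g → ℂ) → (Fin g → ℂ) →L[ℂ] (Fin g → ℂ) := fun w =>
    ∑ l, (ContinuousLinearMap.proj (R := ℂ) (φ := fun _ : Fin g => ℂ) l).smulRight (β l w)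
  let a : (Fin g → ℂ) → (Fin g → ℂ) →L[ℂ] ℂ := fun w =>
    ∑ l, α l w • ContinuousLinearMap.proj (R := ℂ) (φ := fun _ : Fin g => ℂ) l
  have hB : Filter.Tendsto B (𝓝 0) (𝓝 0) := by
    have : Filter.Tendsto B (𝓝 0) (𝓝 (∑ l : Fin g,
        (ContinuousLinearMap.proj (R := ℂ) (φ := fun _ : Fin g => ℂ) l).smulRight
          (0 : Fin g → ℂ))) :=
      tendsto_finsetSum _ fun l _ =>
        ((ContinuousLinearMap.smulRightL ℂ (Fin g → ℂ) (Fin g → ℂ)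
          (ContinuousLinearMap.proj l)).continuous.tendsto 0).comp (hβ l)
    simpa using this
  have ha : Filter.Tendsto a (𝓝 0) (𝓝 0) := by
    have : Filter.Tendsto a (𝓝 0) (𝓝 (∑ l : Fin g, (0 : ℂ) •
        ContinuousLinearMap.proj (R := ℂ) (φ := fun _ : Fin g => ℂ) l)) :=
      tendsto_finsetSum _ fun l _ => (hα l).smul_const _
    simpa using this
  have hdec : ∀ w v, v - G (A v) - B w v = ∑ l, v l • (k l - β l w) := fun w v => by
    have h1 : v - G (A v) = ∑ l, v l • k l := by
      have := clm_apply_eq_sum (ContinuousLinearMap.id ℂ (Fin g → ℂ) - G.comp A) v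
      simpa [k] using this
    rw [h1]
    simp [B, smul_sub, Finset.sum_sub_distrib]
  have hCs : 0 ≤ ∑ l, C l := Finset.sum_nonneg fun l _ => hC l
  obtain ⟨d, hd, hres⟩ := vanish_on_kernel_line hfa h0
    (by
      ext v
      rw [hf, fderiv_thetaSum_slice ht]
      exact thetaSum_odd_zero he t ⟨0, rfl⟩) hA.symm G hG hB (a := a) (C := ∑ l, C l + 1)
    (by positivity)
    (ha.norm.eventually_le_const (by rw [norm_zero]; linarith))
    (by
      filter_upwards [Filter.eventually_all.2 hbd] with w hw v
      rw [hdec, map_sum]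
      set e := ‖f w‖ + ‖fderiv ℂ f w‖
      have he0 : 0 ≤ e := by positivity
      calc _ ≤ ∑ l, ‖v‖ * (C l * e) := norm_sum_le_of_le _ fun l _ => by
            rw [map_smul, norm_smul]
            have := (hw l).1
            gcongr
            exact norm_le_pi_norm v l
        _ = (∑ l, C l) * e * ‖v‖ := by rw [← Finset.mul_sum, ← Finset.sum_mul]; ring
        _ ≤ _ := by gcongr; linarith)
    (by
      filter_upwards [Filter.eventually_all.2 hbd] with w hw v
      set e := ‖f w‖ + ‖fderiv ℂ f w‖
      have he0 : 0 ≤ e := by positivity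
      have h1 : fderiv ℂ (fderiv ℂ (fderiv ℂ f)) w (v - G (A v) - B w v) -
          a w v • fderiv ℂ (fderiv ℂ f) w = ∑ l, v l • (fderiv ℂ (fderiv ℂ (fderiv ℂ f)) w
            (k l - β l w) - α l w • fderiv ℂ (fderiv ℂ f) w) := by
        have hav : a w v = ∑ l, v l * α l w := by simp [a, mul_comm]
        rw [hdec, map_sum, hav, Finset.sum_smul, ← Finset.sum_sub_distrib]
        exact Finset.sum_congr rfl fun l _ => by rw [map_smul, smul_sub, smul_smul]
      rw [h1]
      calc _ ≤ ∑ l, ‖v‖ * (C l * e) := norm_sum_le_of_le _ fun l _ => by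
            rw [norm_smul]
            have := (hw l).2
            gcongr
            exact norm_le_pi_norm v l
        _ = (∑ l, C l) * e * ‖v‖ := by rw [← Finset.mul_sum, ← Finset.sum_mul]; ring
        _ ≤ _ := by gcongr; linarith) hAκ
  have hline := fun s z => analyticAt_thetaSum_line (ε := ε) (δ := δ) ht s κ z
  refine ⟨eq_zero_of_eq_zero_on_segment (hline []) hd (fun r hr => (hres r hr).1) z,
    fun i => eq_zero_of_eq_zero_on_segment (hline [Pi.single i 1]) hd (fun r hr => ?_) z,
    fun i j m n => ?_⟩
  · have := DFunLike.congr_fun (hres r hr).2.1 (Pi.single i 1)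
    rw [hf, fderiv_thetaSum_slice ht] at this
    exact this
  · refine sub_eq_zero.1 (eq_zero_of_eq_zero_on_segment (d := d)
      (h := fun z => thetaSum ε δ [Pi.single i 1, Pi.single j 1] (t, z • κ) *
          thetaSum ε δ [Pi.single m 1, Pi.single n 1] (t, 0) -
        thetaSum ε δ [Pi.single m 1, Pi.single n 1] (t, z • κ) *
          thetaSum ε δ [Pi.single i 1, Pi.single j 1] (t, 0))
      (fun z => ((hline _ z).mul analyticAt_const).sub ((hline _ z).mul analyticAt_const)) hd
      (fun r hr => ?_) z)
    let ev : (Fin g → ℂ) → (Fin g → ℂ) → (((Fin g → ℂ) →L[ℂ] (Fin g → ℂ) →L[ℂ] ℂ) →L[ℂ] ℂ) :=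
      fun v v' => (ContinuousLinearMap.apply ℂ ℂ v').comp
        (ContinuousLinearMap.apply ℂ ((Fin g → ℂ) →L[ℂ] ℂ) v)
    -- This functional is the `2 × 2` minor with `A`; it vanishes on `A` itself.
    have := (hres r hr).2.2 (A (Pi.single m 1) (Pi.single n 1) • ev (Pi.single i 1) (Pi.single j 1) -
      A (Pi.single i 1) (Pi.single j 1) • ev (Pi.single m 1) (Pi.single n 1)) (by
        simp [ev, mul_comm])
    simp only [ev, sub_apply, smul_apply, ContinuousLinearMap.comp_apply,
      ContinuousLinearMap.apply_apply, hf, fderiv2_thetaSum_slice ht, hAv, smul_eq_mul] at this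
    linear_combination this

end KernelLineGlobal

/-! ### Deformation along the theta-null divisor: the Hessian is Gaussian -/

section Gaussian

variable {g : ℕ} {ε δ : Fin g → ZMod 2}

/-- The period matrix `i · 1`. -/
def imagUnit (g : ℕ) : SymCoord g := fun q => if q.IsDiag then Complex.I else 0

lemma symMatrix_imagUnit :
    symMatrix (imagUnit g) = Complex.I • (1 : Matrix (Fin g) (Fin g) ℂ) := by
  ext i j
  simp [symMatrix, imagUnit, Matrix.one_apply]

lemma imagUnit_mem_siegelSet : imagUnit g ∈ siegelSet g := by
  have : (symMatrix (imagUnit g)).map Complex.im = 1 := by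
    ext i j
    by_cases h : i = j <;> simp [symMatrix_imagUnit, Matrix.one_apply, h]
  change ((symMatrix (imagUnit g)).map Complex.im).PosDef
  rw [this]
  exact Matrix.PosDef.one

lemma theta_imagUnit_ne_zero : thetaSum 0 0 [] (imagUnit g, 0) ≠ 0 := by
  have hterm : ∀ m : Fin g → ℤ, thetaCoef 0 0 m * thetaSymbol 0 [] m *
      Complex.exp (thetaForm 0 m (imagUnit g, 0)) = ((Real.exp (-Real.pi * ∑ i, (m i : ℝ) ^ 2) : ℝ) : ℂ) := by
    intro m
    have h1 : thetaIdxC 0 m ⬝ᵥ (symMatrix (imagUnit g)).mulVec (thetaIdxC 0 m) =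
        Complex.I * ((∑ i, (m i : ℝ) ^ 2 : ℝ) : ℂ) := by
      rw [symMatrix_imagUnit, Matrix.smul_mulVec, Matrix.one_mulVec, dotProduct_smul, thetaIdxC_def, charVec_zero]
      simp [dotProduct, intVec, sq]
    rw [thetaForm_apply, h1, thetaCoef, charVec_zero]
    simp only [thetaSymbol, dotProduct_zero, List.map_nil, List.prod_nil, mul_zero, Complex.exp_zero,
      mul_one, one_mul, add_zero, Complex.ofReal_exp]
    congr 1
    push_cast
    linear_combination (Real.pi * ∑ i, (m i : ℂ) ^ 2) * Complex.I_mul_I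
  have hs := (thetaSum_summable 0 0 [] (x := (imagUnit g, 0)) imagUnit_mem_siegelSet).summable
  simp only [hterm] at hs
  have hs' : Summable fun m : Fin g → ℤ => Real.exp (-Real.pi * ∑ i, (m i : ℝ) ^ 2) := by
    exact_mod_cast hs
  rw [thetaSum, expSum]
  simp only [hterm]
  rw [← Complex.ofReal_tsum, Ne, Complex.ofReal_eq_zero]
  exact (hs'.tsum_pos (fun m => (Real.exp_pos _).le) 0 (Real.exp_pos _)).ne'

/-- Local vanishing would spread over the connected domain `ℍ_g × ℂ^g`. A half-period shift at `τ =
i·1` would then give `θ(i·1, 0) = 0`, although that series has positive terms. -/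
lemma thetaSum_not_eventually_zero {x : SymCoord g × (Fin g → ℂ)} (hx : x.1 ∈ siegelSet g) :
    ¬ ∀ᶠ y in 𝓝 x, thetaSum ε δ [] y = 0 := by
  intro h
  have hpre : IsPreconnected (siegelSet g ×ˢ (Set.univ : Set (Fin g → ℂ))) :=
    (convex_siegelSet g).isPreconnected.prod isPreconnected_univ
  have han : AnalyticOnNhd ℂ (thetaSum ε δ []) (siegelSet g ×ˢ (Set.univ : Set (Fin g → ℂ))) :=
    fun y hy => thetaSum_analyticAt ε δ [] hy.1
  have hz := han.eqOn_zero_of_preconnected_of_eventuallyEq_zero hpre (z₀ := x) ⟨hx, trivial⟩ h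
  have h1 := theta_half_period (imagUnit g)
    (-((1 / 2 : ℂ) • ((symMatrix (imagUnit g)).mulVec (charVec ε) + charVec δ))) ε δ
  rw [neg_add_cancel, hz (x := (imagUnit g, _)) ⟨imagUnit_mem_siegelSet, trivial⟩, Pi.zero_apply, mul_zero] at h1
  exact theta_imagUnit_ne_zero h1

/-- With zero Hessian, parity and the heat equation make all `g + 1` differentials vanish.
Nonsingularity would then make `F` vanish near the point. -/
lemma exists_hessian_entry_ne_zero (he : IsEvenChar ε δ) {t : SymCoord g} (ht : t ∈ siegelSet g)
    (hn : IsNonsingularAt (thetaSys ε δ) (t, 0)) :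
    ∃ i j, thetaSum ε δ [Pi.single i 1, Pi.single j 1] (t, 0) ≠ 0 := by
  by_contra! hH
  refine thetaSum_not_eventually_zero (ε := ε) (δ := δ) (x := (t, (0 : Fin g → ℂ))) ht ?_
  refine (hn.eventually_eq_zero fun o => ?_).mono fun y hy => hy none
  cases o with
  | none =>
    exact fderiv_thetaSum_eq_zero ht (fun i => thetaSum_odd_zero he t ⟨0, rfl⟩) hH
  | some i =>
    refine fderiv_thetaSum_eq_zero ht (fun j => hH j i) fun j k => thetaSum_odd_zero he t ⟨1, rfl⟩

lemma exists_curve_of_ne_zero {E : Type*} [NormedAddCommGroup E] [NormedSpace ℂ E] [CompleteSpace E]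
    {φ : E → ℂ} {φ' : E →L[ℂ] ℂ} {a u v : E} (hφ : HasStrictFDerivAt φ φ' a) (hu : φ' u ≠ 0)
    (hv : φ' v = 0) :
    ∃ γ : ℂ → E, γ 0 = a ∧ HasDerivAt γ v 0 ∧ ∀ᶠ s in 𝓝 0, φ (γ s) = φ a := by
  have hsurj : φ'.range = ⊤ := by
    refine LinearMap.range_eq_top.2 fun c => ⟨(c / φ' u) • u, ?_⟩
    simp [hu]
  let v' : φ'.ker := ⟨v, hv⟩
  let ψ := hφ.implicitFunction φ φ' hsurj (φ a)
  have hl : HasDerivAt (fun s : ℂ => s • v') v' 0 := by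
    simpa using (hasDerivAt_id (0 : ℂ)).smul_const v'
  refine ⟨fun s => ψ (s • v'), ?_, ?_, ?_⟩
  · simp [ψ]
  · have h1 : HasFDerivAt ψ φ'.ker.subtypeL ((0 : ℂ) • v') := by
      rw [zero_smul]
      exact (hφ.to_implicitFunction hsurj).hasFDerivAt
    exact h1.comp_hasDerivAt (0 : ℂ) hl
  · have h1 := hφ.map_implicitFunction_eq hsurj
    have h2 : Filter.Tendsto (fun s : ℂ => (φ a, s • v')) (𝓝 0) (𝓝 (φ a, 0)) := by
      refine Filter.Tendsto.prodMk_nhds tendsto_const_nhds ?_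
      simpa using hl.continuousAt.tendsto
    exact h2.eventually h1

/-- At a smooth point of the singular locus with degenerate Hessian, the Hessian of the theta
function along a line in its kernel is `exp (b z ^ 2)` times its value at the origin. -/
theorem exists_gaussian_hessian (he : IsEvenChar ε δ) {t : SymCoord g} (ht : t ∈ siegelSet g)
    (h0 : thetaSum ε δ [] (t, 0) = 0) (hn : IsNonsingularAt (thetaSys ε δ) (t, 0)) {κ : Fin g → ℂ}
    (hκ : ∀ i, thetaSum ε δ [Pi.single i 1, κ] (t, 0) = 0) {i₀ j₀ : Fin g}
    (hA : thetaSum ε δ [Pi.single i₀ 1, Pi.single j₀ 1] (t, 0) ≠ 0) :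
    ∃ b : ℂ, ∀ z : ℂ, thetaSum ε δ [Pi.single i₀ 1, Pi.single j₀ 1] (t, z • κ) =
      thetaSum ε δ [Pi.single i₀ 1, Pi.single j₀ 1] (t, 0) * Complex.exp (b * z ^ 2) := by
  have hpi := Complex.two_pi_I_ne_zero
  obtain ⟨b, hb, hb0, hid⟩ := exists_kernel_identity he ht hn hκ
  have hu : ∀ o, AnalyticAt ℂ (thetaSys ε δ o) (t, (0 : Fin g → ℂ)) := fun o => by
    cases o <;> exact thetaSum_analyticAt ε δ _ ht
  obtain ⟨M, hM, hbd⟩ := fderiv_sub_sum_le hb hu hid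
  -- a curve in the theta-null divisor
  have hφ : HasStrictFDerivAt (fun t => thetaSum ε δ [] (t, 0))
      ((fderiv ℂ (thetaSum ε δ []) (t, 0)).comp (ContinuousLinearMap.inl ℂ _ _)) t :=
    HasStrictFDerivAt.comp t
      (thetaSum_analyticAt ε δ [] (x := (t, (0 : Fin g → ℂ))) ht).hasStrictFDerivAt
      (ContinuousLinearMap.inl ℂ (SymCoord g) (Fin g → ℂ)).hasStrictFDerivAt
  -- The divisor `F(τ, 0) = 0` is smooth at `t`, since its derivative in the direction given by `i₀,
  -- j₀` is a nonzero Hessian entry up to `2πi`. The direction given by `κ, i₀` is tangent because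
  -- `κ` is in the kernel.
  obtain ⟨γ, hγ0, hγ, hγφ⟩ := exists_curve_of_ne_zero hφ
    (u := symDir (Pi.single i₀ 1) (Pi.single j₀ 1)) (v := symDir κ (Pi.single i₀ 1))
    (by
      change fderiv ℂ (thetaSum ε δ []) (t, 0) (symDir _ _, 0) ≠ 0
      rw [thetaSum_fderiv_symDir (x := (t, 0)) ht]
      exact mul_ne_zero (inv_ne_zero hpi) hA)
    (by
      change fderiv ℂ (thetaSum ε δ []) (t, 0) (symDir _ _, 0) = 0
      rw [thetaSum_fderiv_symDir (x := (t, 0)) ht, thetaSum_swap, hκ, mul_zero])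
  set t' : SymCoord g := symDir κ (Pi.single i₀ 1) with ht'
  have hp : HasDerivAt (fun s => (γ s, (0 : Fin g → ℂ))) (t', 0) 0 :=
    hγ.prodMk (hasDerivAt_const _ _)
  have hp0 : Filter.Tendsto (fun s => (γ s, (0 : Fin g → ℂ))) (𝓝 0) (𝓝 (t, 0)) := by
    simpa [hγ0] using hp.continuousAt.tendsto
  -- At `(γ s, 0)` all equations hold, so the `z`-derivative of the kernel identity is exact and
  -- says that `κ - (bᵢ)` lies in the kernel of the Hessian there.
  let κs : ℂ → Fin g → ℂ := fun s i => κ i - b (some i) (γ s, 0)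
  let κ' : Fin g → ℂ := fun i => - fderiv ℂ (b (some i)) (t, 0) (t', 0)
  have hκs0 : κs 0 = κ := by
    ext i
    simp [κs, hγ0, hb0]
  have hκs : HasDerivAt κs κ' 0 := by
    refine hasDerivAt_pi.2 fun i => ?_
    have h1 : HasFDerivAt (b (some i)) (fderiv ℂ (b (some i)) (t, 0)) (γ 0, 0) := by
      rw [hγ0]
      exact (hb (some i)).differentiableAt.hasFDerivAt
    exact (h1.comp_hasDerivAt (0 : ℂ) hp).const_sub (κ i)
  have hvan : ∀ᶠ s in 𝓝 (0 : ℂ), ∀ z : ℂ,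
      thetaSum ε δ [Pi.single j₀ 1] (γ s, z • κs s) = 0 := by
    filter_upwards [hp0.eventually hbd, hp0.eventually hn.eventually,
      hp0.eventually (eventually_fst_mem_siegelSet (x := (t, (0 : Fin g → ℂ))) ht), hγφ]
      with s s1 s2 s3 s4 z
    rw [h0] at s4
    have hodd : ∀ i, thetaSum ε δ [Pi.single i 1] (γ s, 0) = 0 := fun i =>
      thetaSum_odd_zero he _ ⟨0, rfl⟩
    have hz : ∀ o, thetaSys ε δ o (γ s, 0) = 0 := by
      intro o
      cases o with
      | none => exact s4
      | some i => exact hodd i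
    refine (thetaSum_vanish_on_kernel_line he s3 s4 (s2 hz) (κ := κs s) (fun j => ?_) z).2.1 j₀
    have h1 := s1 (0, Pi.single j 1)
    rw [Fintype.sum_option] at h1
    simp only [hz, norm_zero, Finset.sum_const_zero, mul_zero, norm_le_zero_iff, thetaSys_none,
      thetaSys_some, thetaSum_fderiv_snd (x := (γ s, 0)) s3, hodd, zero_add] at h1
    rw [thetaSum_swap, thetaSum_cons_eq_sum (x := (γ s, 0)) s3]
    rw [thetaSum_swap, thetaSum_cons_eq_sum (x := (γ s, 0)) s3, ← Finset.sum_sub_distrib] at h1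
    rw [← h1]
    refine Finset.sum_congr rfl fun i _ => ?_
    rw [thetaSum_swap (Pi.single j 1) (Pi.single i 1)]
    simp only [κs]
    ring
  -- differentiate along the curve
  have hrel : ∀ z : ℂ, thetaSum ε δ [κ, Pi.single i₀ 1, Pi.single j₀ 1] (t, z • κ) +
      (2 * Real.pi * Complex.I) * (z * thetaSum ε δ [κ', Pi.single j₀ 1] (t, z • κ)) = 0 := by
    intro z
    have h1 : HasDerivAt (fun s => (γ s, z • κs s)) (t', z • κ') 0 := hγ.prodMk (hκs.const_smul z)
    have h2 : HasFDerivAt (thetaSum ε δ [Pi.single j₀ 1])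
        (fderiv ℂ (thetaSum ε δ [Pi.single j₀ 1]) (t, z • κ)) (γ 0, z • κs 0) := by
      rw [hγ0, hκs0]
      exact (thetaSum_differentiableAt _ (x := (t, z • κ)) ht).hasFDerivAt
    have h3 := h2.comp_hasDerivAt (0 : ℂ) h1
    have h4 : HasDerivAt (thetaSum ε δ [Pi.single j₀ 1] ∘ fun s => (γ s, z • κs s)) 0 0 := by
      refine (hasDerivAt_const (0 : ℂ) (0 : ℂ)).congr_of_eventuallyEq ?_
      filter_upwards [hvan] with s hs using hs z
    have h5 := h3.unique h4
    have h6 : ((t', z • κ') : SymCoord g × (Fin g → ℂ)) = (t', 0) + (0, z • κ') := by simp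
    rw [h6, map_add, ht', thetaSum_fderiv_symDir (x := (t, z • κ)) ht,
      thetaSum_fderiv_snd (x := (t, z • κ)) ht, thetaSum_cons_smul (x := (t, z • κ)) ht] at h5
    field_simp at h5
    linear_combination h5
  set a₀ := thetaSum ε δ [Pi.single i₀ 1, Pi.single j₀ 1] (t, 0) with ha₀
  set c : ℂ := ∑ i, κ' i * thetaSum ε δ [Pi.single i 1, Pi.single j₀ 1] (t, 0) / a₀ with hc
  set ψ : ℂ → ℂ := fun z => thetaSum ε δ [Pi.single i₀ 1, Pi.single j₀ 1] (t, z • κ) with hψ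
  have hψd : ∀ z, HasDerivAt ψ (-(2 * Real.pi * Complex.I) * c * z * ψ z) z := by
    intro z
    have h1 := (thetaSum_slice_hasFDerivAt (ε := ε) (δ := δ) ht
      [Pi.single i₀ 1, Pi.single j₀ 1] (z • κ)).comp_hasDerivAt z
        (by simpa using (hasDerivAt_id z).smul_const κ : HasDerivAt (fun z : ℂ => z • κ) κ z)
    refine h1.congr_deriv ?_
    change fderiv ℂ (thetaSum ε δ [Pi.single i₀ 1, Pi.single j₀ 1]) (t, z • κ) (0, κ) = _
    rw [thetaSum_fderiv_snd (x := (t, z • κ)) ht]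
    have h2 := hrel z
    rw [thetaSum_cons_eq_sum (x := (t, z • κ)) ht κ'] at h2
    -- Proportionality of the Hessian to `A` along the line expresses every entry through `ψ` and
    -- closes the differential equation.
    have h3 : ∑ i, κ' i * thetaSum ε δ [Pi.single i 1, Pi.single j₀ 1] (t, z • κ) = c * ψ z := by
      rw [hc, Finset.sum_mul]
      refine Finset.sum_congr rfl fun i _ => ?_
      have := (thetaSum_vanish_on_kernel_line he ht h0 hn hκ z).2.2 i j₀ i₀ j₀
      rw [← ha₀] at this
      field_simp
      rw [hψ]
      linear_combination κ' i * this
    rw [h3] at h2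
    linear_combination h2
  refine ⟨-(Real.pi * Complex.I) * c, fun z => ?_⟩
  set β := -(Real.pi * Complex.I) * c with hβ
  have hquot : ∀ z, HasDerivAt (fun z => ψ z * Complex.exp (-(β * z ^ 2))) 0 z := by
    intro z
    have h1 : HasDerivAt (fun z : ℂ => -(β * z ^ 2)) (-(β * (2 * z))) z := by
      simpa using ((hasDerivAt_pow 2 z).const_mul β).fun_neg
    refine ((hψd z).mul h1.cexp).congr_deriv ?_
    rw [hβ]
    ring
  have hconst := is_const_of_deriv_eq_zero (fun z => (hquot z).differentiableAt)
    (fun z => (hquot z).deriv) z 0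
  have hψ0 : ψ 0 = a₀ := by simp [hψ, ha₀]
  simp only [hψ0, ne_eq, OfNat.ofNat_ne_zero, not_false_eq_true, zero_pow, mul_zero, neg_zero,
    Complex.exp_zero, mul_one] at hconst
  change ψ z = _
  rw [← hconst, mul_assoc, ← Complex.exp_add, neg_add_cancel, Complex.exp_zero, mul_one]

end Gaussian

/-! ### Recurrence to the period lattice and growth -/

section Recurrence

variable {g : ℕ} {ε δ : Fin g → ZMod 2}

/-- A real vector as a complex vector. -/
def realVec (p : Fin g → ℝ) : Fin g → ℂ := fun i => (p i : ℂ)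

lemma exists_real_coordinates {t : SymCoord g} (ht : t ∈ siegelSet g) (w : Fin g → ℂ) :
    ∃ p q : Fin g → ℝ, w = (symMatrix t).mulVec (realVec p) + realVec q := by
  set Y := (symMatrix t).map Complex.im with hY
  have hdet : IsUnit Y.det := (Matrix.isUnit_iff_isUnit_det _).1 (Matrix.PosDef.isUnit ht)
  let p : Fin g → ℝ := Y⁻¹.mulVec fun i => (w i).im
  have hp : Y.mulVec p = fun i => (w i).im := by
    rw [Matrix.mulVec_mulVec, Matrix.mul_nonsing_inv _ hdet, Matrix.one_mulVec]
  refine ⟨p, fun i => (w i).re - ∑ j, (symMatrix t i j).re * p j, ?_⟩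
  ext i
  refine Complex.ext ?_ ?_
  · simp [Matrix.mulVec, dotProduct, realVec, Complex.re_sum]
  · have := congrFun hp i
    simp only [Matrix.mulVec, dotProduct, hY, Matrix.map_apply] at this
    simp [Matrix.mulVec, dotProduct, realVec, Complex.im_sum, this]

/-- In the compact torus `(ℝ/ℤ)^g × (ℝ/ℤ)^g` the multiples of a point return to every neighbourhood
of `0` infinitely often. -/
lemma exists_nat_smul_near_int (p q : Fin g → ℝ) {η : ℝ} (hη : 0 < η) (N : ℕ) :
    ∃ n : ℕ, N ≤ n ∧ ∃ a b : Fin g → ℤ, ∀ i, |n * p i - a i| < η ∧ |n * q i - b i| < η := by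
  let x : (Fin g → UnitAddCircle) × (Fin g → UnitAddCircle) :=
    (fun i => (p i : UnitAddCircle), fun i => (q i : UnitAddCircle))
  have h := (mapClusterPt_zero_atTop_nsmul x).frequently (Metric.ball_mem_nhds 0 hη)
  obtain ⟨n, hn, hx⟩ := (Filter.frequently_atTop.1 h) N
  rw [dist_zero_right] at hx
  refine ⟨n, hn, fun i => round (n * p i), fun i => round (n * q i), fun i => ⟨?_, ?_⟩⟩
  · have h1 : ‖(n • x).1 i‖ < η := ((norm_le_pi_norm _ i).trans (norm_fst_le _)).trans_lt hx
    have h2 : (n • x).1 i = ((n * p i : ℝ) : UnitAddCircle) := by simp [x]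
    rwa [h2, UnitAddCircle.norm_eq] at h1
  · have h1 : ‖(n • x).2 i‖ < η := ((norm_le_pi_norm _ i).trans (norm_snd_le _)).trans_lt hx
    have h2 : (n • x).2 i = ((n * q i : ℝ) : UnitAddCircle) := by simp [x]
    rwa [h2, UnitAddCircle.norm_eq] at h1

lemma exists_nat_smul_near_period (t : SymCoord g) (p q : Fin g → ℝ) {η : ℝ} (hη : 0 < η) (N : ℕ) :
    ∃ n : ℕ, N ≤ n ∧ ∃ a b : Fin g → ℤ, (∀ i, |n * p i - a i| < 1) ∧
      ‖(n : ℂ) • ((symMatrix t).mulVec (realVec p) + realVec q) -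
        ((symMatrix t).mulVec (intVec a) + intVec b)‖ < η := by
  have hc : Filter.Tendsto (fun y : (Fin g → ℝ) × (Fin g → ℝ) =>
      (symMatrix t).mulVec (realVec y.1) + realVec y.2) (𝓝 0) (𝓝 0) := by
    have : Continuous fun y : (Fin g → ℝ) × (Fin g → ℝ) =>
        (symMatrix t).mulVec (realVec y.1) + realVec y.2 := by
      have hr : Continuous (realVec (g := g)) := by unfold realVec; fun_prop
      exact (Continuous.matrix_mulVec continuous_const (hr.comp continuous_fst)).add
        (hr.comp continuous_snd)
    refine this.tendsto' 0 0 ?_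
    have : realVec (0 : Fin g → ℝ) = 0 := by ext i; simp [realVec]
    simp [this]
  obtain ⟨r, hr, hball⟩ := Metric.eventually_nhds_iff.1 (hc.eventually (Metric.ball_mem_nhds 0 hη))
  obtain ⟨n, hn, a, b, h⟩ := exists_nat_smul_near_int p q (lt_min hr one_pos) N
  refine ⟨n, hn, a, b, fun i => (h i).1.trans_le (min_le_right _ _), ?_⟩
  have h1 := @hball (fun i => n * p i - a i, fun i => n * q i - b i) (by
    rw [dist_zero_right, Prod.norm_def, max_lt_iff]
    exact ⟨(pi_norm_lt_iff hr).2 fun i => (h i).1.trans_le (min_le_left _ _),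
      (pi_norm_lt_iff hr).2 fun i => (h i).2.trans_le (min_le_left _ _)⟩)
  rw [dist_zero_right] at h1
  have e1 : realVec (fun i => n * p i - a i) = (n : ℂ) • realVec p - intVec a := by
    ext i; simp [realVec, intVec]
  have e2 : realVec (fun i => n * q i - b i) = (n : ℂ) • realVec q - intVec b := by
    ext i; simp [realVec, intVec]
  have e3 : (n : ℂ) • ((symMatrix t).mulVec (realVec p) + realVec q) -
      ((symMatrix t).mulVec (intVec a) + intVec b) =
      (symMatrix t).mulVec (realVec fun i => n * p i - a i) + realVec fun i => n * q i - b i := by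
    rw [e1, e2, Matrix.mulVec_sub, Matrix.mulVec_smul, smul_add]
    abel
  rw [e3]
  exact h1

lemma thetaSum_hasDerivAt_add_smul {t : SymCoord g} (ht : t ∈ siegelSet g) (s : List (Fin g → ℂ))
    (w v : Fin g → ℂ) : HasDerivAt (fun r : ℂ => thetaSum ε δ s (t, w + r • v))
      (thetaSum ε δ (v :: s) (t, w)) 0 := by
  have h1 : HasDerivAt (fun r : ℂ => w + r • v) v 0 := by
    simpa using ((hasDerivAt_id (0 : ℂ)).smul_const v).const_add w
  have h2 := (thetaSum_slice_hasFDerivAt (ε := ε) (δ := δ) ht s (w + (0 : ℂ) • v)).comp_hasDerivAt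
    (0 : ℂ) h1
  refine h2.congr_deriv ?_
  rw [zero_smul, add_zero]
  exact thetaSum_fderiv_snd (x := (t, w)) ht v

/-- The exponent of the factor of automorphy for the period `τ a + b`. -/
def periodExponent (ε δ : Fin g → ZMod 2) (t : SymCoord g) (a b : Fin g → ℤ) (w : Fin g → ℂ) : ℂ :=
  Real.pi * Complex.I * (-(intVec a ⬝ᵥ (symMatrix t).mulVec (intVec a))
    - 2 * (intVec a ⬝ᵥ w) - intVec a ⬝ᵥ charVec δ + charVec ε ⬝ᵥ intVec b)

lemma periodExponent_hasDerivAt (t : SymCoord g) (a b : Fin g → ℤ) (w v : Fin g → ℂ) :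
    HasDerivAt (fun r : ℂ => Complex.exp (periodExponent ε δ t a b (w + r • v)))
      (Complex.exp (periodExponent ε δ t a b w) * (-(2 * Real.pi * Complex.I) * (intVec a ⬝ᵥ v)))
      0 := by
  have e : (fun r : ℂ => periodExponent ε δ t a b (w + r • v)) = fun r =>
      periodExponent ε δ t a b w + r * (-(2 * Real.pi * Complex.I) * (intVec a ⬝ᵥ v)) := by
    ext r
    simp only [periodExponent, dotProduct_add, dotProduct_smul, smul_eq_mul]
    ring
  have h1 : HasDerivAt (fun r : ℂ => periodExponent ε δ t a b (w + r • v))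
      (-(2 * Real.pi * Complex.I) * (intVec a ⬝ᵥ v)) 0 := by
    rw [e]
    refine (((hasDerivAt_id (0 : ℂ)).mul_const _).const_add _).congr_deriv ?_
    rw [one_mul]
  simpa using h1.cexp

lemma norm_exp_periodExponent (t : SymCoord g) (a b : Fin g → ℤ) (w : Fin g → ℂ) :
    ‖Complex.exp (periodExponent ε δ t a b w)‖ =
      Real.exp (Real.pi * ((fun i => (a i : ℝ)) ⬝ᵥ
        ((symMatrix t).map Complex.im).mulVec (fun i => (a i : ℝ)) +
        2 * ∑ i, a i * (w i).im)) := by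
  have h1 : (intVec a ⬝ᵥ (symMatrix t).mulVec (intVec a)).im = (fun i => (a i : ℝ)) ⬝ᵥ
        ((symMatrix t).map Complex.im).mulVec (fun i => (a i : ℝ)) := by
    simp [dotProduct, Matrix.mulVec, intVec, Complex.im_sum]
  have h2 : (intVec a ⬝ᵥ w).im = ∑ i, a i * (w i).im := by
    simp [dotProduct, intVec, Complex.im_sum]
  rw [Complex.norm_exp, ← h1, ← h2, periodExponent, charVec_eq, charVec_eq, intVec_dot, intVec_dot]
  congr 1
  simp only [Complex.mul_re, Complex.mul_im, Complex.ofReal_re, Complex.ofReal_im, Complex.I_re,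
    Complex.I_im, Complex.add_im, Complex.sub_im, Complex.neg_im, Complex.intCast_im,
    Complex.re_ofNat, Complex.im_ofNat]
  ring

/-- The quasi-periodicity relation is differentiated twice. As `F` and `dF` vanish at the translated
point, they vanish at `w`, so all terms containing derivatives of the exponential factor drop out.
-/
lemma hessian_add_period {t : SymCoord g} (ht : t ∈ siegelSet g) (a b : Fin g → ℤ)
    {w : Fin g → ℂ}
    (h0 : thetaSum ε δ [] (t, w + ((symMatrix t).mulVec (intVec a) + intVec b)) = 0)
    (h1 : ∀ i, thetaSum ε δ [Pi.single i 1]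
      (t, w + ((symMatrix t).mulVec (intVec a) + intVec b)) = 0) (i j : Fin g) :
    thetaSum ε δ [Pi.single i 1, Pi.single j 1]
        (t, w + ((symMatrix t).mulVec (intVec a) + intVec b)) =
      Complex.exp (periodExponent ε δ t a b w) *
        thetaSum ε δ [Pi.single i 1, Pi.single j 1] (t, w) := by
  set ω := (symMatrix t).mulVec (intVec a) + intVec b with hω
  have p0 : ∀ w, thetaSum ε δ [] (t, w + ω) =
      Complex.exp (periodExponent ε δ t a b w) * thetaSum ε δ [] (t, w) := fun w =>
    thetaSum_add_period t w a b
  have p1 : ∀ w v, thetaSum ε δ [v] (t, w + ω) = Complex.exp (periodExponent ε δ t a b w) *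
      (-(2 * Real.pi * Complex.I) * (intVec a ⬝ᵥ v) * thetaSum ε δ [] (t, w) +
        thetaSum ε δ [v] (t, w)) := fun w v => by
    have d1 := thetaSum_hasDerivAt_add_smul (ε := ε) (δ := δ) ht [] (w + ω) v
    have d2 := (periodExponent_hasDerivAt (ε := ε) (δ := δ) t a b w v).mul
      (thetaSum_hasDerivAt_add_smul (ε := ε) (δ := δ) ht [] w v)
    have e : (fun r : ℂ => thetaSum ε δ [] (t, w + ω + r • v)) =
        (fun r : ℂ => Complex.exp (periodExponent ε δ t a b (w + r • v))) *
          fun r : ℂ => thetaSum ε δ [] (t, w + r • v) := by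
      ext r
      rw [Pi.mul_apply, ← p0]
      congr 2
      abel
    rw [e] at d1
    rw [d1.unique d2, zero_smul, add_zero]
    ring
  have hne : Complex.exp (periodExponent ε δ t a b w) ≠ 0 := Complex.exp_ne_zero _
  have z0 : thetaSum ε δ [] (t, w) = 0 := by
    rw [p0] at h0
    exact (mul_eq_zero.1 h0).resolve_left hne
  have z1 : ∀ i, thetaSum ε δ [Pi.single i 1] (t, w) = 0 := fun i => by
    have := h1 i
    rw [p1, z0, mul_zero, zero_add] at this
    exact (mul_eq_zero.1 this).resolve_left hne
  have d1 := thetaSum_hasDerivAt_add_smul (ε := ε) (δ := δ) ht [Pi.single j 1] (w + ω)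
    (Pi.single i 1)
  have d2 := (periodExponent_hasDerivAt (ε := ε) (δ := δ) t a b w (Pi.single i 1)).mul
    (((thetaSum_hasDerivAt_add_smul (ε := ε) (δ := δ) ht [] w (Pi.single i 1)).const_mul
      (-(2 * Real.pi * Complex.I) * (intVec a ⬝ᵥ Pi.single j 1))).add
      (thetaSum_hasDerivAt_add_smul (ε := ε) (δ := δ) ht [Pi.single j 1] w (Pi.single i 1)))
  have e : (fun r : ℂ => thetaSum ε δ [Pi.single j 1] (t, w + ω + r • Pi.single i 1)) =
      (fun r : ℂ => Complex.exp (periodExponent ε δ t a b (w + r • Pi.single i 1))) *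
        ((fun r : ℂ => -(2 * Real.pi * Complex.I) * (intVec a ⬝ᵥ Pi.single j 1) *
          thetaSum ε δ [] (t, w + r • Pi.single i 1)) +
          fun r : ℂ => thetaSum ε δ [Pi.single j 1] (t, w + r • Pi.single i 1)) := by
    ext r
    rw [Pi.mul_apply, Pi.add_apply, ← p1]
    congr 2
    abel
  rw [e] at d1
  rw [d1.unique d2]
  simp [z0, z1]

/-- The growth of the theta function along a line of singular points whose Hessian is Gaussian. -/
lemma gaussian_growth {t : SymCoord g} (ht : t ∈ siegelSet g) {κ : Fin g → ℂ}
    (h0 : ∀ z : ℂ, thetaSum ε δ [] (t, z • κ) = 0)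
    (h1 : ∀ (z : ℂ) i, thetaSum ε δ [Pi.single i 1] (t, z • κ) = 0) {i₀ j₀ : Fin g}
    (hA : thetaSum ε δ [Pi.single i₀ 1, Pi.single j₀ 1] (t, 0) ≠ 0) {b : ℂ}
    (hb : ∀ z : ℂ, thetaSum ε δ [Pi.single i₀ 1, Pi.single j₀ 1] (t, z • κ) =
      thetaSum ε δ [Pi.single i₀ 1, Pi.single j₀ 1] (t, 0) * Complex.exp (b * z ^ 2))
    (ζ : ℂ) {p q : Fin g → ℝ} (hpq : ζ • κ = (symMatrix t).mulVec (realVec p) + realVec q) :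
    0 ≤ (b * ζ ^ 2).re ∧ ((b * ζ ^ 2).re = 0 → p = 0) := by
  set A := thetaSum ε δ [Pi.single i₀ 1, Pi.single j₀ 1] (t, 0) with hAdef
  obtain ⟨c, hc, hq⟩ := posDef_lower_bound ht
  have hApos : 0 < ‖A‖ := norm_pos_iff.2 hA
  have hcont : ∀ᶠ w in 𝓝 (0 : Fin g → ℂ),
      ‖A‖ / 2 < ‖thetaSum ε δ [Pi.single i₀ 1, Pi.single j₀ 1] (t, w)‖ :=
    (analyticAt_thetaSum_slice ht [Pi.single i₀ 1, Pi.single j₀ 1] 0).continuousAt.norm.eventually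
      (lt_mem_nhds (half_lt_self hApos))
  obtain ⟨r, hr, hball⟩ := Metric.eventually_nhds_iff.1 hcont
  -- Near a period the Hessian entry is the factor of automorphy times a value of norm at least `‖A‖
  -- / 2`; this half is the source of `log 2`. Taking the error `e` below `c / 4`, and using `|a| ≤
  -- a²` for integers, leaves `c / 2` of the quadratic form.
  have key : ∀ N : ℕ, ∃ n : ℕ, N ≤ n ∧ ∃ a : Fin g → ℤ, (∀ i, |n * p i - a i| < 1) ∧
      Real.pi * (c / 2) * ∑ i, (a i : ℝ) ^ 2 - Real.log 2 ≤ (n : ℝ) ^ 2 * (b * ζ ^ 2).re := by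
    intro N
    obtain ⟨n, hn, a, m, ha, hw⟩ := exists_nat_smul_near_period t p q
      (lt_min hr (by positivity : 0 < c / 4)) N
    refine ⟨n, hn, a, ha, ?_⟩
    rw [← hpq] at hw
    set ω := (symMatrix t).mulVec (intVec a) + intVec m with hω
    set e := (n : ℂ) • ζ • κ - ω with he
    have hsum : e + ω = ((n : ℂ) * ζ) • κ := by rw [he, sub_add_cancel, smul_smul]
    have hH := hessian_add_period (ε := ε) (δ := δ) ht a m (w := e) (by rw [hsum, h0])
      (fun i => by rw [hsum, h1]) i₀ j₀
    rw [hsum, hb] at hH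
    have hH' := congrArg norm hH
    rw [norm_mul, norm_mul, Complex.norm_exp, norm_exp_periodExponent] at hH'
    have hre : (b * ((n : ℂ) * ζ) ^ 2).re = (n : ℝ) ^ 2 * (b * ζ ^ 2).re := by
      have : b * ((n : ℂ) * ζ) ^ 2 = (((n : ℝ) ^ 2 : ℝ) : ℂ) * (b * ζ ^ 2) := by push_cast; ring
      rw [this, Complex.re_ofReal_mul]
    rw [hre] at hH'
    have hF := @hball e (by rw [dist_zero_right]; exact hw.trans_le (min_le_left _ _))
    have hexp : Real.pi * (c / 2) * ∑ i, (a i : ℝ) ^ 2 ≤ Real.pi * ((fun i => (a i : ℝ)) ⬝ᵥ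
        ((symMatrix t).map Complex.im).mulVec (fun i => (a i : ℝ)) +
        2 * ∑ i, a i * (e i).im) := by
      have h2 := hq fun i => (a i : ℝ)
      have h3 : -(c / 4 * ∑ i, (a i : ℝ) ^ 2) ≤ ∑ i, a i * (e i).im := by
        rw [Finset.mul_sum, ← Finset.sum_neg_distrib]
        refine Finset.sum_le_sum fun i _ => ?_
        have h4 : |(e i).im| ≤ c / 4 := (Complex.abs_im_le_norm _).trans
          ((norm_le_pi_norm e i).trans (hw.le.trans (min_le_right _ _)))
        have h5 : |(a i : ℝ)| ≤ (a i : ℝ) ^ 2 := by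
          have : |a i| ≤ a i ^ 2 := by
            rw [← sq_abs]
            rcases (abs_nonneg (a i)).eq_or_lt with h | h
            · simp [← h]
            · nlinarith
          exact_mod_cast this
        have h6 : |(a i : ℝ) * (e i).im| ≤ c / 4 * (a i : ℝ) ^ 2 := by
          rw [abs_mul, mul_comm]
          gcongr
        linarith [neg_abs_le ((a i : ℝ) * (e i).im)]
      have h4 : c / 2 * ∑ i, (a i : ℝ) ^ 2 ≤ (fun i => (a i : ℝ)) ⬝ᵥ
          ((symMatrix t).map Complex.im).mulVec (fun i => (a i : ℝ)) +
          2 * ∑ i, a i * (e i).im := by linarith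
      calc _ = Real.pi * (c / 2 * ∑ i, (a i : ℝ) ^ 2) := by ring
        _ ≤ _ := by gcongr
    set X := Real.pi * (c / 2) * ∑ i, (a i : ℝ) ^ 2
    have h7 : Real.exp X * (‖A‖ / 2) ≤ ‖A‖ * Real.exp ((n : ℝ) ^ 2 * (b * ζ ^ 2).re) := by
      rw [hH']
      gcongr
    have h8 : Real.exp (X - Real.log 2) ≤ Real.exp ((n : ℝ) ^ 2 * (b * ζ ^ 2).re) := by
      rw [Real.exp_sub, Real.exp_log two_pos]
      have : ‖A‖ * (Real.exp X / 2) ≤ ‖A‖ * Real.exp ((n : ℝ) ^ 2 * (b * ζ ^ 2).re) := by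
        linarith
      exact le_of_mul_le_mul_left this hApos
    exact Real.exp_le_exp.1 h8
  have hlog : 0 < Real.log 2 := Real.log_pos one_lt_two
  constructor
  · by_contra! hneg
    obtain ⟨N, hN⟩ := exists_nat_gt (Real.log 2 / -(b * ζ ^ 2).re)
    -- `N + 1` ensures `n ≥ 1`, so that `N ≤ n ≤ n²`.
    obtain ⟨n, hn, a, -, ha⟩ := key (N + 1)
    rw [div_lt_iff₀ (by linarith)] at hN
    have h2 : 0 ≤ Real.pi * (c / 2) * ∑ i, (a i : ℝ) ^ 2 := by positivity
    have hn1 : (N : ℝ) + 1 ≤ n := by exact_mod_cast hn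
    have hn2 : (N : ℝ) ≤ (n : ℝ) ^ 2 := by
      have : (0 : ℝ) ≤ N := Nat.cast_nonneg N
      nlinarith
    nlinarith
  · intro hz
    ext i
    by_contra hp
    have hp' : 0 < |p i| := abs_pos.2 hp
    set R := Real.log 2 / (Real.pi * (c / 2)) with hR
    have hR0 : 0 ≤ R := by positivity
    -- With zero growth the integer vectors `a` stay bounded, while `a i` is within `1` of `n * p
    -- i`, which is unbounded if `p i ≠ 0`.
    obtain ⟨N, hN⟩ := exists_nat_gt ((R + 2) / |p i|)
    obtain ⟨n, hn, a, ha1, ha⟩ := key N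
    rw [hz, mul_zero] at ha
    rw [div_lt_iff₀ hp'] at hN
    have h2 : ∑ i, (a i : ℝ) ^ 2 ≤ R := by
      rw [hR, le_div_iff₀ (by positivity)]
      linarith
    have h3 : (a i : ℝ) ^ 2 ≤ R := (Finset.single_le_sum (f := fun i => (a i : ℝ) ^ 2)
      (fun i _ => sq_nonneg _) (Finset.mem_univ i)).trans h2
    have h4 : |(a i : ℝ)| ≤ R + 1 := by
      rw [← sq_abs] at h3
      nlinarith [sq_nonneg (|(a i : ℝ)| - 1)]
    have h5 : |n * p i| < R + 2 := by
      have := abs_add_le (n * p i - a i) (a i)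
      rw [sub_add_cancel] at this
      linarith [ha1 i]
    rw [abs_mul, Nat.abs_cast] at h5
    have h6 : (N : ℝ) * |p i| ≤ n * |p i| := by gcongr
    linarith

/-- A degenerate even point of the theta divisor is a singular point of the singular locus. -/
theorem not_isNonsingularAt_of_degenerate (he : IsEvenChar ε δ) {t : SymCoord g}
    (ht : t ∈ siegelSet g) (h0 : thetaSum ε δ [] (t, 0) = 0) {κ : Fin g → ℂ} (hκ0 : κ ≠ 0)
    (hκ : ∀ i, thetaSum ε δ [Pi.single i 1, κ] (t, 0) = 0) :
    ¬ IsNonsingularAt (thetaSys ε δ) (t, 0) := by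
  intro hn
  obtain ⟨i₀, j₀, hA⟩ := exists_hessian_entry_ne_zero he ht hn
  obtain ⟨b, hb⟩ := exists_gaussian_hessian he ht h0 hn hκ hA
  have hv := thetaSum_vanish_on_kernel_line he ht h0 hn hκ
  obtain ⟨p, q, hpq⟩ := exists_real_coordinates ht ((1 : ℂ) • κ)
  obtain ⟨p', q', hpq'⟩ := exists_real_coordinates ht (Complex.I • κ)
  have g1 := gaussian_growth ht (fun z => (hv z).1) (fun z => (hv z).2.1) hA hb 1 hpq
  have g2 := gaussian_growth ht (fun z => (hv z).1) (fun z => (hv z).2.1) hA hb Complex.I hpq'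
  simp only [one_pow, mul_one, Complex.I_sq, mul_neg, Complex.neg_re] at g1 g2
  -- The choices `ζ = 1` and `ζ = i` give `Re b ≥ 0` and `-Re b ≥ 0`.
  have hre : b.re = 0 := le_antisymm (by linarith [g2.1]) g1.1
  have hz : realVec (0 : Fin g → ℝ) = 0 := by ext i; simp [realVec]
  rw [g1.2 hre, hz, Matrix.mulVec_zero, zero_add, one_smul] at hpq
  rw [g2.2 (by rw [hre, neg_zero]), hz, Matrix.mulVec_zero, zero_add] at hpq'
  refine hκ0 (funext fun i => Complex.ext ?_ ?_)
  · have := congrArg Complex.im (congrFun hpq' i)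
    simpa [realVec] using this
  · rw [hpq]
    simp [realVec]

end Recurrence

/-! ### Smoothness at points with nondegenerate Hessian -/

section Nondegenerate

variable {g : ℕ} {ε δ : Fin g → ZMod 2}

/-- A relation among the differentials, evaluated on `z`-directions, puts the coefficients of the
`d(∂ᵢF)` in the kernel of the Hessian. Evaluated on `τ`-directions, it then kills the coefficient of
`dF`, since the Hessian is nonzero for `g ≥ 1`. -/
lemma isNonsingularAt_of_nondegenerate (hg : 1 ≤ g) (he : IsEvenChar ε δ) {t : SymCoord g}
    (ht : t ∈ siegelSet g) (h0 : thetaSum ε δ [] (t, 0) = 0)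
    (hnd : ∀ κ, (∀ i, thetaSum ε δ [Pi.single i 1, κ] (t, 0) = 0) → κ = 0) :
    IsNonsingularAt (thetaSys ε δ) (t, 0) := by
  have hodd : ∀ v, thetaSum ε δ [v] (t, 0) = 0 := fun v => thetaSum_odd_zero he t ⟨0, rfl⟩
  refine isNonsingularAt_of_linearIndependent (fun o => ?_) (fun o => ?_) ?_
  · cases o <;> exact thetaSum_analyticAt ε δ _ ht
  · cases o with
    | none => exact h0
    | some i => exact hodd _
  refine Fintype.linearIndependent_iff.2 fun c hc => ?_
  have hc' : ∀ d, c none * fderiv ℂ (thetaSum ε δ []) (t, 0) d +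
      ∑ i, c (some i) * fderiv ℂ (thetaSum ε δ [Pi.single i 1]) (t, 0) d = 0 := fun d => by
    have := DFunLike.congr_fun hc d
    rw [Fintype.sum_option] at this
    simpa [thetaSys_none, thetaSys_some] using this
  have hsome : (fun i => c (some i)) = 0 := hnd _ fun i => by
    have := hc' (0, Pi.single i 1)
    simp only [thetaSum_fderiv_snd (x := (t, 0)) ht, hodd, mul_zero, zero_add] at this
    rw [thetaSum_swap, thetaSum_cons_eq_sum (x := (t, 0)) ht, ← this]
    exact Finset.sum_congr rfl fun j _ => by rw [thetaSum_swap]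
  have hsome' : ∀ i, c (some i) = 0 := fun i => congrFun hsome i
  have hnone : c none = 0 := by
    by_contra hne
    have hz : (Pi.single ⟨0, hg⟩ 1 : Fin g → ℂ) = 0 := hnd _ fun i => by
      have := hc' (symDir (Pi.single i 1) (Pi.single ⟨0, hg⟩ 1), 0)
      simp only [hsome', zero_mul, Finset.sum_const_zero, add_zero,
        thetaSum_fderiv_symDir (x := (t, 0)) ht] at this
      exact ((mul_eq_zero.1 ((mul_eq_zero.1 this).resolve_left hne)).resolve_left
        (inv_ne_zero Complex.two_pi_I_ne_zero))
    simpa using congrFun hz ⟨0, hg⟩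
  intro o
  cases o with
  | none => exact hnone
  | some i => exact hsome' i

end Nondegenerate

/-! ### Transport from half-periods to the origin -/

section Transport

lemma germsInIdeal_of_unit {E ι : Type*} [NormedAddCommGroup E] [NormedSpace ℂ E] [Fintype ι]
    [DecidableEq ι] {f h : Option ι → E → ℂ} {p : E} {e : E → ℂ} {r : ι → E → ℂ}
    (he : AnalyticAt ℂ e p) (hr : ∀ i, AnalyticAt ℂ (r i) p)
    (h0 : ∀ᶠ x in 𝓝 p, f none x = e x * h none x)
    (h1 : ∀ i, ∀ᶠ x in 𝓝 p, f (some i) x = r i x * h none x + e x * h (some i) x) :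
    GermsInIdeal f h p := by
  intro o
  cases o with
  | none =>
    refine ⟨fun o x => o.elim (e x) fun _ => 0, fun o => ?_, ?_⟩
    · cases o
      · exact he
      · exact analyticAt_const
    · filter_upwards [h0] with x hx
      rw [Fintype.sum_option]
      simpa using hx
  | some i =>
    refine ⟨fun o x => o.elim (r i x) fun j => if j = i then e x else 0, fun o => ?_, ?_⟩
    · cases o with
      | none => exact hr i
      | some j =>
        by_cases hj : j = i
        · simpa [hj] using he
        · simpa [hj] using analyticAt_const
    · filter_upwards [h1 i] with x hx
      rw [Fintype.sum_option]
      simpa using hx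

variable {g : ℕ} {ε δ : Fin g → ZMod 2}

/-- The linear part `(τ, w) ↦ (τ, w + τ a)` of a translation along the fibres. -/
def shearMap (a : Fin g → ℂ) :
    SymCoord g × (Fin g → ℂ) →L[ℂ] SymCoord g × (Fin g → ℂ) :=
  LinearMap.toContinuousLinearMap
    { toFun := fun x => (x.1, x.2 + (symMatrix x.1).mulVec a)
      map_add' := fun x y => by
        have : symMatrix (x + y).1 = symMatrix x.1 + symMatrix y.1 := rfl
        rw [this, Matrix.add_mulVec]
        ext <;> simp
        ring
      map_smul' := fun c x => by
        have : symMatrix (c • x).1 = c • symMatrix x.1 := rfl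
        rw [this, Matrix.smul_mulVec]
        simp }

lemma shearMap_apply (a : Fin g → ℂ) (x : SymCoord g × (Fin g → ℂ)) :
    shearMap a x = (x.1, x.2 + (symMatrix x.1).mulVec a) := rfl

/-- The translation `(τ, w) ↦ (τ, w + τ a + b)`. -/
def shiftMap (a b : Fin g → ℂ) (x : SymCoord g × (Fin g → ℂ)) : SymCoord g × (Fin g → ℂ) :=
  shearMap a x + (0, b)

lemma shiftMap_eq (a b : Fin g → ℂ) (x : SymCoord g × (Fin g → ℂ)) :
    shiftMap a b x = (x.1, x.2 + ((symMatrix x.1).mulVec a + b)) := by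
  simp [shiftMap, shearMap_apply, add_assoc]

lemma shiftMap_shiftMap_neg (a b : Fin g → ℂ) (x : SymCoord g × (Fin g → ℂ)) :
    shiftMap a b (shiftMap (-a) (-b) x) = x := by
  simp only [shiftMap_eq, Matrix.mulVec_neg]
  refine Prod.ext rfl ?_
  dsimp only
  abel

lemma shiftMap_neg_shiftMap (a b : Fin g → ℂ) (x : SymCoord g × (Fin g → ℂ)) :
    shiftMap (-a) (-b) (shiftMap a b x) = x := by
  simp only [shiftMap_eq, Matrix.mulVec_neg]
  refine Prod.ext rfl ?_
  dsimp only
  abel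

lemma analyticAt_shiftMap (a b : Fin g → ℂ) (x : SymCoord g × (Fin g → ℂ)) :
    AnalyticAt ℂ (shiftMap a b) x :=
  ((shearMap a).analyticAt x).add analyticAt_const

lemma fderiv_shiftMap (a b : Fin g → ℂ) (x : SymCoord g × (Fin g → ℂ)) :
    fderiv ℂ (shiftMap a b) x = shearMap a :=
  ((shearMap a).hasFDerivAt.add_const _).fderiv

lemma shearMap_surjective (a : Fin g → ℂ) : Function.Surjective (shearMap a) := fun y =>
  ⟨(y.1, y.2 - (symMatrix y.1).mulVec a), by simp [shearMap_apply]⟩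

lemma analyticAt_dot_symMatrix (v w : Fin g → ℂ) (x : SymCoord g × (Fin g → ℂ)) :
    AnalyticAt ℂ (fun x : SymCoord g × (Fin g → ℂ) => v ⬝ᵥ (symMatrix x.1).mulVec w) x := by
  simp only [dotProduct, Matrix.mulVec, Finset.mul_sum]
  refine Finset.analyticAt_fun_sum _ fun i _ => Finset.analyticAt_fun_sum _ fun j _ => ?_
  exact analyticAt_const.mul ((((ContinuousLinearMap.proj (R := ℂ)
    (φ := fun _ : Sym2 (Fin g) => ℂ) s(i, j)).comp (ContinuousLinearMap.fst ℂ _ _)).analyticAt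
      x).mul analyticAt_const)

lemma analyticAt_dot_snd (v : Fin g → ℂ) (x : SymCoord g × (Fin g → ℂ)) :
    AnalyticAt ℂ (fun x : SymCoord g × (Fin g → ℂ) => v ⬝ᵥ x.2) x := by
  simp only [dotProduct]
  refine Finset.analyticAt_fun_sum _ fun i _ => ?_
  exact analyticAt_const.mul (((ContinuousLinearMap.proj (R := ℂ)
    (φ := fun _ : Fin g => ℂ) i).comp (ContinuousLinearMap.snd ℂ _ _)).analyticAt x)

/-- The theta function, translated by `τ (m + ε / 2) + (n + δ / 2)`, is the theta function with
characteristic `[ε, δ]` up to a unit. -/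
lemma exists_theta_shift (ε δ : Fin g → ZMod 2) (m n : Fin g → ℤ) :
    ∃ q : SymCoord g × (Fin g → ℂ) → ℂ, (∀ x, AnalyticAt ℂ q x) ∧ ∀ x,
      thetaSum 0 0 [] (shiftMap (intVec m + (1 / 2 : ℂ) • charVec ε)
        (intVec n + (1 / 2 : ℂ) • charVec δ) x) = Complex.exp (q x) * thetaSum ε δ [] x := by
  refine ⟨fun x => Real.pi * Complex.I *
      (-(1 / 4 * (charVec ε ⬝ᵥ (symMatrix x.1).mulVec (charVec ε))) -
        (charVec ε ⬝ᵥ x.2 + (charVec ε ⬝ᵥ (symMatrix x.1).mulVec (intVec m) +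
          charVec ε ⬝ᵥ intVec n)) - 1 / 2 * (charVec ε ⬝ᵥ charVec δ)) +
      Real.pi * Complex.I * (-(intVec m ⬝ᵥ (symMatrix x.1).mulVec (intVec m))
        - 2 * (intVec m ⬝ᵥ x.2) - intVec m ⬝ᵥ charVec δ + charVec ε ⬝ᵥ intVec n),
    fun x => ?_, fun x => ?_⟩
  · have h1 := analyticAt_dot_symMatrix (charVec ε) (charVec ε) x
    have h2 := analyticAt_dot_snd (charVec ε) x
    have h3 := analyticAt_dot_symMatrix (charVec ε) (intVec m) x
    have h4 := analyticAt_dot_symMatrix (intVec m) (intVec m) x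
    have h5 := analyticAt_dot_snd (intVec m) x
    fun_prop
  · obtain ⟨t, w⟩ := x
    have e : shiftMap (intVec m + (1 / 2 : ℂ) • charVec ε) (intVec n + (1 / 2 : ℂ) • charVec δ)
        (t, w) = (t, (w + ((symMatrix t).mulVec (intVec m) + intVec n)) +
          (1 / 2 : ℂ) • ((symMatrix t).mulVec (charVec ε) + charVec δ)) := by
      rw [shiftMap_eq, Matrix.mulVec_add, Matrix.mulVec_smul, smul_add]
      refine Prod.ext rfl ?_
      dsimp only
      abel
    rw [e, theta_half_period, thetaSum_add_period, Complex.exp_add]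
    simp only [dotProduct_add]
    ring

lemma singEq_eq_thetaSys {x : SymCoord g × (Fin g → ℂ)} (hx : x.1 ∈ siegelSet g)
    (o : Option (Fin g)) : singEq g o x = thetaSys 0 0 o x := by
  cases o with
  | none => exact theta_eq x.1 x.2
  | some i =>
    change fderiv ℂ (theta x.1) x.2 (Pi.single i 1) = _
    have : theta x.1 = fun w => thetaSum 0 0 [] (x.1, w) := funext fun w => theta_eq x.1 w
    rw [this, fderiv_thetaSum_slice hx]
    rfl

/-- Up to a unit and a translation, the equations of the singular locus near a half-period are
those for the theta function with characteristic near the origin. -/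
lemma exists_singEq_shift (ε δ : Fin g → ZMod 2) (m n : Fin g → ℤ) :
    ∃ (e : SymCoord g × (Fin g → ℂ) → ℂ) (r : Fin g → SymCoord g × (Fin g → ℂ) → ℂ),
      (∀ x, AnalyticAt ℂ e x) ∧ (∀ x, e x ≠ 0) ∧ (∀ i x, AnalyticAt ℂ (r i) x) ∧
      ∀ x : SymCoord g × (Fin g → ℂ), x.1 ∈ siegelSet g →
        singEq g none (shiftMap (intVec m + (1 / 2 : ℂ) • charVec ε)
          (intVec n + (1 / 2 : ℂ) • charVec δ) x) = e x * thetaSys ε δ none x ∧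
        ∀ i, singEq g (some i) (shiftMap (intVec m + (1 / 2 : ℂ) • charVec ε)
          (intVec n + (1 / 2 : ℂ) • charVec δ) x) =
            r i x * thetaSys ε δ none x + e x * thetaSys ε δ (some i) x := by
  obtain ⟨q, hq, h⟩ := exists_theta_shift ε δ m n
  set a := intVec m + (1 / 2 : ℂ) • charVec ε
  set b := intVec n + (1 / 2 : ℂ) • charVec δ
  refine ⟨fun x => Complex.exp (q x),
    fun i x => Complex.exp (q x) * fderiv ℂ q x (0, Pi.single i 1), fun x => (hq x).cexp,
    fun x => Complex.exp_ne_zero _, fun i x => (hq x).cexp.mul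
      (((ContinuousLinearMap.apply ℂ ℂ
        ((0, Pi.single i 1) : SymCoord g × (Fin g → ℂ))).analyticAt _).comp (hq x).fderiv),
    fun x hx => ?_⟩
  have hx' : (shiftMap a b x).1 ∈ siegelSet g := by rw [shiftMap_eq]; exact hx
  refine ⟨by rw [singEq_eq_thetaSys hx']; exact h x, fun i => ?_⟩
  rw [singEq_eq_thetaSys hx', thetaSys_some, ← thetaSum_fderiv_snd hx']
  have h1 : HasFDerivAt (thetaSum 0 0 [] ∘ shiftMap a b)
      ((fderiv ℂ (thetaSum 0 0 []) (shiftMap a b x)).comp (shearMap a)) x := by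
    refine HasFDerivAt.comp x (thetaSum_differentiableAt [] hx').hasFDerivAt ?_
    rw [← fderiv_shiftMap a b x]
    exact (analyticAt_shiftMap a b x).differentiableAt.hasFDerivAt
  have h2 : HasFDerivAt (fun x => Complex.exp (q x) * thetaSum ε δ [] x)
      (Complex.exp (q x) • fderiv ℂ (thetaSum ε δ []) x +
        thetaSum ε δ [] x • (Complex.exp (q x) • fderiv ℂ q x)) x :=
    (hq x).differentiableAt.hasFDerivAt.cexp.mul (thetaSum_differentiableAt [] hx).hasFDerivAt
  have h3 : thetaSum 0 0 [] ∘ shiftMap a b = fun x => Complex.exp (q x) * thetaSum ε δ [] x :=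
    funext h
  rw [h3] at h1
  have h4 := DFunLike.congr_fun (h1.unique h2) (0, Pi.single i 1)
  have h5 : shearMap a (0, Pi.single i 1) = (0, Pi.single i 1) := by
    have : symMatrix (0 : SymCoord g) = 0 := rfl
    simp [shearMap_apply, this]
  rw [ContinuousLinearMap.comp_apply, h5] at h4
  rw [h4, thetaSys_none, thetaSys_some, ← thetaSum_fderiv_snd hx]
  simp only [add_apply, smul_apply, smul_eq_mul]
  ring

/-- The point `(τ, τ (m + ε / 2) + (n + δ / 2))`. -/
def halfPeriod (ε δ : Fin g → ZMod 2) (m n : Fin g → ℤ) (t : SymCoord g) : Fin g → ℂ :=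
  (symMatrix t).mulVec (intVec m + (1 / 2 : ℂ) • charVec ε) + (intVec n + (1 / 2 : ℂ) • charVec δ)

lemma shiftMap_zero (ε δ : Fin g → ZMod 2) (m n : Fin g → ℤ) (t : SymCoord g) :
    shiftMap (intVec m + (1 / 2 : ℂ) • charVec ε) (intVec n + (1 / 2 : ℂ) • charVec δ) (t, 0) =
      (t, halfPeriod ε δ m n t) := by
  rw [shiftMap_eq, zero_add]
  rfl

lemma singEq_halfPeriod_eq_zero {t : SymCoord g} (ht : t ∈ siegelSet g) (m n : Fin g → ℤ)
    (h : ∀ o, thetaSys ε δ o (t, 0) = 0) (o : Option (Fin g)) :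
    singEq g o (t, halfPeriod ε δ m n t) = 0 := by
  obtain ⟨e, r, -, -, -, hs⟩ := exists_singEq_shift ε δ m n
  rw [← shiftMap_zero]
  cases o with
  | none => rw [(hs (t, 0) ht).1, h, mul_zero]
  | some i => rw [(hs (t, 0) ht).2, h, h, mul_zero, mul_zero, add_zero]

/-- The translation is an automorphism of `(τ, z)`-space, and the two systems differ by a triangular
matrix of functions with the unit `e` on its diagonal, so they generate the same ideal. The integral
vectors `m, n` cover all representatives of a point of `A_τ`. -/
lemma isNonsingularAt_halfPeriod_iff {t : SymCoord g} (ht : t ∈ siegelSet g) (m n : Fin g → ℤ) :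
    IsNonsingularAt (singEq g) (t, halfPeriod ε δ m n t) ↔
      IsNonsingularAt (thetaSys ε δ) (t, 0) := by
  obtain ⟨e, r, he, he0, hr, hs⟩ := exists_singEq_shift ε δ m n
  rw [← shiftMap_zero]
  set a := intVec m + (1 / 2 : ℂ) • charVec ε
  set b := intVec n + (1 / 2 : ℂ) • charVec δ
  have hev := eventually_fst_mem_siegelSet (x := (t, (0 : Fin g → ℂ))) ht
  have i1 : GermsInIdeal (fun o => singEq g o ∘ shiftMap a b) (thetaSys ε δ) (t, 0) :=
    germsInIdeal_of_unit (he _) (fun i => hr i _) (hev.mono fun x hx => (hs x hx).1)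
      fun i => hev.mono fun x hx => (hs x hx).2 i
  have i2 : GermsInIdeal (thetaSys ε δ) (fun o => singEq g o ∘ shiftMap a b) (t, 0) := by
    refine germsInIdeal_of_unit (e := fun x => (e x)⁻¹) (r := fun i x => -(r i x * (e x)⁻¹ * (e x)⁻¹))
      ((he _).inv (he0 _)) (fun i => (((hr i _).mul ((he _).inv (he0 _))).mul
        ((he _).inv (he0 _))).neg) (hev.mono fun x hx => ?_) fun i => hev.mono fun x hx => ?_
    · rw [Function.comp_apply, (hs x hx).1, inv_mul_cancel_left₀ (he0 x)]
    · rw [Function.comp_apply, Function.comp_apply, (hs x hx).1, (hs x hx).2]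
      have := he0 x
      field_simp
      ring
  constructor
  · intro h
    refine (IsNonsingularAt.comp (analyticAt_shiftMap a b _) ?_ h).of_ideal_eq i2 i1
    rw [fderiv_shiftMap]
    exact shearMap_surjective a
  · intro h
    have h1 := h.of_ideal_eq i1 i2
    rw [← shiftMap_neg_shiftMap a b (t, 0)] at h1
    have h2 := IsNonsingularAt.comp (analyticAt_shiftMap (-a) (-b) _) (by
      rw [fderiv_shiftMap]
      exact shearMap_surjective _) h1
    convert h2 using 2 with o
    ext x
    simp [shiftMap_shiftMap_neg]

end Transport

/-! ### Rank of the Hessian and the equality of the two loci -/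

section Main

variable {g : ℕ} {ε δ : Fin g → ZMod 2}

lemma rank_le_pred_iff (hg : 1 ≤ g) (H : Matrix (Fin g) (Fin g) ℂ) :
    H.rank ≤ g - 1 ↔ ∃ κ, κ ≠ 0 ∧ H.mulVec κ = 0 := by
  rw [Matrix.exists_mulVec_eq_zero_iff]
  constructor
  · intro h
    by_contra hdet
    have hu : IsUnit H := (Matrix.isUnit_iff_isUnit_det H).2 (isUnit_iff_ne_zero.2 hdet)
    have := Matrix.rank_of_isUnit H hu
    rw [Fintype.card_fin] at this
    omega
  · intro hdet
    by_contra h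
    have hle := H.rank_le_width
    have hr : H.rank = g := by omega
    have htop : H.mulVecLin.range = ⊤ := Submodule.eq_top_of_finrank_eq (by
      rw [Module.finrank_fintype_fun_eq_card, Fintype.card_fin]
      exact hr)
    have hu : IsUnit H := Matrix.mulVec_surjective_iff_isUnit.1 (LinearMap.range_eq_top.1 htop)
    exact (isUnit_iff_ne_zero.1 ((Matrix.isUnit_iff_isUnit_det H).1 hu)) hdet

lemma hessian_thetaChar {t : SymCoord g} (ht : t ∈ siegelSet g) (i j : Fin g) :
    hessian (thetaChar ε δ t) 0 i j = thetaSum ε δ [Pi.single i 1, Pi.single j 1] (t, 0) := by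
  have h1 : thetaChar ε δ t = fun w => thetaSum ε δ [] (t, w) := funext fun w => thetaChar_eq t w
  have h2 : partialZ j (thetaChar ε δ t) = fun w => thetaSum ε δ [Pi.single j 1] (t, w) := by
    ext w
    rw [partialZ, h1, fderiv_thetaSum_slice ht]
  rw [hessian, Matrix.of_apply, h2, partialZ, fderiv_thetaSum_slice ht]

lemma hessian_mulVec_eq_zero_iff {t : SymCoord g} (ht : t ∈ siegelSet g) (κ : Fin g → ℂ) :
    (hessian (thetaChar ε δ t) 0).mulVec κ = 0 ↔
      ∀ i, thetaSum ε δ [Pi.single i 1, κ] (t, 0) = 0 := by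
  rw [funext_iff]
  refine forall_congr' fun i => ?_
  have : (hessian (thetaChar ε δ t) 0).mulVec κ i = thetaSum ε δ [Pi.single i 1, κ] (t, 0) := by
    rw [thetaSum_swap, thetaSum_cons_eq_sum (x := (t, 0)) ht, Matrix.mulVec, dotProduct]
    refine Finset.sum_congr rfl fun j _ => ?_
    rw [hessian_thetaChar ht, thetaSum_swap, mul_comm]
  rw [this, Pi.zero_apply]

lemma isNonsingularAt_thetaSys_iff (hg : 1 ≤ g) (he : IsEvenChar ε δ) {t : SymCoord g}
    (ht : t ∈ siegelSet g) (h0 : thetaSum ε δ [] (t, 0) = 0) :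
    IsNonsingularAt (thetaSys ε δ) (t, 0) ↔ ¬ (hessian (thetaChar ε δ t) 0).rank ≤ g - 1 := by
  rw [rank_le_pred_iff hg]
  simp only [hessian_mulVec_eq_zero_iff ht]
  constructor
  · rintro h ⟨κ, hκ0, hκ⟩
    exact not_isNonsingularAt_of_degenerate he ht h0 hκ0 hκ h
  · intro h
    push Not at h
    refine isNonsingularAt_of_nondegenerate hg he ht h0 fun κ hκ => ?_
    by_contra hne
    obtain ⟨i, hi⟩ := h κ hne
    exact hi (hκ i)

lemma halfPeriod_zero (τ : Siegel g) (ε δ : Fin g → ZMod 2) :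
    (1 / 2 : ℂ) • (τ.mat.mulVec (charVec ε) + charVec δ) = halfPeriod ε δ 0 0 τ.1 := by
  have : intVec (0 : Fin g → ℤ) = 0 := by ext i; simp [intVec]
  rw [halfPeriod, this, zero_add, zero_add, Matrix.mulVec_smul, smul_add]
  rfl

lemma halfPeriod_add_period (τ : Siegel g) (ε δ : Fin g → ZMod 2) (mn : (Fin g → ℤ) × (Fin g → ℤ)) :
    halfPeriod ε δ 0 0 τ.1 + periodHom τ mn = halfPeriod ε δ mn.1 mn.2 τ.1 := by
  have h0 : intVec (0 : Fin g → ℤ) = 0 := by ext i; simp [intVec]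
  have h : periodHom τ mn = (symMatrix τ.1).mulVec (intVec mn.1) + intVec mn.2 := rfl
  rw [h, halfPeriod, halfPeriod, h0, zero_add, zero_add, Matrix.mulVec_add]
  abel

lemma point_eq_point {τ τ' : Siegel g} {z z' : Fin g → ℂ}
    (h : UnivFamily.point τ z = UnivFamily.point τ' z') :
    τ = τ' ∧ ∃ mn, z' = z + periodHom τ mn := by
  obtain ⟨rfl, h2⟩ := Sigma.mk.inj_iff.1 h
  obtain ⟨mn, hmn⟩ := QuotientAddGroup.eq.1 (eq_of_heq h2)
  exact ⟨rfl, mn, by rw [hmn]; abel⟩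

lemma theta_halfPeriod_eq_zero_iff (τ : Siegel g) (ε δ : Fin g → ZMod 2) :
    theta τ.1 ((1 / 2 : ℂ) • (τ.mat.mulVec (charVec ε) + charVec δ)) = 0 ↔
      thetaSum ε δ [] (τ.1, 0) = 0 := by
  have h := theta_half_period τ.1 0 ε δ
  rw [zero_add] at h
  rw [theta_eq]
  change thetaSum 0 0 [] (τ.1, (1 / 2 : ℂ) • ((symMatrix τ.1).mulVec (charVec ε) + charVec δ)) = 0 ↔ _
  rw [h, mul_eq_zero, or_iff_right (Complex.exp_ne_zero _)]

theorem thetaNull_eq_image (hg : 1 ≤ g) :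
    thetaNull g (g - 1) = UnivFamily.toSiegel '' (singNull g ∩ singOfSingLocus g) := by
  ext τ
  constructor
  · rintro ⟨ε, δ, he, h0, hr⟩
    rw [thetaChar_eq] at h0
    have ht : τ.1 ∈ siegelSet g := τ.2
    refine ⟨UnivFamily.point τ (halfPeriod ε δ 0 0 τ.1), ⟨⟨τ, ε, δ, he, ?_, ?_⟩,
      τ, _, rfl, ?_, ?_⟩, rfl⟩
    · rw [halfPeriod_zero]
    · exact (theta_halfPeriod_eq_zero_iff τ ε δ).2 h0
    · refine singEq_halfPeriod_eq_zero ht 0 0 fun o => ?_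
      cases o with
      | none => exact h0
      | some i => exact thetaSum_odd_zero he _ ⟨0, rfl⟩
    · rw [isNonsingularAt_halfPeriod_iff ht, isNonsingularAt_thetaSys_iff hg he ht h0, not_not]
      exact hr
  · rintro ⟨x, ⟨⟨τ₁, ε, δ, he, hx, hθ⟩, τ₂, z, hx', -, hns⟩, rfl⟩
    rw [halfPeriod_zero] at hx
    -- The representative `z` at which singularity is tested may differ from the half-period by a
    -- lattice vector `mn`.
    obtain ⟨rfl, mn, hz⟩ := point_eq_point (hx.symm.trans hx')
    have ht : τ₁.1 ∈ siegelSet g := τ₁.2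
    have h0 := (theta_halfPeriod_eq_zero_iff τ₁ ε δ).1 hθ
    rw [hz, halfPeriod_add_period, isNonsingularAt_halfPeriod_iff ht,
      isNonsingularAt_thetaSys_iff hg he ht h0, not_not] at hns
    rw [hx]
    exact ⟨ε, δ, he, by rw [thetaChar_eq]; exact h0, hns⟩

end Main

end ThetaNull

end

theorem mainTheorem3 (g : ℕ) (hg : 1 ≤ g) :
    ThetaNull.thetaNull g (g - 1) =
        ThetaNull.UnivFamily.toSiegel '' (ThetaNull.singNull g ∩ ThetaNull.singOfSingLocus g) ∧
      ThetaNull.thetaNullModuli g (g - 1) =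
        ThetaNull.UnivFamily.proj '' (ThetaNull.singNull g ∩ ThetaNull.singOfSingLocus g) := by
  refine ⟨ThetaNull.thetaNull_eq_image hg, ?_⟩
  rw [ThetaNull.thetaNullModuli, ThetaNull.thetaNull_eq_image hg, Set.image_image]
  rfl
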